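/- **Weighted Bishop inequality.** *Setting.* Let $n\ge 1$ and let $M$ be a smooth manifold of dimension $n+1$. Let $L:TM\to\mathbb R$ be a Lorentz–Finsler structure: $L$ is $C^\infty$ on $TM\setminus\{0\}$, $L(rv)=r^2L(v)$ for all $r>0$, and for every $v\neq0$ the Hessian $g_v=(g_{\alpha\beta}(v))=\big(\partial^2L/\partial v^\alpha\partial v^\beta(v)\big)$ is nondegenerate of signature $(-,+,\dots,+)$. Let $M$ be time oriented by a smooth vector field $T$ with $L(T)<0$. Let $\Omega_x$ be the connected component of $\{v\in T_xM: L(v)<0\}$ containing $T(x)$ (the future-directed timelike vectors), and let $\psi:\bigcup_x(\overline{\Omega}_x\setminus\{0\})\to\mathbb R$ be $C^\infty$ with $\psi(rv)=\psi(v)$ for $r>0$. In local coordinates (with summation over repeated indices) let $\widetilde\Gamma^\alpha_{\beta\gamma}=\frac12 g^{\alpha\delta}(\partial_{x^\beta}g_{\delta\gamma}+\partial_{x^\gamma}g_{\beta\delta}-\partial_{x^\delta}g_{\beta\gamma})$, $G^\alpha=\frac12\widetilde\Gamma^\alpha_{\beta\gamma}v^\beta v^\gamma$, $N^\alpha_\beta=\partial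 G^\alpha/\partial v^\beta$, $\Gamma^\alpha_{\beta\gamma}=\widetilde\Gamma^\alpha_{\beta\gamma}-\frac12g^{\alpha\delta}(\partial_{v^\mu}g_{\delta\gamma}N^\mu_\beta+\partial_{v^\mu}g_{\beta\delta}N^\mu_\gamma-\partial_{v^\mu}g_{\beta\gamma}N^\mu_\delta)$, and let $$R^\alpha_\beta(v)=2\partial_{x^\beta}G^\alpha-\big(\partial_{x^\gamma}N^\alpha_\beta\, v^\gamma-2\,\partial_{v^\gamma}N^\alpha_\beta\, G^\gamma\big)-N^\alpha_\gamma N^\gamma_\beta$$ be the components of the curvature endomorphism $R_v$ of $T_xM$. Put $\mathrm{Ric}(v)=\mathrm{trace}(R_v)$. Geodesics are the smooth solutions of $\ddot\eta^\alpha+\widetilde\Gamma^\alpha_{\beta\gamma}(\dot\eta)\dot\eta^\beta\dot\eta^\gamma=0$. A vector field $X$ along $\eta$ has covariant derivative $X'$ with components $\dot X^\alpha+\Gamma^\alpha_{\beta\gamma}(\dot\eta)\dot\eta^\beta X^\gamma$. A field $E$ of endomorphisms along $\eta$ has derivative $E'(P)=E(P)'-E(P')$. For a nonzero vector $v\in\overline\Omega_x$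 let $\gamma:(-\delta,\delta)\to M$ be the geodesic with $\dot\gamma(0)=v$, and put $f=\psi(\dot\gamma)$. The weighted Ricci curvature is $$\mathrm{Ric}_N(v)=\mathrm{Ric}(v)+f''(0)-\frac{f'(0)^2}{N-n}\quad (N\in\mathbb R\setminus\{n\}),\qquad \mathrm{Ric}_{+\infty}(v)=\mathrm{Ric}(v)+f''(0),$$ and $\mathrm{Ric}_n(v)=\mathrm{Ric}(v)+f''(0)$ if $f'(0)=0$, $\mathrm{Ric}_n(v)=-\infty$ if $f'(0)\ne0$. *Hypotheses.* Let $I\subset\mathbb R$ be an interval with nonempty interior, and let $\eta:I\to M$ be a future-directed timelike geodesic of unit speed, $L(\dot\eta)\equiv-\frac12$. Let $N_\eta(t)\subset T_{\eta(t)}M$ be the $g_{\dot\eta(t)}$-orthogonal complement of $\dot\eta(t)$, and write $\psi_\eta(t)=\psi(\dot\eta(t))$. Let $\mathsf J(t):N_\eta(t)\to N_\eta(t)$, $t\in I$, be a nonsingular Lagrange tensor field along $\eta$. That is, $\mathsf J$ is a field of endomorphisms with $\mathsf J''+R_{\dot\eta}\mathsf J=0$, $\ker\mathsf J\cap\ker\mathsf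 J'=\{0\}$ and $(\mathsf J')^{\mathsf T}\mathsf J-\mathsf J^{\mathsf T}\mathsf J'=0$ (transposes with respect to $g_{\dot\eta}$), and every $\mathsf J(t)$ is invertible. Let $N\in(-\infty,0]\cup[n,+\infty]$ and let $\varepsilon\in\mathbb R$ be such that $$\varepsilon=0\ \text{ if } N=0,\qquad |\varepsilon|<\sqrt{\tfrac{N}{N-n}}\ \text{ if } N\ne0,$$ where the condition is void for $N=n$ and reads $|\varepsilon|<1$ for $N=+\infty$. Put $$c=c(N,\varepsilon)=\frac1n\Big(1-\varepsilon^2\,\frac{N-n}{N}\Big),\qquad c(0,0)=\frac1n,\qquad c(+\infty,\varepsilon)=\frac{1-\varepsilon^2}{n}.$$ Let $\tau=\tau_\varepsilon$ be a primitive on $I$ of $t\mapsto e^{2(\varepsilon-1)\psi_\eta(t)/n}$, denote by ${}^*$ the derivative with respect to $\tau$ (for instance $\xi^*=d(\xi\circ\tau^{-1})/d\tau$ and $\eta^*=d(\eta\circ\tau^{-1})/d\tau=e^{2(1-\varepsilon)\psi_\eta/n}\,\dot\eta$), and set $$\mathsf J_\psi(t)=e^{-\psi_\eta(t)/n}\,\mathsf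 J(t),\qquad \xi=|\det\mathsf J_\psi|^{c}.$$ *Conclusion.* Then $c>0$, $\xi$ is twice differentiable with respect to $\tau$, and on all of $I$ $$\xi^{**}\le -c\,\xi\,\mathrm{Ric}_N(\eta^*),$$ where the right-hand side is $+\infty$ at the points at which $\mathrm{Ric}_N(\eta^*)=-\infty$. -/

import Mathlib

open Set
open scoped Manifold ContDiff Topology

noncomputable section

namespace LorentzFinsler

/-- Coordinate space of an `(n+1)`-dimensional manifold; indices run over `0, …, n`. -/
abbrev Coord (n : ℕ) : Type := EuclideanSpace ℝ (Fin (n + 1))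

/-- The tangent bundle `TM`. -/
abbrev TM (n : ℕ) (M : Type*) [TopologicalSpace M] [ChartedSpace (Coord n) M] :=
  TangentBundle (𝓡 (n + 1)) M

/-! ### Lorentz-Finsler structures -/

section Metric

variable {n : ℕ} {M : Type*} [TopologicalSpace M] [ChartedSpace (Coord n) M]

/-- The fundamental tensor `g_v(a, b)`: the Hessian at `v` of the restriction of `L` to the vector
space `T_x M`, `x` being the base point of `v`. -/
def metric (L : TM n M → ℝ) (v : TM n M) :
    TangentSpace (𝓡 (n + 1)) v.proj →L[ℝ] TangentSpace (𝓡 (n + 1)) v.proj →L[ℝ] ℝ :=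
  fderiv ℝ (fun u : Coord n => fderiv ℝ (fun w : Coord n => L ⟨v.proj, w⟩) u) v.2

/-- The `g_v`-orthogonal complement of `v` in the tangent space at the base point of `v`. -/
def normalSpace (L : TM n M → ℝ) (v : TM n M) : Submodule ℝ (TangentSpace (𝓡 (n + 1)) v.proj) :=
  LinearMap.ker (metric L v v.2).toLinearMap

/-- `L` is a Lorentz-Finsler structure: smooth off the zero section, positively `2`-homogeneous, and
`g_v` is nondegenerate of signature `(-, +, …, +)` for all `v ≠ 0`. -/
structure IsLorentzFinsler [IsManifold (𝓡 (n + 1)) ∞ M] (L : TM n M → ℝ) : Prop where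
  smooth : ContMDiffOn (𝓡 (n + 1)).tangent 𝓘(ℝ, ℝ) ∞ L {v | v.2 ≠ 0}
  homogeneous : ∀ (v : TM n M) (r : ℝ), 0 < r → L ⟨v.proj, r • v.2⟩ = r ^ 2 * L v
  signature : ∀ v : TM n M, v.2 ≠ 0 →
    ∃ b : Module.Basis (Fin (n + 1)) ℝ (TangentSpace (𝓡 (n + 1)) v.proj),
      ∀ i j, metric L v (b i) (b j) = if i = j then (if i = 0 then -1 else 1) else 0

/-- A time orientation: a smooth vector field which is everywhere timelike (`L < 0`). -/
structure IsTimeOrientation [IsManifold (𝓡 (n + 1)) ∞ M] (L : TM n M → ℝ)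
    (T : ∀ x : M, TangentSpace (𝓡 (n + 1)) x) : Prop where
  smooth : ContMDiff (𝓡 (n + 1)) (𝓡 (n + 1)).tangent ∞ (fun x => (⟨x, T x⟩ : TM n M))
  timelike : ∀ x, L ⟨x, T x⟩ < 0

/-- The future cone `Ω_x`: the timelike vectors at `x` in the connected component of `T x`. -/
def futureCone (L : TM n M → ℝ) (T : ∀ x : M, TangentSpace (𝓡 (n + 1)) x) (x : M) :
    Set (TangentSpace (𝓡 (n + 1)) x) :=
  connectedComponentIn {u | L ⟨x, u⟩ < 0} (T x)

/-- `Ω`: the future-directed timelike vectors. -/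
def futureTimelike (L : TM n M → ℝ) (T : ∀ x : M, TangentSpace (𝓡 (n + 1)) x) : Set (TM n M) :=
  {v | v.2 ∈ futureCone L T v.proj}

/-- The future-directed causal vectors: the union over `x` of (closure of `Ω_x`) minus `0`. -/
def futureCausal (L : TM n M → ℝ) (T : ∀ x : M, TangentSpace (𝓡 (n + 1)) x) : Set (TM n M) :=
  {v | v.2 ∈ closure (futureCone L T v.proj) ∧ v.2 ≠ 0}

/-- A weight function: smooth and positively `0`-homogeneous on the future causal vectors
(its values elsewhere are irrelevant). -/
structure IsWeight [IsManifold (𝓡 (n + 1)) ∞ M] (L : TM n M → ℝ)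
    (T : ∀ x : M, TangentSpace (𝓡 (n + 1)) x) (ψ : TM n M → ℝ) : Prop where
  smooth : ContMDiffOn (𝓡 (n + 1)).tangent 𝓘(ℝ, ℝ) ∞ ψ (futureCausal L T)
  homogeneous : ∀ v ∈ futureCausal L T, ∀ r : ℝ, 0 < r → ψ ⟨v.proj, r • v.2⟩ = ψ v

end Metric

/-! ### Coordinate expressions

For functions `f x v` of the coordinates `(x^α, v^α)` of the tangent bundle. -/

section Coordinates

variable {n : ℕ}

/-- `∂f/∂x^α`. -/
def pdx (α : Fin (n + 1)) (f : Coord n → Coord n → ℝ) (x v : Coord n) : ℝ :=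
  fderiv ℝ (fun y => f y v) x (EuclideanSpace.single α 1)

/-- `∂f/∂v^α`. -/
def pdv (α : Fin (n + 1)) (f : Coord n → Coord n → ℝ) (x v : Coord n) : ℝ :=
  fderiv ℝ (fun w => f x w) v (EuclideanSpace.single α 1)

/-- `g_{αβ} = ∂²L/∂v^α∂v^β`, for a Lagrangian `ℓ` written in coordinates. -/
def gLow (ℓ : Coord n → Coord n → ℝ) (α β : Fin (n + 1)) : Coord n → Coord n → ℝ :=
  pdv α (pdv β ℓ)

/-- `g^{αβ}`, the inverse matrix of `g_{αβ}`. -/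
def gUp (ℓ : Coord n → Coord n → ℝ) (α β : Fin (n + 1)) (x v : Coord n) : ℝ :=
  (Matrix.of fun i j => gLow ℓ i j x v)⁻¹ α β

/-- The formal Christoffel symbols of the geodesic equation. -/
def christoffel (ℓ : Coord n → Coord n → ℝ) (α β γ : Fin (n + 1)) (x v : Coord n) : ℝ :=
  1 / 2 * ∑ δ, gUp ℓ α δ x v *
    (pdx β (gLow ℓ δ γ) x v + pdx γ (gLow ℓ β δ) x v - pdx δ (gLow ℓ β γ) x v)

/-- The geodesic spray coefficients `G^α`. -/
def spray (ℓ : Coord n → Coord n → ℝ) (α : Fin (n + 1)) (x v : Coord n) : ℝ :=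
  1 / 2 * ∑ β, ∑ γ, christoffel ℓ α β γ x v * v β * v γ

/-- The nonlinear connection `N^α_β = ∂G^α/∂v^β`. -/
def nonlin (ℓ : Coord n → Coord n → ℝ) (α β : Fin (n + 1)) : Coord n → Coord n → ℝ :=
  pdv β (spray ℓ α)

/-- The coefficients `Γ^α_{βγ}` of the Chern connection. -/
def chern (ℓ : Coord n → Coord n → ℝ) (α β γ : Fin (n + 1)) (x v : Coord n) : ℝ :=
  christoffel ℓ α β γ x v - 1 / 2 * ∑ δ, ∑ μ, gUp ℓ α δ x v *
    (pdv μ (gLow ℓ δ γ) x v * nonlin ℓ μ β x v + pdv μ (gLow ℓ β δ) x v * nonlin ℓ μ γ x v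
      - pdv μ (gLow ℓ β γ) x v * nonlin ℓ μ δ x v)

/-- The components `R^α_β(v)` of the curvature endomorphism `R_v`. -/
def curv (ℓ : Coord n → Coord n → ℝ) (α β : Fin (n + 1)) (x v : Coord n) : ℝ :=
  2 * pdx β (spray ℓ α) x v
    - ∑ γ, (pdx γ (nonlin ℓ α β) x v * v γ - 2 * pdv γ (nonlin ℓ α β) x v * spray ℓ γ x v)
    - ∑ γ, nonlin ℓ α γ x v * nonlin ℓ γ β x v

end Coordinates

/-! ### Geodesics and covariant derivatives along curves -/

section Curves

variable {n : ℕ} {M : Type*} [TopologicalSpace M] [ChartedSpace (Coord n) M]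

/-- The smooth charts of `M`. -/
def charts (n : ℕ) (M : Type*) [TopologicalSpace M] [ChartedSpace (Coord n) M] :
    Set (OpenPartialHomeomorph M (Coord n)) :=
  IsManifold.maximalAtlas (𝓡 (n + 1)) ∞ M

/-- The components in the chart `c` of a tangent vector at `p`. -/
def comp (c : OpenPartialHomeomorph M (Coord n)) (p : M) (w : TangentSpace (𝓡 (n + 1)) p) :
    Coord n :=
  mfderiv (𝓡 (n + 1)) (𝓡 (n + 1)) c p w

/-- The Lagrangian `L` written in the chart `c`: its value at the tangent vector
`∑ v^α ∂/∂x^α` at the point with coordinates `x`. -/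
def lagr (L : TM n M → ℝ) (c : OpenPartialHomeomorph M (Coord n)) (x v : Coord n) : ℝ :=
  L ⟨c.symm x, mfderiv (𝓡 (n + 1)) (𝓡 (n + 1)) c.symm x v⟩

/-- The velocity of a curve defined on a set `I` (one-sided at endpoints of `I`). -/
def velocity (η : ℝ → M) (I : Set ℝ) (t : ℝ) : TM n M :=
  ⟨η t, mfderivWithin 𝓘(ℝ, ℝ) (𝓡 (n + 1)) η I t (1 : ℝ)⟩

/-- The velocity in coordinates. -/
def coordVelocity (c : OpenPartialHomeomorph M (Coord n)) (η : ℝ → M) (I : Set ℝ) (t : ℝ) :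
    Coord n :=
  derivWithin (fun s => c (η s)) I t

/-- `η : I → M` is smooth and satisfies the geodesic equation in local coordinates. -/
structure IsGeodesicOn (L : TM n M → ℝ) (η : ℝ → M) (I : Set ℝ) : Prop where
  smooth : ContMDiffOn 𝓘(ℝ, ℝ) (𝓡 (n + 1)) ∞ η I
  equation : ∀ c ∈ charts n M, ∀ t ∈ I, η t ∈ c.source → ∀ α,
    derivWithin (coordVelocity c η I) I t α
      + ∑ β, ∑ γ, christoffel (lagr L c) α β γ (c (η t)) (coordVelocity c η I t)
          * coordVelocity c η I t β * coordVelocity c η I t γ = 0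

/-- In the chart `c`: the vector field `X` along `η` is differentiable at time `t`, and its
covariant derivative `dX^α/dt + Γ^α_{βγ}(η') η'^β X^γ` (with reference vector `η'`) is `y`. -/
def HasCovDerivIn (L : TM n M → ℝ) (c : OpenPartialHomeomorph M (Coord n)) (η : ℝ → M)
    (I : Set ℝ) (X : ∀ s, TangentSpace (𝓡 (n + 1)) (η s)) (t : ℝ)
    (y : TangentSpace (𝓡 (n + 1)) (η t)) : Prop :=
  ∀ α, HasDerivWithinAt (fun s => comp c (η s) (X s) α)
    (comp c (η t) y α - ∑ β, ∑ γ, chern (lagr L c) α β γ (c (η t)) (coordVelocity c η I t)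
      * coordVelocity c η I t β * comp c (η t) (X t) γ) I t

/-- A field of endomorphisms of the normal spaces `N_η(t)` along `η`. -/
abbrev NormalEnd (L : TM n M → ℝ) (η : ℝ → M) (I : Set ℝ) :=
  ∀ t : ℝ, Module.End ℝ (normalSpace L (velocity η I t))

/-- `E'` is the covariant derivative on `I` of the field of endomorphisms `E`:
`E(P)' = E'(P) + E(P')` at every time `t`, for all fields `P` in `N_η` which are
differentiable at `t`, with covariant derivative `q` there. -/
def IsTensorDeriv (L : TM n M → ℝ) (η : ℝ → M) (I : Set ℝ) (E E' : NormalEnd L η I) : Prop :=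
  ∀ c ∈ charts n M, ∀ t ∈ I, η t ∈ c.source →
    ∀ (P : ∀ s, normalSpace L (velocity η I s)) (q : normalSpace L (velocity η I t)),
      HasCovDerivIn L c η I (fun s => (P s).1) t q.1 →
        HasCovDerivIn L c η I (fun s => (E s (P s)).1) t (E' t (P t) + E t q).1

/-- `J` is a Jacobi tensor field along `η` with covariant derivative `J'`: `J'' + R J = 0`
(the existence of the derivatives is part of the condition)
and `ker J ∩ ker J' = 0`. -/
structure IsJacobiTensor (L : TM n M → ℝ) (η : ℝ → M) (I : Set ℝ) (J J' : NormalEnd L η I) :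
    Prop where
  deriv : IsTensorDeriv L η I J J'
  equation : ∃ J'' : NormalEnd L η I, IsTensorDeriv L η I J' J'' ∧
    ∀ c ∈ charts n M, ∀ t ∈ I, η t ∈ c.source → ∀ (a : normalSpace L (velocity η I t)) (α),
      comp c (η t) (J'' t a).1 α
        + ∑ β, curv (lagr L c) α β (c (η t)) (coordVelocity c η I t)
            * comp c (η t) (J t a).1 β = 0
  ker : ∀ t ∈ I, LinearMap.ker (J t) ⊓ LinearMap.ker (J' t) = ⊥

/-- `J` is a Lagrange tensor field along `η`: a Jacobi tensor field such that
`(J')ᵀ J - Jᵀ J' = 0`, with transposes taken with respect to `g_{η'}` on `N_η`. -/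
def IsLagrangeTensor (L : TM n M → ℝ) (η : ℝ → M) (I : Set ℝ) (J : NormalEnd L η I) : Prop :=
  ∃ J' : NormalEnd L η I, IsJacobiTensor L η I J J' ∧
    ∀ t ∈ I, ∀ a b : normalSpace L (velocity η I t),
      metric L (velocity η I t) (J t a).1 (J' t b).1
        - metric L (velocity η I t) (J' t a).1 (J t b).1 = 0

/-! ### Weighted Ricci curvature -/

/-- The Ricci curvature `Ric(v)`, the trace of `R_v` (computed in the preferred chart at the base
point of `v`). -/
def ric (L : TM n M → ℝ) (v : TM n M) : ℝ :=
  ∑ α, curv (lagr L (chartAt (Coord n) v.proj)) α α (chartAt (Coord n) v.proj v.proj)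
    (comp (chartAt (Coord n) v.proj) v.proj v.2)

open Classical in
/-- The geodesic `γ : (-δ, δ) → M` with initial velocity `v`. -/
def geodesicFrom (L : TM n M → ℝ) (v : TM n M) : ℝ → M :=
  if h : ∃ γ : ℝ → M, ∃ δ > 0, IsGeodesicOn L γ (Ioo (-δ) δ) ∧ velocity γ (Ioo (-δ) δ) 0 = v
  then h.choose else fun _ => v.proj

/-- `ψ_η(t) = ψ(η'(t))`. -/
def psiAlong (ψ : TM n M → ℝ) (η : ℝ → M) (I : Set ℝ) (t : ℝ) : ℝ :=
  ψ (velocity η I t)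

open Classical in
/-- The weighted Ricci curvature `Ric_N(v)`, for `N` real or `N = +∞`. The value `-∞` occurs for
`N = n`. -/
def ricN (L ψ : TM n M → ℝ) (N : EReal) (v : TM n M) : EReal :=
  let f : ℝ → ℝ := psiAlong ψ (geodesicFrom L v) univ
  if N = ⊤ then ((ric L v + deriv (deriv f) 0 : ℝ) : EReal)
  else if N = (n : EReal) then
    (if deriv f 0 = 0 then ((ric L v + deriv (deriv f) 0 : ℝ) : EReal) else ⊥)
  else ((ric L v + deriv (deriv f) 0 - deriv f 0 ^ 2 / (N.toReal - n) : ℝ) : EReal)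

end Curves

/-! ### The `ε`-proper time and the constant -/

/-- `τ` is an `ε`-proper time on `I`, i.e. a primitive of `exp (2 (ε - 1) ψ_η / n)`. -/
def IsProperTime (n : ℕ) (ε : ℝ) (ψη : ℝ → ℝ) (I : Set ℝ) (τ : ℝ → ℝ) : Prop :=
  ∀ t ∈ I, HasDerivWithinAt τ (Real.exp (2 * (ε - 1) / n * ψη t)) I t

/-- The inverse function `τ⁻¹ : τ(I) → I`. -/
def tauInv (τ : ℝ → ℝ) (I : Set ℝ) : ℝ → ℝ := Function.invFunOn τ I

/-- The derivative `f^* = d(f ∘ τ⁻¹)/dτ` of a function `f` on `I`, as a function of `t ∈ I`. -/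
def starDeriv (τ : ℝ → ℝ) (I : Set ℝ) (f : ℝ → ℝ) (t : ℝ) : ℝ :=
  derivWithin (f ∘ tauInv τ I) (τ '' I) (τ t)

/-- `η^* = d(η ∘ τ⁻¹)/dτ`, as a function of `t ∈ I`. -/
def starVelocity {n : ℕ} {M : Type*} [TopologicalSpace M] [ChartedSpace (Coord n) M]
    (τ : ℝ → ℝ) (I : Set ℝ) (η : ℝ → M) (t : ℝ) : TM n M :=
  velocity (η ∘ tauInv τ I) (τ '' I) (τ t)

/-- The timelike `ε`-range: `ε = 0` if `N = 0`, no condition if `N = n`, and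
`|ε| < √(N / (N - n))` otherwise (`|ε| < 1` for `N = +∞`). -/
def InTimelikeRange (n : ℕ) (N : EReal) (ε : ℝ) : Prop :=
  (N = 0 → ε = 0) ∧ (N = ⊤ → |ε| < 1) ∧
    (N ≠ 0 → N ≠ ⊤ → N ≠ (n : EReal) → |ε| < √(N.toReal / (N.toReal - n)))

open Classical in
/-- `c(N, ε) = (1 - ε² (N - n) / N) / n`, with `c(0, 0) = 1 / n` and
`c(+∞, ε) = (1 - ε²) / n`. -/
def cConst (n : ℕ) (N : EReal) (ε : ℝ) : ℝ :=
  if N = 0 then 1 / n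
  else if N = ⊤ then 1 / n * (1 - ε ^ 2)
  else 1 / n * (1 - ε ^ 2 * ((N.toReal - n) / N.toReal))

/-- `ξ = |det J_ψ|^c`, where `J_ψ = exp (-ψ_η / n) J`. -/
def xi {n : ℕ} {M : Type*} [TopologicalSpace M] [ChartedSpace (Coord n) M]
    (L ψ : TM n M → ℝ) (η : ℝ → M) (I : Set ℝ) (J : NormalEnd L η I) (c : ℝ) (t : ℝ) : ℝ :=
  |LinearMap.det (Real.exp (-psiAlong ψ η I t / n) • J t)| ^ c

end LorentzFinsler

end

/-!
The proof is the Lorentz-Finsler version of the classical argument: a Riccati equation for the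
expansion of the Lagrange tensor field, combined with a completed square in the weight.

Put `B = J' J⁻¹` and `θ = tr B`. The Jacobi equation gives the Riccati equation `B' = -R - B²`, so
that `(log |det J|)' = θ` and `θ' = -Ric - tr (B²)`. Since `J` is Lagrange, `B` is symmetric with
respect to `g_η'`, which is positive definite on the `n`-dimensional space `N_η`; hence
`θ² ≤ n tr (B²)` (`IsLagrangeTensor.exists_expansion`). With `a = ψ_η'` and `u = θ - a` the function
`ξ = (e^{-ψ_η} |det J|)^c` satisfies `ξ' = c u ξ`, and differentiating twice with respect to the
`ε`-proper time expresses `ξ**` through `u'`, `u²` and `a u` (`starDeriv_rpow`). For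
`k = (N - n) / N > 0` the remaining inequality is `(a + ε k u)² ≥ 0`, and the exceptional values
of `N` are similar (`le_neg_mul_ricN`).

The covariant derivatives are handled in coordinates. An endomorphism of `N_η` is extended by zero
on the line spanned by `η'` and written as a matrix in a chart; then the covariant derivative is the
ordinary derivative plus the commutator with the matrix `Γ^α_{βγ} v^β`, and commutators do not
contribute to traces (`IsTensorDeriv.matDerivWithin`, `riccati_trace`). For this one needs that the
orthogonal projection to `N_η` is parallel, which follows from the Euler-Lagrange equation for the
momentum `∂L/∂v^j` and from the compatibility of the Chern connection with `g` along geodesics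
(`IsCoordLagrangian.metric_compatible`), and that `R_v v = 0`
(`IsCoordLagrangian.sum_curv_mul`); both rest on Euler's theorem for homogeneous functions.

The weighted Ricci curvature of `η*` is defined by a geodesic with this initial velocity, which has
to be related to `η`. First, a geodesic with any nonzero initial velocity exists: the geodesic
equation is solved in one chart by the Picard-Lindelöf theorem, and as it is equivalent to the
Euler-Lagrange equation, its solutions are solutions in all charts (`exists_geodesic`). Secondly,
the first two derivatives of the weight along a geodesic are obtained by applying the geodesic
vector field `(v, -2G)` to `ψ`, hence depend on the initial velocity only, and are homogeneous of
degree one and two in it (`weight_derivatives_smul_velocity`). The second point uses that the set of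
future-directed timelike vectors is open (`eventually_futureTimelike`).
-/

noncomputable section

namespace LorentzFinsler

/-! ### Calculus of functions of coordinates and velocities -/

section CoordCalculus

variable {n : ℕ}

/-- The coordinate domain of the slit tangent bundle over `O`: pairs `(x, v)` with `v ≠ 0`. -/
def slit (O : Set (Coord n)) : Set (Coord n × Coord n) := O ×ˢ {0}ᶜ

/-- `f x v` is smooth for `x ∈ O` and `v ≠ 0`. -/
def SmoothOff (O : Set (Coord n)) (f : Coord n → Coord n → ℝ) : Prop :=
  ContDiffOn ℝ ∞ (fun p : Coord n × Coord n => f p.1 p.2) (slit O)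

/-- `f x v` is positively homogeneous of degree `k` in `v`, for `x ∈ O` and `v ≠ 0`. -/
def HomogOff (O : Set (Coord n)) (k : ℕ) (f : Coord n → Coord n → ℝ) : Prop :=
  ∀ x ∈ O, ∀ v : Coord n, v ≠ 0 → ∀ r : ℝ, 0 < r → f x (r • v) = r ^ k * f x v

variable {O : Set (Coord n)} {f g : Coord n → Coord n → ℝ} {x v : Coord n}

lemma isOpen_slit (hO : IsOpen O) : IsOpen (slit O) := hO.prod isOpen_compl_singleton

lemma mem_slit (hx : x ∈ O) (hv : v ≠ 0) : (x, v) ∈ slit O := ⟨hx, hv⟩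

lemma SmoothOff.contDiffAt (hf : SmoothOff O f) (hO : IsOpen O) (hx : x ∈ O) (hv : v ≠ 0) :
    ContDiffAt ℝ ∞ (fun p : Coord n × Coord n => f p.1 p.2) (x, v) :=
  ContDiffOn.contDiffAt hf ((isOpen_slit hO).mem_nhds (mem_slit hx hv))

lemma SmoothOff.differentiableAt (hf : SmoothOff O f) (hO : IsOpen O) (hx : x ∈ O) (hv : v ≠ 0) :
    DifferentiableAt ℝ (fun p : Coord n × Coord n => f p.1 p.2) (x, v) :=
  (hf.contDiffAt hO hx hv).differentiableAt (by simp)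

lemma SmoothOff.hasFDerivAt_snd (hf : SmoothOff O f) (hO : IsOpen O) (hx : x ∈ O) (hv : v ≠ 0) :
    HasFDerivAt (fun w => f x w)
      ((fderiv ℝ (fun p : Coord n × Coord n => f p.1 p.2) (x, v)).comp
        (ContinuousLinearMap.inr ℝ _ _)) v :=
  (hf.differentiableAt hO hx hv).hasFDerivAt.comp v (hasFDerivAt_prodMk_right x v)

lemma SmoothOff.hasFDerivAt_fst (hf : SmoothOff O f) (hO : IsOpen O) (hx : x ∈ O) (hv : v ≠ 0) :
    HasFDerivAt (fun y => f y v)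
      ((fderiv ℝ (fun p : Coord n × Coord n => f p.1 p.2) (x, v)).comp
        (ContinuousLinearMap.inl ℝ _ _)) x :=
  HasFDerivAt.comp (f := fun y => (y, v)) x (hf.differentiableAt hO hx hv).hasFDerivAt
    (hasFDerivAt_prodMk_left x v)

lemma SmoothOff.pdv_eq (hf : SmoothOff O f) (hO : IsOpen O) (hx : x ∈ O) (hv : v ≠ 0)
    (α : Fin (n + 1)) : pdv α f x v =
      fderiv ℝ (fun p : Coord n × Coord n => f p.1 p.2) (x, v) (0, EuclideanSpace.single α 1) := by
  simp [pdv, (hf.hasFDerivAt_snd hO hx hv).fderiv]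

lemma SmoothOff.pdx_eq (hf : SmoothOff O f) (hO : IsOpen O) (hx : x ∈ O) (hv : v ≠ 0)
    (α : Fin (n + 1)) : pdx α f x v =
      fderiv ℝ (fun p : Coord n × Coord n => f p.1 p.2) (x, v) (EuclideanSpace.single α 1, 0) := by
  simp [pdx, (hf.hasFDerivAt_fst hO hx hv).fderiv]

lemma coord_eq_sum (u : Coord n) : u = ∑ α, u α • EuclideanSpace.single α (1 : ℝ) := by
  ext i
  simp [Finset.sum_apply, Pi.single_apply]

lemma clm_eq_sum (D : Coord n →L[ℝ] ℝ) (u : Coord n) :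
    D u = ∑ α, D (EuclideanSpace.single α 1) * u α := by
  conv_lhs => rw [coord_eq_sum u]
  simp [map_sum, mul_comm]

/-- The total differential in terms of the partial derivatives. -/
lemma SmoothOff.fderiv_eq_sum (hf : SmoothOff O f) (hO : IsOpen O) (hx : x ∈ O) (hv : v ≠ 0)
    (a b : Coord n) :
    fderiv ℝ (fun p : Coord n × Coord n => f p.1 p.2) (x, v) (a, b) =
      ∑ α, pdx α f x v * a α + ∑ α, pdv α f x v * b α := by
  have h : ((a, b) : Coord n × Coord n) = (a, 0) + (0, b) := by simp
  rw [h, map_add]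
  congr 1
  · have := clm_eq_sum ((fderiv ℝ (fun p : Coord n × Coord n => f p.1 p.2) (x, v)).comp
        (ContinuousLinearMap.inl ℝ _ _)) a
    simpa [hf.pdx_eq hO hx hv] using this
  · have := clm_eq_sum ((fderiv ℝ (fun p : Coord n × Coord n => f p.1 p.2) (x, v)).comp
        (ContinuousLinearMap.inr ℝ _ _)) b
    simpa [hf.pdv_eq hO hx hv] using this

lemma SmoothOff.congr (hf : SmoothOff O f) (h : ∀ x ∈ O, ∀ v : Coord n, v ≠ 0 → g x v = f x v) :
    SmoothOff O g :=
  ContDiffOn.congr hf fun p hp => h p.1 hp.1 p.2 hp.2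

lemma SmoothOff.fderiv_apply (hf : SmoothOff O f) (hO : IsOpen O) (u : Coord n × Coord n) :
    SmoothOff O fun x v => fderiv ℝ (fun p : Coord n × Coord n => f p.1 p.2) (x, v) u :=
  (ContDiffOn.fderiv_of_isOpen hf (isOpen_slit hO) (m := ∞) (by simp)).clm_apply contDiffOn_const

lemma SmoothOff.dv (hf : SmoothOff O f) (hO : IsOpen O) (α : Fin (n + 1)) :
    SmoothOff O (pdv α f) :=
  (hf.fderiv_apply hO (0, EuclideanSpace.single α 1)).congr fun _ hx _ hv => hf.pdv_eq hO hx hv α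

lemma SmoothOff.dx (hf : SmoothOff O f) (hO : IsOpen O) (α : Fin (n + 1)) :
    SmoothOff O (pdx α f) :=
  (hf.fderiv_apply hO (EuclideanSpace.single α 1, 0)).congr fun _ hx _ hv => hf.pdx_eq hO hx hv α

lemma SmoothOff.add (hf : SmoothOff O f) (hg : SmoothOff O g) :
    SmoothOff O fun x v => f x v + g x v := ContDiffOn.add hf hg

lemma SmoothOff.sub (hf : SmoothOff O f) (hg : SmoothOff O g) :
    SmoothOff O fun x v => f x v - g x v := ContDiffOn.sub hf hg

lemma SmoothOff.mul (hf : SmoothOff O f) (hg : SmoothOff O g) :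
    SmoothOff O fun x v => f x v * g x v := ContDiffOn.mul hf hg

lemma SmoothOff.const (r : ℝ) : SmoothOff O fun _ _ => r := contDiffOn_const

lemma SmoothOff.sum {ι : Type*} {s : Finset ι} {F : ι → Coord n → Coord n → ℝ}
    (h : ∀ i, SmoothOff O (F i)) : SmoothOff O fun x v => ∑ i ∈ s, F i x v :=
  ContDiffOn.sum fun i _ => h i

lemma SmoothOff.prod {ι : Type*} {s : Finset ι} {F : ι → Coord n → Coord n → ℝ}
    (h : ∀ i, SmoothOff O (F i)) : SmoothOff O fun x v => ∏ i ∈ s, F i x v :=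
  contDiffOn_prod fun i _ => h i

lemma SmoothOff.coord (α : Fin (n + 1)) : SmoothOff O fun _ v => v α :=
  ((EuclideanSpace.proj (𝕜 := ℝ) α).contDiff.comp contDiff_snd).contDiffOn

/-! #### Symmetry of second derivatives -/

lemma SmoothOff.fderiv_comm (hf : SmoothOff O f) (hO : IsOpen O) (hx : x ∈ O) (hv : v ≠ 0)
    (u w : Coord n × Coord n) :
    fderiv ℝ (fun p => fderiv ℝ (fun p : Coord n × Coord n => f p.1 p.2) p u) (x, v) w =
      fderiv ℝ (fun p => fderiv ℝ (fun p : Coord n × Coord n => f p.1 p.2) p w) (x, v) u := by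
  have hc := hf.contDiffAt hO hx hv
  have hd : DifferentiableAt ℝ (fderiv ℝ (fun p : Coord n × Coord n => f p.1 p.2)) (x, v) :=
    (hc.fderiv_right (m := 1) (by norm_cast)).differentiableAt (by simp)
  have hs : IsSymmSndFDerivAt ℝ (fun p : Coord n × Coord n => f p.1 p.2) (x, v) :=
    hc.isSymmSndFDerivAt (by simp [minSmoothness_of_isRCLikeNormedField]; norm_cast)
  rw [fderiv_clm_apply hd (differentiableAt_const _),
    fderiv_clm_apply hd (differentiableAt_const _)]
  simpa using hs w u

lemma fderiv_congr_slit (hO : IsOpen O) (h : ∀ x ∈ O, ∀ v : Coord n, v ≠ 0 → g x v = f x v)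
    (hx : x ∈ O) (hv : v ≠ 0) :
    fderiv ℝ (fun p : Coord n × Coord n => g p.1 p.2) (x, v) =
      fderiv ℝ (fun p : Coord n × Coord n => f p.1 p.2) (x, v) := by
  apply Filter.EventuallyEq.fderiv_eq
  filter_upwards [(isOpen_slit hO).mem_nhds (mem_slit hx hv)] with p hp using h p.1 hp.1 p.2 hp.2

lemma pdv_congr (h : ∀ x ∈ O, ∀ v : Coord n, v ≠ 0 → g x v = f x v)
    (hx : x ∈ O) (hv : v ≠ 0) (α : Fin (n + 1)) : pdv α g x v = pdv α f x v := by
  unfold pdv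
  rw [Filter.EventuallyEq.fderiv_eq]
  filter_upwards [isOpen_compl_singleton.mem_nhds hv] with w hw using h x hx w hw

lemma pdx_congr (hO : IsOpen O) (h : ∀ x ∈ O, ∀ v : Coord n, v ≠ 0 → g x v = f x v)
    (hx : x ∈ O) (hv : v ≠ 0) (α : Fin (n + 1)) : pdx α g x v = pdx α f x v := by
  unfold pdx
  rw [Filter.EventuallyEq.fderiv_eq]
  filter_upwards [hO.mem_nhds hx] with y hy using h y hy v hv

lemma SmoothOff.pdv_comm (hf : SmoothOff O f) (hO : IsOpen O) (hx : x ∈ O) (hv : v ≠ 0)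
    (α β : Fin (n + 1)) :
    pdv α (pdv β f) x v = pdv β (pdv α f) x v := by
  rw [(hf.dv hO β).pdv_eq hO hx hv, (hf.dv hO α).pdv_eq hO hx hv,
    fderiv_congr_slit hO (fun y hy w hw => hf.pdv_eq hO hy hw β) hx hv,
    fderiv_congr_slit hO (fun y hy w hw => hf.pdv_eq hO hy hw α) hx hv]
  exact hf.fderiv_comm hO hx hv _ _

/-! #### Homogeneous functions -/

lemma HomogOff.dx {k : ℕ} (hf : HomogOff O k f) (hO : IsOpen O) (α : Fin (n + 1)) :
    HomogOff O k (pdx α f) := by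
  intro x hx v hv r hr
  unfold pdx
  have : (fun y => f y (r • v)) =ᶠ[𝓝 x] fun y => r ^ k • f y v := by
    filter_upwards [hO.mem_nhds hx] with y hy using hf y hy v hv r hr
  rw [this.fderiv_eq]
  change fderiv ℝ (r ^ k • fun y => f y v) x _ = _
  rw [fderiv_const_smul_field]
  simp

lemma HomogOff.dv {k : ℕ} (hf : HomogOff O (k + 1) f) (hs : SmoothOff O f) (hO : IsOpen O)
    (α : Fin (n + 1)) : HomogOff O k (pdv α f) := by
  intro x hx v hv r hr
  have hrv : r • v ≠ 0 := smul_ne_zero hr.ne' hv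
  have h1 : HasFDerivAt (fun w : Coord n => f x (r • w)) _ v :=
    (hs.hasFDerivAt_snd hO hx hrv).comp v ((hasFDerivAt_id v).const_smul r)
  have h2 : (fun w : Coord n => f x (r • w)) =ᶠ[𝓝 v] fun w => r ^ (k + 1) • f x w := by
    filter_upwards [isOpen_compl_singleton.mem_nhds hv] with w hw using hf x hx w hw r hr
  have h3 := congrArg (fun D => D (EuclideanSpace.single α 1)) (h1.fderiv.symm.trans h2.fderiv_eq)
  change _ = fderiv ℝ (r ^ (k + 1) • fun w => f x w) v _ at h3
  rw [fderiv_const_smul_field] at h3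
  simp only [ContinuousLinearMap.comp_apply, smul_apply, map_smul,
    ContinuousLinearMap.inr_apply, ContinuousLinearMap.id_apply] at h3
  rw [← hs.pdv_eq hO hx hrv, Pi.smul_apply, smul_apply, smul_eq_mul, smul_eq_mul, pow_succ',
    mul_assoc] at h3
  exact mul_left_cancel₀ hr.ne' h3

/-- Euler's theorem on homogeneous functions. -/
lemma HomogOff.euler {k : ℕ} (hf : HomogOff O k f) (hs : SmoothOff O f) (hO : IsOpen O)
    (hx : x ∈ O) (hv : v ≠ 0) : ∑ β, pdv β f x v * v β = k * f x v := by
  have h1 : HasDerivAt (fun r : ℝ => r • v) v 1 := by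
    simpa using (hasDerivAt_id (1 : ℝ)).smul_const v
  have h0 : HasFDerivAt (fun w => f x w) (fderiv ℝ (fun w => f x w) v) ((1 : ℝ) • v) := by
    rw [one_smul]
    exact (hs.hasFDerivAt_snd hO hx hv).differentiableAt.hasFDerivAt
  have h2 := h0.comp_hasDerivAt (1 : ℝ) h1
  have h3 : HasDerivAt (fun r : ℝ => r ^ k * f x v) (k * f x v) 1 := by
    simpa using (hasDerivAt_pow k (1 : ℝ)).mul_const (f x v)
  have h4 : (fun r : ℝ => f x (r • v)) =ᶠ[𝓝 1] fun r => r ^ k * f x v := by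
    filter_upwards [lt_mem_nhds one_pos] with r hr using hf x hx v hv r hr
  have h5 := (h3.congr_of_eventuallyEq h4).unique h2
  rw [h5, clm_eq_sum]
  rfl

lemma HomogOff.sum {ι : Type*} {s : Finset ι} {k : ℕ} {F : ι → Coord n → Coord n → ℝ}
    (h : ∀ i, HomogOff O k (F i)) : HomogOff O k fun x v => ∑ i ∈ s, F i x v := by
  intro x hx v hv r hr
  simp only [fun i => h i x hx v hv r hr, Finset.mul_sum]

lemma HomogOff.mul {k l : ℕ} (hf : HomogOff O k f) (hg : HomogOff O l g) :
    HomogOff O (k + l) fun x v => f x v * g x v := by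
  intro x hx v hv r hr
  simp only [hf x hx v hv r hr, hg x hx v hv r hr]
  ring

lemma HomogOff.add {k : ℕ} (hf : HomogOff O k f) (hg : HomogOff O k g) :
    HomogOff O k fun x v => f x v + g x v := by
  intro x hx v hv r hr
  simp only [hf x hx v hv r hr, hg x hx v hv r hr]
  ring

lemma HomogOff.sub {k : ℕ} (hf : HomogOff O k f) (hg : HomogOff O k g) :
    HomogOff O k fun x v => f x v - g x v := by
  intro x hx v hv r hr
  simp only [hf x hx v hv r hr, hg x hx v hv r hr]
  ring

lemma HomogOff.const (c : ℝ) : HomogOff O 0 fun _ _ => c := by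
  intro x hx v hv r hr
  simp

lemma HomogOff.coord (α : Fin (n + 1)) : HomogOff O 1 fun _ v => v α := by
  intro x hx v hv r hr
  simp

/-! #### Derivatives of contractions with the velocity -/

lemma pdx_sum_mul_coord {F : Fin (n + 1) → Coord n → Coord n → ℝ} (hF : ∀ γ, SmoothOff O (F γ))
    (hO : IsOpen O) (hx : x ∈ O) (hv : v ≠ 0) (α : Fin (n + 1)) :
    pdx α (fun x v => ∑ γ, F γ x v * v γ) x v = ∑ γ, pdx α (F γ) x v * v γ := by
  have h : HasFDerivAt (fun y => ∑ γ, F γ y v * v γ) _ x :=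
    HasFDerivAt.fun_sum fun γ (_ : γ ∈ Finset.univ) =>
      (((hF γ).hasFDerivAt_fst hO hx hv).mul_const (v γ))
  unfold pdx
  rw [h.fderiv]
  simp only [sum_apply, smul_apply, smul_eq_mul]
  refine Finset.sum_congr rfl fun γ _ => ?_
  rw [((hF γ).hasFDerivAt_fst hO hx hv).fderiv, mul_comm]

end CoordCalculus

/-! ### Lagrangians in coordinates -/

section CoordLagrangian

variable {n : ℕ}

/-- A Lorentz-Finsler Lagrangian written in coordinates `x ∈ O`: it is smooth and positively
`2`-homogeneous off the zero section, and has nondegenerate vertical Hessian. -/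
structure IsCoordLagrangian (O : Set (Coord n)) (ℓ : Coord n → Coord n → ℝ) : Prop where
  isOpen : IsOpen O
  smooth : SmoothOff O ℓ
  homog : HomogOff O 2 ℓ
  isUnit_det : ∀ x ∈ O, ∀ v : Coord n, v ≠ 0 →
    IsUnit (Matrix.of fun i j => gLow ℓ i j x v).det

variable {O : Set (Coord n)} {ℓ : Coord n → Coord n → ℝ} {x v : Coord n}

namespace IsCoordLagrangian

lemma smooth_gLow (h : IsCoordLagrangian O ℓ) (α β : Fin (n + 1)) : SmoothOff O (gLow ℓ α β) :=
  (h.smooth.dv h.isOpen β).dv h.isOpen α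

lemma homog_dv (h : IsCoordLagrangian O ℓ) (α : Fin (n + 1)) : HomogOff O 1 (pdv α ℓ) :=
  h.homog.dv h.smooth h.isOpen α

lemma homog_gLow (h : IsCoordLagrangian O ℓ) (α β : Fin (n + 1)) : HomogOff O 0 (gLow ℓ α β) :=
  (h.homog_dv β).dv (h.smooth.dv h.isOpen β) h.isOpen α

lemma gLow_symm (h : IsCoordLagrangian O ℓ) (hx : x ∈ O) (hv : v ≠ 0) (α β : Fin (n + 1)) :
    gLow ℓ α β x v = gLow ℓ β α x v := h.smooth.pdv_comm h.isOpen hx hv α β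

/-- The Cartan tensor `∂g_{βγ}/∂v^α` is totally symmetric. -/
lemma pdv_gLow_symm (h : IsCoordLagrangian O ℓ) (hx : x ∈ O) (hv : v ≠ 0) (α β γ : Fin (n + 1)) :
    pdv α (gLow ℓ β γ) x v = pdv β (gLow ℓ α γ) x v :=
  (h.smooth.dv h.isOpen γ).pdv_comm h.isOpen hx hv α β

lemma pdv_gLow_symm' (h : IsCoordLagrangian O ℓ) (hx : x ∈ O) (hv : v ≠ 0) (α β γ : Fin (n + 1)) :
    pdv α (gLow ℓ β γ) x v = pdv α (gLow ℓ γ β) x v :=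
  pdv_congr (fun _ hx _ hv => h.gLow_symm hx hv β γ) hx hv α

lemma pdx_gLow_symm (h : IsCoordLagrangian O ℓ) (hx : x ∈ O) (hv : v ≠ 0) (α β γ : Fin (n + 1)) :
    pdx α (gLow ℓ β γ) x v = pdx α (gLow ℓ γ β) x v :=
  pdx_congr h.isOpen (fun _ hx _ hv => h.gLow_symm hx hv β γ) hx hv α

lemma sum_gLow_mul (h : IsCoordLagrangian O ℓ) (hx : x ∈ O) (hv : v ≠ 0) (α : Fin (n + 1)) :
    ∑ β, gLow ℓ α β x v * v β = pdv α ℓ x v := by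
  have := (h.homog_dv α).euler (h.smooth.dv h.isOpen α) h.isOpen hx hv
  simp only [Nat.cast_one, one_mul] at this
  rw [← this]
  exact Finset.sum_congr rfl fun β _ => by rw [h.gLow_symm hx hv]; rfl

lemma sum_sum_gLow_mul (h : IsCoordLagrangian O ℓ) (hx : x ∈ O) (hv : v ≠ 0) :
    ∑ α, ∑ β, gLow ℓ α β x v * v α * v β = 2 * ℓ x v := by
  have := h.homog.euler h.smooth h.isOpen hx hv
  push_cast at this
  rw [← this]
  refine Finset.sum_congr rfl fun α _ => ?_
  rw [← h.sum_gLow_mul hx hv, Finset.sum_mul]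
  exact Finset.sum_congr rfl fun β _ => by ring

/-- The Cartan tensor annihilates the velocity. -/
lemma sum_pdv_gLow_mul (h : IsCoordLagrangian O ℓ) (hx : x ∈ O) (hv : v ≠ 0) (α β : Fin (n + 1)) :
    ∑ γ, pdv γ (gLow ℓ α β) x v * v γ = 0 := by
  simpa using (h.homog_gLow α β).euler (h.smooth_gLow α β) h.isOpen hx hv

lemma sum_gLow_gUp (h : IsCoordLagrangian O ℓ) (hx : x ∈ O) (hv : v ≠ 0) (α β : Fin (n + 1)) :
    ∑ γ, gLow ℓ α γ x v * gUp ℓ γ β x v = if α = β then 1 else 0 := by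
  have := congrFun (congrFun (Matrix.mul_nonsing_inv _ (h.isUnit_det x hx v hv)) α) β
  simpa [Matrix.mul_apply, Matrix.one_apply, gUp] using this

lemma _root_.LorentzFinsler.SmoothOff.det {F : Fin (n + 1) → Fin (n + 1) → Coord n → Coord n → ℝ}
    (hF : ∀ i j, SmoothOff O (F i j)) :
    SmoothOff O fun x v => (Matrix.of fun i j => F i j x v).det := by
  simp only [Matrix.det_apply']
  exact SmoothOff.sum fun σ => (SmoothOff.const _).mul (SmoothOff.prod fun i => hF _ _)

lemma smooth_gUp (h : IsCoordLagrangian O ℓ) (α β : Fin (n + 1)) : SmoothOff O (gUp ℓ α β) := by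
  have hd : SmoothOff O fun x v => ((Matrix.of fun i j => gLow ℓ i j x v).det)⁻¹ :=
    ContDiffOn.inv (SmoothOff.det h.smooth_gLow)
      fun p hp => (h.isUnit_det p.1 hp.1 p.2 hp.2).ne_zero
  have ha : SmoothOff O fun x v => (Matrix.of fun i j => gLow ℓ i j x v).adjugate α β := by
    have : SmoothOff O fun x v => (Matrix.of fun i j =>
        (if i = β then fun _ _ => (Pi.single α (1 : ℝ) : Fin (n + 1) → ℝ) j
          else gLow ℓ i j) x v).det := by
      refine SmoothOff.det fun i j => ?_
      split_ifs
      · exact SmoothOff.const _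
      · exact h.smooth_gLow i j
    refine this.congr fun x _ v _ => ?_
    rw [Matrix.adjugate_apply]
    congr 1
    ext i j
    by_cases hi : i = β <;> simp [Matrix.updateRow_apply, hi]
  refine (hd.mul ha).congr fun x hx v hv => ?_
  rw [gUp, Matrix.inv_def, Matrix.smul_apply, Ring.inverse_eq_inv', smul_eq_mul]

lemma homog_gUp (h : IsCoordLagrangian O ℓ) (α β : Fin (n + 1)) : HomogOff O 0 (gUp ℓ α β) := by
  intro x hx v hv r hr
  simp [gUp, fun i j => h.homog_gLow i j x hx v hv r hr]

lemma smooth_christoffel (h : IsCoordLagrangian O ℓ) (α β γ : Fin (n + 1)) :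
    SmoothOff O (christoffel ℓ α β γ) :=
  (SmoothOff.const _).mul <| SmoothOff.sum fun δ => (h.smooth_gUp α δ).mul <|
    (((h.smooth_gLow δ γ).dx h.isOpen β).add ((h.smooth_gLow β δ).dx h.isOpen γ)).sub
      ((h.smooth_gLow β γ).dx h.isOpen δ)

lemma homog_christoffel (h : IsCoordLagrangian O ℓ) (α β γ : Fin (n + 1)) :
    HomogOff O 0 (christoffel ℓ α β γ) :=
  (HomogOff.const (1 / 2)).mul <| HomogOff.sum (k := 0) fun δ => (h.homog_gUp α δ).mul <|
    (((h.homog_gLow δ γ).dx h.isOpen β).add ((h.homog_gLow β δ).dx h.isOpen γ)).sub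
      ((h.homog_gLow β γ).dx h.isOpen δ)

lemma smooth_spray (h : IsCoordLagrangian O ℓ) (α : Fin (n + 1)) : SmoothOff O (spray ℓ α) :=
  (SmoothOff.const _).mul <| SmoothOff.sum fun β => SmoothOff.sum fun γ =>
    ((h.smooth_christoffel α β γ).mul (SmoothOff.coord β)).mul (SmoothOff.coord γ)

lemma homog_spray (h : IsCoordLagrangian O ℓ) (α : Fin (n + 1)) : HomogOff O 2 (spray ℓ α) :=
  (HomogOff.const (1 / 2)).mul <| HomogOff.sum (k := 2) fun β => HomogOff.sum fun γ =>
    ((h.homog_christoffel α β γ).mul (HomogOff.coord β)).mul (HomogOff.coord γ)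

lemma smooth_nonlin (h : IsCoordLagrangian O ℓ) (α β : Fin (n + 1)) :
    SmoothOff O (nonlin ℓ α β) := (h.smooth_spray α).dv h.isOpen β

lemma homog_nonlin (h : IsCoordLagrangian O ℓ) (α β : Fin (n + 1)) :
    HomogOff O 1 (nonlin ℓ α β) := (h.homog_spray α).dv (h.smooth_spray α) h.isOpen β

lemma homog_curv (h : IsCoordLagrangian O ℓ) (α β : Fin (n + 1)) : HomogOff O 2 (curv ℓ α β) := by
  have h1 : HomogOff O 2 fun x v => 2 * pdx β (spray ℓ α) x v :=
    (HomogOff.const 2).mul (k := 0) ((h.homog_spray α).dx h.isOpen β)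
  have h2 : HomogOff O 2 fun x v => ∑ γ, (pdx γ (nonlin ℓ α β) x v * v γ
      - 2 * pdv γ (nonlin ℓ α β) x v * spray ℓ γ x v) :=
    HomogOff.sum fun γ => (((h.homog_nonlin α β).dx h.isOpen γ).mul (HomogOff.coord γ)).sub <|
      ((HomogOff.const 2).mul ((h.homog_nonlin α β).dv (h.smooth_nonlin α β) h.isOpen γ)).mul
        (h.homog_spray γ)
  have h3 : HomogOff O 2 fun x v => ∑ γ, nonlin ℓ α γ x v * nonlin ℓ γ β x v :=
    HomogOff.sum fun γ => (h.homog_nonlin α γ).mul (h.homog_nonlin γ β)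
  exact (h1.sub h2).sub h3

/-- `N^α_β v^β = 2 G^α`. -/
lemma sum_nonlin_mul (h : IsCoordLagrangian O ℓ) (hx : x ∈ O) (hv : v ≠ 0) (α : Fin (n + 1)) :
    ∑ β, nonlin ℓ α β x v * v β = 2 * spray ℓ α x v := by
  have := (h.homog_spray α).euler (h.smooth_spray α) h.isOpen hx hv
  push_cast at this
  exact this

/-- The curvature endomorphism annihilates the velocity: `R_v v = 0`. -/
lemma sum_curv_mul (h : IsCoordLagrangian O ℓ) (hx : x ∈ O) (hv : v ≠ 0) (α : Fin (n + 1)) :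
    ∑ β, curv ℓ α β x v * v β = 0 := by
  have h1 (γ) : ∑ β, pdx γ (nonlin ℓ α β) x v * v β = 2 * pdx γ (spray ℓ α) x v := by
    rw [← pdx_sum_mul_coord (h.smooth_nonlin α) h.isOpen hx hv,
      pdx_congr h.isOpen (fun y hy w hw => h.sum_nonlin_mul hy hw α) hx hv]
    simp only [pdx]
    change fderiv ℝ ((2 : ℝ) • fun y => spray ℓ α y v) x _ = _
    rw [fderiv_const_smul_field]
    simp
  have h2 (γ) : ∑ β, pdv γ (nonlin ℓ α β) x v * v β = nonlin ℓ α γ x v := by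
    have := (h.homog_nonlin α γ).euler (h.smooth_nonlin α γ) h.isOpen hx hv
    simp only [Nat.cast_one, one_mul] at this
    rw [← this]
    exact Finset.sum_congr rfl fun β _ => by
      rw [nonlin, (h.smooth_spray α).pdv_comm h.isOpen hx hv]; rfl
  have h3 : ∑ β, (∑ γ, (pdx γ (nonlin ℓ α β) x v * v γ
      - 2 * pdv γ (nonlin ℓ α β) x v * spray ℓ γ x v)) * v β =
      ∑ γ, (2 * pdx γ (spray ℓ α) x v * v γ - 2 * nonlin ℓ α γ x v * spray ℓ γ x v) := by
    simp only [Finset.sum_mul]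
    rw [Finset.sum_comm]
    refine Finset.sum_congr rfl fun γ _ => ?_
    rw [← h1, ← h2, Finset.sum_mul, Finset.mul_sum, Finset.sum_mul, ← Finset.sum_sub_distrib]
    exact Finset.sum_congr rfl fun β _ => by ring
  have h4 : ∑ β, (∑ γ, nonlin ℓ α γ x v * nonlin ℓ γ β x v) * v β =
      ∑ γ, 2 * nonlin ℓ α γ x v * spray ℓ γ x v := by
    simp only [Finset.sum_mul]
    rw [Finset.sum_comm]
    refine Finset.sum_congr rfl fun γ _ => ?_
    rw [mul_comm 2, mul_assoc, ← h.sum_nonlin_mul hx hv γ, Finset.mul_sum]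
    exact Finset.sum_congr rfl fun β _ => by ring
  simp only [curv]
  rw [Finset.sum_congr rfl fun β _ => by rw [sub_mul, sub_mul], Finset.sum_sub_distrib,
    Finset.sum_sub_distrib, h3, h4, ← Finset.sum_sub_distrib, ← Finset.sum_sub_distrib]
  exact Finset.sum_eq_zero fun γ _ => by ring

/-- The Christoffel symbols with lowered index. -/
lemma sum_gLow_christoffel (h : IsCoordLagrangian O ℓ) (hx : x ∈ O) (hv : v ≠ 0)
    (κ β γ : Fin (n + 1)) :
    ∑ α, gLow ℓ κ α x v * christoffel ℓ α β γ x v = 1 / 2 *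
      (pdx β (gLow ℓ κ γ) x v + pdx γ (gLow ℓ β κ) x v - pdx κ (gLow ℓ β γ) x v) := by
  have h1 : ∑ α, gLow ℓ κ α x v * christoffel ℓ α β γ x v = ∑ δ, 1 / 2 *
      (∑ α, gLow ℓ κ α x v * gUp ℓ α δ x v) *
      (pdx β (gLow ℓ δ γ) x v + pdx γ (gLow ℓ β δ) x v - pdx δ (gLow ℓ β γ) x v) := by
    simp only [christoffel, Finset.mul_sum, Finset.sum_mul]
    rw [Finset.sum_comm]
    exact Finset.sum_congr rfl fun δ _ => Finset.sum_congr rfl fun α _ => by ring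
  rw [h1]
  simp [h.sum_gLow_gUp hx hv]

/-- The spray coefficients with lowered index: `2 g_{κα} G^α` is the part of the Euler-Lagrange
expression of `ℓ` which does not involve the acceleration. -/
lemma sum_gLow_spray (h : IsCoordLagrangian O ℓ) (hx : x ∈ O) (hv : v ≠ 0) (κ : Fin (n + 1)) :
    ∑ α, gLow ℓ κ α x v * (2 * spray ℓ α x v) =
      ∑ β, pdx β (pdv κ ℓ) x v * v β - pdx κ ℓ x v := by
  have h1 : ∑ α, gLow ℓ κ α x v * (2 * spray ℓ α x v) = ∑ β, ∑ γ,
      (∑ α, gLow ℓ κ α x v * christoffel ℓ α β γ x v) * v β * v γ := by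
    have h2 (α) : gLow ℓ κ α x v * (2 * spray ℓ α x v) =
        ∑ β, ∑ γ, gLow ℓ κ α x v * christoffel ℓ α β γ x v * v β * v γ := by
      rw [spray, ← mul_assoc 2, mul_one_div_cancel two_ne_zero, one_mul, Finset.mul_sum]
      refine Finset.sum_congr rfl fun β _ => ?_
      rw [Finset.mul_sum]
      exact Finset.sum_congr rfl fun γ _ => by ring
    simp only [h2, Finset.sum_mul]
    rw [Finset.sum_comm]
    exact Finset.sum_congr rfl fun β _ => Finset.sum_comm
  have h3 (β α) : ∑ γ, pdx β (gLow ℓ α γ) x v * v γ = pdx β (pdv α ℓ) x v := by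
    rw [← pdx_sum_mul_coord (h.smooth_gLow α) h.isOpen hx hv]
    exact pdx_congr h.isOpen (fun y hy w hw => h.sum_gLow_mul hy hw α) hx hv β
  have h4 : ∑ β, pdx κ (pdv β ℓ) x v * v β = 2 * pdx κ ℓ x v := by
    rw [← pdx_sum_mul_coord (fun γ => h.smooth.dv h.isOpen γ) h.isOpen hx hv,
      pdx_congr (f := fun x v => (2 : ℝ) * ℓ x v) h.isOpen (fun y hy w hw => by
        have := h.homog.euler h.smooth h.isOpen hy hw
        push_cast at this
        exact this) hx hv]
    simp only [pdx]
    change fderiv ℝ ((2 : ℝ) • fun y => ℓ y v) x _ = _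
    rw [fderiv_const_smul_field]
    simp
  have h5 : ∑ β, ∑ γ, pdx β (gLow ℓ κ γ) x v * v β * v γ =
      ∑ β, pdx β (pdv κ ℓ) x v * v β := by
    refine Finset.sum_congr rfl fun β _ => ?_
    rw [← h3, Finset.sum_mul]
    exact Finset.sum_congr rfl fun γ _ => by ring
  have h6 : ∑ β, ∑ γ, pdx γ (gLow ℓ β κ) x v * v β * v γ =
      ∑ β, pdx β (pdv κ ℓ) x v * v β := by
    rw [Finset.sum_comm, ← h5]
    refine Finset.sum_congr rfl fun β _ => Finset.sum_congr rfl fun γ _ => ?_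
    rw [h.pdx_gLow_symm hx hv]
    ring
  have h7 : ∑ β, ∑ γ, pdx κ (gLow ℓ β γ) x v * v β * v γ = 2 * pdx κ ℓ x v := by
    rw [← h4]
    refine Finset.sum_congr rfl fun β _ => ?_
    rw [← h3, Finset.sum_mul]
    exact Finset.sum_congr rfl fun γ _ => by ring
  have h8 : ∑ β, ∑ γ, (∑ α, gLow ℓ κ α x v * christoffel ℓ α β γ x v) * v β * v γ = 1 / 2 *
      (∑ β, ∑ γ, pdx β (gLow ℓ κ γ) x v * v β * v γ
        + ∑ β, ∑ γ, pdx γ (gLow ℓ β κ) x v * v β * v γ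
        - ∑ β, ∑ γ, pdx κ (gLow ℓ β γ) x v * v β * v γ) := by
    simp only [← Finset.sum_add_distrib, ← Finset.sum_sub_distrib, Finset.mul_sum]
    refine Finset.sum_congr rfl fun β _ => Finset.sum_congr rfl fun γ _ => ?_
    rw [h.sum_gLow_christoffel hx hv]
    ring
  rw [h1, h8, h5, h6, h7]
  ring

end IsCoordLagrangian

/-- The connection matrix `Γ^α_{βγ}(v) v^β` of the covariant derivative along a curve with
velocity `v`. -/
def conn (ℓ : Coord n → Coord n → ℝ) (α γ : Fin (n + 1)) (x v : Coord n) : ℝ :=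
  ∑ β, chern ℓ α β γ x v * v β

namespace IsCoordLagrangian

/-- The Chern connection with lowered index, in terms of the horizontal derivatives
`∂/∂x^β - N^μ_β ∂/∂v^μ` of `g`. -/
lemma sum_gLow_chern (h : IsCoordLagrangian O ℓ) (hx : x ∈ O) (hv : v ≠ 0)
    (κ β γ : Fin (n + 1)) :
    ∑ α, gLow ℓ κ α x v * chern ℓ α β γ x v = 1 / 2 *
      ((pdx β (gLow ℓ κ γ) x v - ∑ μ, pdv μ (gLow ℓ κ γ) x v * nonlin ℓ μ β x v)
      + (pdx γ (gLow ℓ β κ) x v - ∑ μ, pdv μ (gLow ℓ β κ) x v * nonlin ℓ μ γ x v)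
      - (pdx κ (gLow ℓ β γ) x v - ∑ μ, pdv μ (gLow ℓ β γ) x v * nonlin ℓ μ κ x v)) := by
  have h1 : ∑ α, gLow ℓ κ α x v * chern ℓ α β γ x v =
      ∑ α, gLow ℓ κ α x v * christoffel ℓ α β γ x v - ∑ δ, 1 / 2 *
      (∑ α, gLow ℓ κ α x v * gUp ℓ α δ x v) *
      (∑ μ, (pdv μ (gLow ℓ δ γ) x v * nonlin ℓ μ β x v
        + pdv μ (gLow ℓ β δ) x v * nonlin ℓ μ γ x v
        - pdv μ (gLow ℓ β γ) x v * nonlin ℓ μ δ x v)) := by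
    have h2 (α) : gLow ℓ κ α x v * chern ℓ α β γ x v = gLow ℓ κ α x v * christoffel ℓ α β γ x v -
        ∑ δ, 1 / 2 * (gLow ℓ κ α x v * gUp ℓ α δ x v) *
        (∑ μ, (pdv μ (gLow ℓ δ γ) x v * nonlin ℓ μ β x v
        + pdv μ (gLow ℓ β δ) x v * nonlin ℓ μ γ x v
        - pdv μ (gLow ℓ β γ) x v * nonlin ℓ μ δ x v)) := by
      rw [chern, mul_sub, mul_left_comm, Finset.mul_sum, Finset.mul_sum]
      congr 1
      refine Finset.sum_congr rfl fun δ _ => ?_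
      rw [← Finset.mul_sum]
      ring
    simp only [h2, Finset.sum_sub_distrib]
    congr 1
    rw [Finset.sum_comm]
    refine Finset.sum_congr rfl fun δ _ => ?_
    rw [Finset.mul_sum, Finset.sum_mul]
  rw [h1, h.sum_gLow_christoffel hx hv]
  simp only [h.sum_gLow_gUp hx hv, mul_ite, mul_one, mul_zero, ite_mul, zero_mul,
    Finset.sum_ite_eq, Finset.mem_univ, if_true, Finset.sum_add_distrib, Finset.sum_sub_distrib]
  ring

/-- Along a curve with velocity `v` satisfying the geodesic equation, the covariant derivative is
compatible with `g_v`; the left hand side is `dg_{αγ}/dt`. -/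
lemma metric_compatible (h : IsCoordLagrangian O ℓ) (hx : x ∈ O) (hv : v ≠ 0)
    (α γ : Fin (n + 1)) :
    ∑ β, pdx β (gLow ℓ α γ) x v * v β + ∑ μ, pdv μ (gLow ℓ α γ) x v * (-(2 * spray ℓ μ x v)) =
      ∑ δ, gLow ℓ α δ x v * conn ℓ δ γ x v + ∑ δ, gLow ℓ γ δ x v * conn ℓ δ α x v := by
  have h1 (α γ) : ∑ δ, gLow ℓ α δ x v * conn ℓ δ γ x v =
      ∑ β, (∑ δ, gLow ℓ α δ x v * chern ℓ δ β γ x v) * v β := by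
    simp only [conn, Finset.mul_sum, Finset.sum_mul]
    rw [Finset.sum_comm]
    exact Finset.sum_congr rfl fun β _ => Finset.sum_congr rfl fun δ _ => by ring
  have h2 : ∑ μ, pdv μ (gLow ℓ α γ) x v * (-(2 * spray ℓ μ x v)) =
      ∑ β, -(∑ μ, pdv μ (gLow ℓ α γ) x v * nonlin ℓ μ β x v) * v β := by
    simp only [← h.sum_nonlin_mul hx hv, Finset.sum_mul, Finset.mul_sum, ← Finset.sum_neg_distrib]
    rw [Finset.sum_comm]
    exact Finset.sum_congr rfl fun β _ => Finset.sum_congr rfl fun δ _ => by ring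
  rw [h1, h1, h2, ← Finset.sum_add_distrib, ← Finset.sum_add_distrib]
  refine Finset.sum_congr rfl fun β _ => ?_
  rw [h.sum_gLow_chern hx hv, h.sum_gLow_chern hx hv]
  simp only [h.pdx_gLow_symm hx hv _ γ α, h.pdv_gLow_symm' hx hv _ γ α,
    h.pdx_gLow_symm hx hv _ β α, h.pdv_gLow_symm' hx hv _ β α,
    h.pdx_gLow_symm hx hv _ β γ, h.pdv_gLow_symm' hx hv _ β γ]
  ring

/-- The covariant derivative of the velocity only involves the spray. -/
lemma sum_conn_mul (h : IsCoordLagrangian O ℓ) (hx : x ∈ O) (hv : v ≠ 0) (α : Fin (n + 1)) :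
    ∑ γ, conn ℓ α γ x v * v γ = 2 * spray ℓ α x v := by
  have h1 (δ μ) : ∑ γ, pdv μ (gLow ℓ δ γ) x v * v γ = 0 := by
    rw [← h.sum_pdv_gLow_mul hx hv δ μ]
    refine Finset.sum_congr rfl fun γ _ => ?_
    rw [h.pdv_gLow_symm' hx hv, h.pdv_gLow_symm hx hv, h.pdv_gLow_symm' hx hv]
  have h2 (δ μ) : ∑ γ, pdv μ (gLow ℓ γ δ) x v * v γ = 0 := by
    rw [← h1 δ μ]
    exact Finset.sum_congr rfl fun γ _ => by rw [h.pdv_gLow_symm' hx hv]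
  -- each of the terms by which the Chern connection differs from the formal Christoffel symbols
  -- contracts the Cartan tensor with the velocity
  have h3 : ∑ β, ∑ γ, (∑ δ, ∑ μ, gUp ℓ α δ x v *
    (pdv μ (gLow ℓ δ γ) x v * nonlin ℓ μ β x v + pdv μ (gLow ℓ β δ) x v * nonlin ℓ μ γ x v
      - pdv μ (gLow ℓ β γ) x v * nonlin ℓ μ δ x v)) * v β * v γ = 0 := by
    have h4 : ∀ β γ, (∑ δ, ∑ μ, gUp ℓ α δ x v *
      (pdv μ (gLow ℓ δ γ) x v * nonlin ℓ μ β x v + pdv μ (gLow ℓ β δ) x v * nonlin ℓ μ γ x v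
      - pdv μ (gLow ℓ β γ) x v * nonlin ℓ μ δ x v)) * v β * v γ =
      ∑ δ, ∑ μ, gUp ℓ α δ x v * ((pdv μ (gLow ℓ δ γ) x v * v γ) * (nonlin ℓ μ β x v * v β)
        + (pdv μ (gLow ℓ β δ) x v * v β) * (nonlin ℓ μ γ x v * v γ)
        - (pdv μ (gLow ℓ β γ) x v * v γ) * (nonlin ℓ μ δ x v * v β)) := by
      intro β γ
      simp only [Finset.sum_mul]
      exact Finset.sum_congr rfl fun δ _ => Finset.sum_congr rfl fun μ _ => by ring
    simp only [h4]
    rw [Finset.sum_congr rfl fun β _ => Finset.sum_comm, Finset.sum_comm]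
    refine Finset.sum_eq_zero fun δ _ => ?_
    rw [Finset.sum_congr rfl fun β _ => Finset.sum_comm, Finset.sum_comm]
    refine Finset.sum_eq_zero fun μ _ => ?_
    simp only [← Finset.mul_sum, Finset.sum_add_distrib, Finset.sum_sub_distrib, ← Finset.sum_mul,
      h1, h2]
    simp
  have h5 : ∑ γ, conn ℓ α γ x v * v γ = ∑ β, ∑ γ, christoffel ℓ α β γ x v * v β * v γ
      - 1 / 2 * ∑ β, ∑ γ, (∑ δ, ∑ μ, gUp ℓ α δ x v *
    (pdv μ (gLow ℓ δ γ) x v * nonlin ℓ μ β x v + pdv μ (gLow ℓ β δ) x v * nonlin ℓ μ γ x v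
      - pdv μ (gLow ℓ β γ) x v * nonlin ℓ μ δ x v)) * v β * v γ := by
    rw [Finset.sum_congr rfl fun γ _ => by rw [conn, Finset.sum_mul]]
    rw [Finset.sum_comm, Finset.mul_sum, ← Finset.sum_sub_distrib]
    refine Finset.sum_congr rfl fun β _ => ?_
    rw [Finset.mul_sum, ← Finset.sum_sub_distrib]
    refine Finset.sum_congr rfl fun γ _ => ?_
    rw [chern]
    ring
  rw [h5, h3, spray]
  ring

end IsCoordLagrangian

end CoordLagrangian

/-! ### Tangent vectors in charts -/

section Charts

/-- The second derivative of a function of the velocity after a linear change of variables. -/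
lemma hessian_comp {n : ℕ} {O : Set (Coord n)} {ℓ : Coord n → Coord n → ℝ} {x : Coord n}
    (hs : SmoothOff O ℓ) (hO : IsOpen O) (hx : x ∈ O)
    (A : Coord n ≃L[ℝ] Coord n) (v : Coord n) (hv : v ≠ 0) (a b : Coord n) :
    fderiv ℝ (fun u => fderiv ℝ (fun w => ℓ x (A w)) u) v a b =
      ∑ α, ∑ β, gLow ℓ α β x (A v) * A a α * A b β := by
  have hAv : A v ≠ 0 := (map_ne_zero_iff _ A.injective).2 hv
  have h1 (u : Coord n) (hu : u ≠ 0) : fderiv ℝ (fun w => ℓ x (A w)) u b =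
      ∑ β, pdv β ℓ x (A u) * A b β := by
    have hAu : A u ≠ 0 := (map_ne_zero_iff _ A.injective).2 hu
    have h2 := hs.hasFDerivAt_snd hO hx hAu
    have h3 : HasFDerivAt (fun w => ℓ x (A w)) _ u := h2.comp u A.hasFDerivAt
    rw [h3.fderiv, ContinuousLinearMap.comp_apply, clm_eq_sum, ← h2.fderiv]
    rfl
  have h4 : fderiv ℝ (fun u => fderiv ℝ (fun w => ℓ x (A w)) u) v a b =
      fderiv ℝ (fun u => fderiv ℝ (fun w => ℓ x (A w)) u b) v a := by
    have hd : DifferentiableAt ℝ (fun u => fderiv ℝ (fun w => ℓ x (A w)) u) v := by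
      have hcd : ContDiffAt ℝ ∞ (fun w => ℓ x (A w)) v :=
        (hs.contDiffAt hO hx hAv).comp (f := fun w => (x, A w)) v
          (contDiffAt_const.prodMk A.contDiff.contDiffAt)
      exact (hcd.fderiv_right (m := 1) (by norm_cast)).differentiableAt (by simp)
    rw [fderiv_clm_apply hd (differentiableAt_const _)]
    simp
  have h5 : (fun u => fderiv ℝ (fun w => ℓ x (A w)) u b) =ᶠ[𝓝 v]
      fun u => ∑ β, pdv β ℓ x (A u) * A b β := by
    filter_upwards [isOpen_compl_singleton.mem_nhds hv] with u hu using h1 u hu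
  have h6 : HasFDerivAt (fun u => ∑ β, pdv β ℓ x (A u) * A b β) _ v :=
    HasFDerivAt.fun_sum fun β (_ : β ∈ Finset.univ) =>
      ((((hs.dv hO β).hasFDerivAt_snd hO hx hAv).comp v A.hasFDerivAt).mul_const (A b β))
  rw [h4, h5.fderiv_eq, h6.fderiv, Finset.sum_comm]
  simp only [sum_apply, smul_apply, smul_eq_mul]
  refine Finset.sum_congr rfl fun β _ => ?_
  rw [ContinuousLinearMap.comp_apply, clm_eq_sum, Finset.mul_sum,
    ← ((hs.dv hO β).hasFDerivAt_snd hO hx hAv).fderiv]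
  refine Finset.sum_congr rfl fun α _ => ?_
  change _ * (gLow ℓ α β x (A v) * A a α) = _
  rw [mul_comm]

variable {n : ℕ} {M : Type*} [TopologicalSpace M] [ChartedSpace (Coord n) M]

lemma tm_ext {p q : M} {a b : Coord n} (h : p = q) (h' : a = b) :
    (⟨p, a⟩ : TM n M) = ⟨q, b⟩ := by
  subst h h'
  rfl

/-- The tangent vector `∑ w^α ∂/∂x^α` at the point with coordinates `x` in the chart `c`. -/
def tlift (c : OpenPartialHomeomorph M (Coord n)) (p : Coord n × Coord n) : TM n M :=
  ⟨c.symm p.1, mfderiv (𝓡 (n + 1)) (𝓡 (n + 1)) c.symm p.1 p.2⟩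

variable {c : OpenPartialHomeomorph M (Coord n)}

lemma mdifferentiable_of_mem_charts (hc : c ∈ charts n M) :
    c.MDifferentiable (𝓡 (n + 1)) (𝓡 (n + 1)) :=
  ⟨(contMDiffOn_of_mem_maximalAtlas hc).mdifferentiableOn (by simp),
    (contMDiffOn_symm_of_mem_maximalAtlas hc).mdifferentiableOn (by simp)⟩

lemma mfderiv_symm_comp (hc : c ∈ charts n M) {p : M} (hp : p ∈ c.source)
    (w : TangentSpace (𝓡 (n + 1)) p) :
    mfderiv (𝓡 (n + 1)) (𝓡 (n + 1)) c.symm (c p) (comp c p w) = w :=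
  DFunLike.congr_fun ((mdifferentiable_of_mem_charts hc).symm_comp_deriv hp) w

lemma comp_mfderiv_symm (hc : c ∈ charts n M) {x : Coord n} (hx : x ∈ c.target) (w : Coord n) :
    comp c (c.symm x) (mfderiv (𝓡 (n + 1)) (𝓡 (n + 1)) c.symm x w) = w :=
  DFunLike.congr_fun ((mdifferentiable_of_mem_charts hc).comp_symm_deriv hx) w

lemma tlift_comp (hc : c ∈ charts n M) {p : M} (hp : p ∈ c.source)
    (w : TangentSpace (𝓡 (n + 1)) p) : tlift c (c p, comp c p w) = ⟨p, w⟩ :=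
  tm_ext (c.left_inv hp) (mfderiv_symm_comp hc hp w)

/-- The component map of a chart at a point, as a linear equivalence. -/
def compEquiv (hc : c ∈ charts n M) {p : M} (hp : p ∈ c.source) :
    TangentSpace (𝓡 (n + 1)) p ≃L[ℝ] Coord n :=
  (mdifferentiable_of_mem_charts hc).mfderiv hp

@[simp] lemma compEquiv_apply (hc : c ∈ charts n M) {p : M} (hp : p ∈ c.source)
    (w : TangentSpace (𝓡 (n + 1)) p) : compEquiv hc hp w = comp c p w := rfl

lemma lagr_comp (hc : c ∈ charts n M) (F : TM n M → ℝ) {p : M} (hp : p ∈ c.source)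
    (w : TangentSpace (𝓡 (n + 1)) p) : lagr F c (c p) (comp c p w) = F ⟨p, w⟩ :=
  congrArg F (tlift_comp hc hp w)

lemma mfderiv_symm_ne_zero (hc : c ∈ charts n M) {x : Coord n} (hx : x ∈ c.target) {w : Coord n}
    (hw : w ≠ 0) : (tlift c (x, w) : TM n M).2 ≠ 0 := by
  intro h0
  apply hw
  rw [← comp_mfderiv_symm hc hx w]
  change comp c _ (tlift c (x, w) : TM n M).2 = 0
  rw [h0]
  exact map_zero (mfderiv (𝓡 (n + 1)) (𝓡 (n + 1)) c (c.symm x))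

lemma tlift_smul (x w : Coord n) (r : ℝ) :
    (tlift c (x, r • w) : TM n M) = ⟨(tlift c (x, w)).proj, r • (tlift c (x, w)).2⟩ :=
  tm_ext rfl (map_smul (mfderiv (𝓡 (n + 1)) (𝓡 (n + 1)) c.symm x) r w)

variable [IsManifold (𝓡 (n + 1)) ∞ M]

lemma chartAt_mem_charts (p : M) : chartAt (Coord n) p ∈ charts n M :=
  IsManifold.chart_mem_maximalAtlas p

omit [TopologicalSpace M] [ChartedSpace (Coord n) M] [IsManifold (𝓡 (n + 1)) ∞ M] in
lemma contMDiff_mk_modelSpace : ContMDiff (𝓘(ℝ, Coord n × Coord n)) (𝓡 (n + 1)).tangent ∞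
    (fun p : Coord n × Coord n => (⟨p.1, p.2⟩ : TangentBundle (𝓡 (n + 1)) (Coord n))) := by
  intro p
  apply Bundle.contMDiffAt_totalSpace.2
  refine ⟨contDiff_fst.contMDiff.contMDiffAt, ?_⟩
  have h : (fun q : Coord n × Coord n => (trivializationAt (Coord n) (TangentSpace (𝓡 (n + 1)))
      p.1 (⟨q.1, q.2⟩ : TangentBundle (𝓡 (n + 1)) (Coord n))).2) = Prod.snd := by
    funext q
    simp
  have h2 : ContMDiffAt (𝓘(ℝ, Coord n × Coord n)) (𝓡 (n + 1)) ∞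
      (Prod.snd : Coord n × Coord n → Coord n) p := contDiff_snd.contMDiff.contMDiffAt
  rw [← h] at h2
  exact h2

lemma contMDiffOn_tlift (hc : c ∈ charts n M) :
    ContMDiffOn (𝓘(ℝ, Coord n × Coord n)) (𝓡 (n + 1)).tangent ∞ (tlift c : _ → TM n M)
      (c.target ×ˢ univ) := by
  have h := (contMDiffOn_symm_of_mem_maximalAtlas hc).contMDiffOn_tangentMapWithin (m := ∞)
    (by simp) c.open_target.uniqueMDiffOn
  refine (h.comp contMDiff_mk_modelSpace.contMDiffOn fun p hp => hp.1).congr fun p hp => ?_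
  simp only [tlift, tangentMapWithin, Function.comp]
  rw [mfderivWithin_of_isOpen c.open_target hp.1]

/-- Smooth functions of tangent vectors are smooth functions of their coordinates. -/
lemma contDiffOn_lagr (hc : c ∈ charts n M) {F : TM n M → ℝ} {S : Set (TM n M)}
    (hF : ContMDiffOn (𝓡 (n + 1)).tangent 𝓘(ℝ, ℝ) ∞ F S) :
    ContDiffOn ℝ ∞ (fun p : Coord n × Coord n => lagr F c p.1 p.2)
      ((c.target ×ˢ univ) ∩ tlift c ⁻¹' S) := by
  rw [← contMDiffOn_iff_contDiffOn]
  exact hF.comp ((contMDiffOn_tlift hc).mono inter_subset_left) fun p hp => hp.2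

lemma smoothOff_lagr (hc : c ∈ charts n M) {L : TM n M → ℝ} (hL : IsLorentzFinsler L) :
    SmoothOff c.target (lagr L c) :=
  (contDiffOn_lagr hc hL.smooth).mono fun _ hp =>
    ⟨⟨hp.1, mem_univ _⟩, mfderiv_symm_ne_zero hc hp.1 hp.2⟩

/-- The fundamental tensor in coordinates. -/
lemma metric_eq (hc : c ∈ charts n M) {L : TM n M → ℝ} (hL : IsLorentzFinsler L) (v : TM n M)
    (hp : v.proj ∈ c.source) (hv : v.2 ≠ 0) (a b : TangentSpace (𝓡 (n + 1)) v.proj) :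
    metric L v a b = ∑ α, ∑ β, gLow (lagr L c) α β (c v.proj) (comp c v.proj v.2) *
      comp c v.proj a α * comp c v.proj b β := by
  let A : Coord n ≃L[ℝ] Coord n := compEquiv hc hp
  have h0 : (fun w : Coord n => L ⟨v.proj, w⟩) = fun w => lagr L c (c v.proj) (A w) :=
    funext fun w => (lagr_comp hc L hp w).symm
  exact (congrArg (fun f : Coord n → ℝ => fderiv ℝ (fun u => fderiv ℝ f u) (v.2 : Coord n)
    (a : Coord n) (b : Coord n)) h0).trans
    (hessian_comp (smoothOff_lagr hc hL) c.open_target (c.map_source hp) A v.2 hv a b)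

lemma isCoordLagrangian_lagr (hc : c ∈ charts n M) {L : TM n M → ℝ} (hL : IsLorentzFinsler L) :
    IsCoordLagrangian c.target (lagr L c) where
  isOpen := c.open_target
  smooth := smoothOff_lagr hc hL
  homog := by
    intro x hx v hv r hr
    change L (tlift c (x, r • v)) = r ^ 2 * L (tlift c (x, v))
    rw [tlift_smul, hL.homogeneous _ r hr]
  isUnit_det := by
    intro x hx v hv
    rw [isUnit_iff_ne_zero]
    intro hdet
    -- a vector in the kernel is orthogonal to the pseudo-orthonormal basis of the signature
    obtain ⟨u, hu, hGu⟩ := Matrix.exists_mulVec_eq_zero_iff.2 hdet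
    have hne := mfderiv_symm_ne_zero hc hx hv
    set V : TM n M := tlift c (x, v) with hV
    have hp : V.proj ∈ c.source := c.map_target hx
    have hcV : c V.proj = x := c.right_inv hx
    have hcv : comp c V.proj V.2 = v := comp_mfderiv_symm hc hx v
    obtain ⟨b, hb⟩ := hL.signature V hne
    set U : Coord n := WithLp.toLp 2 u with hU
    set e := compEquiv hc hp with he
    have hz (a) : metric L V a (e.symm U) = 0 := by
      rw [metric_eq hc hL V hp hne, hcV, hcv]
      refine Finset.sum_eq_zero fun α _ => ?_
      have h1 : comp c V.proj (e.symm U) = U := e.apply_symm_apply U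
      have h2 := congrFun hGu α
      simp only [Matrix.mulVec, dotProduct, Matrix.of_apply, Pi.zero_apply] at h2
      rw [h1]
      calc _ = comp c V.proj a α * ∑ β, gLow (lagr L c) α β x v * u β := by
            rw [Finset.mul_sum]
            exact Finset.sum_congr rfl fun β _ => by simp [hU]; ring
        _ = 0 := by rw [h2, mul_zero]
    have h3 (i) : b.repr (e.symm U) i = 0 := by
      have h4 := hz (b i)
      rw [← b.sum_repr (e.symm U), map_sum] at h4
      simp only [map_smul, hb, smul_eq_mul, mul_ite, mul_zero] at h4
      rw [Finset.sum_ite_eq] at h4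
      simp only [Finset.mem_univ, if_true] at h4
      split_ifs at h4 with h0
      · simpa using h4
      · simpa using h4
    have h5 : e.symm U = 0 := by
      rw [← b.sum_repr (e.symm U)]
      exact Finset.sum_eq_zero fun i _ => by rw [h3, zero_smul]
    have h6 : U = 0 := by simpa using h5
    exact hu (by ext i; simpa [hU] using congrArg (fun w : Coord n => w i) h6)

end Charts

/-! ### Curves and geodesics in charts -/

section CurvesInCharts

variable {n : ℕ} {M : Type*} [TopologicalSpace M] [ChartedSpace (Coord n) M]
  {c : OpenPartialHomeomorph M (Coord n)} {η : ℝ → M} {S : Set ℝ} {t : ℝ}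

lemma hasDerivWithinAt_chart_comp (hc : c ∈ charts n M)
    (hη : ContMDiffOn 𝓘(ℝ, ℝ) (𝓡 (n + 1)) ∞ η S) (ht : t ∈ S) (hp : η t ∈ c.source) :
    HasDerivWithinAt (fun s => c (η s)) (comp c (η t) (velocity η S t).2) S t := by
  have h1 := (hη.mdifferentiableOn (by simp) t ht).hasMFDerivWithinAt
  have h2 := ((mdifferentiable_of_mem_charts hc).mdifferentiableAt hp).hasMFDerivAt
  have h3 : HasFDerivWithinAt (fun s => c (η s)) ((mfderiv (𝓡 (n + 1)) (𝓡 (n + 1)) c (η t) :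
      Coord n →L[ℝ] Coord n).comp
        (mfderivWithin 𝓘(ℝ, ℝ) (𝓡 (n + 1)) η S t : ℝ →L[ℝ] Coord n)) S t :=
    hasMFDerivWithinAt_iff_hasFDerivWithinAt.1 (h2.comp_hasMFDerivWithinAt t h1)
  have h4 (A : Coord n →L[ℝ] Coord n) (B : ℝ →L[ℝ] Coord n) {f : ℝ → Coord n}
      (h : HasFDerivWithinAt f (A.comp B) S t) : HasDerivWithinAt f (A (B 1)) S t :=
    h.hasDerivWithinAt
  exact h4 _ _ h3

lemma coordVelocity_eq (hc : c ∈ charts n M)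
    (hη : ContMDiffOn 𝓘(ℝ, ℝ) (𝓡 (n + 1)) ∞ η S) (hS : UniqueDiffOn ℝ S)
    (ht : t ∈ S) (hp : η t ∈ c.source) :
    coordVelocity c η S t = comp c (η t) (velocity η S t).2 :=
  (hasDerivWithinAt_chart_comp hc hη ht hp).derivWithin (hS t ht)

lemma hasDerivWithinAt_coord (hc : c ∈ charts n M)
    (hη : ContMDiffOn 𝓘(ℝ, ℝ) (𝓡 (n + 1)) ∞ η S) (hS : UniqueDiffOn ℝ S)
    (ht : t ∈ S) (hp : η t ∈ c.source) :
    HasDerivWithinAt (fun s => c (η s)) (coordVelocity c η S t) S t :=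
  coordVelocity_eq hc hη hS ht hp ▸ hasDerivWithinAt_chart_comp hc hη ht hp

lemma tlift_coordVelocity (hc : c ∈ charts n M)
    (hη : ContMDiffOn 𝓘(ℝ, ℝ) (𝓡 (n + 1)) ∞ η S) (hS : UniqueDiffOn ℝ S)
    (ht : t ∈ S) (hp : η t ∈ c.source) :
    tlift c (c (η t), coordVelocity c η S t) = velocity η S t := by
  rw [coordVelocity_eq hc hη hS ht hp]
  exact tlift_comp hc hp _

lemma eventually_mem_source (hη : ContMDiffOn 𝓘(ℝ, ℝ) (𝓡 (n + 1)) ∞ η S)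
    (ht : t ∈ S) (hp : η t ∈ c.source) : ∀ᶠ s in 𝓝[S] t, s ∈ S ∧ η s ∈ c.source :=
  Filter.Eventually.and self_mem_nhdsWithin
    ((hη.continuousOn t ht).eventually (c.open_source.mem_nhds hp))

lemma contDiffWithinAt_chart_comp (hc : c ∈ charts n M)
    (hη : ContMDiffOn 𝓘(ℝ, ℝ) (𝓡 (n + 1)) ∞ η S) (ht : t ∈ S) (hp : η t ∈ c.source) :
    ContDiffWithinAt ℝ ∞ (fun s => c (η s)) S t := by
  rw [← contMDiffWithinAt_iff_contDiffWithinAt]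
  exact ((contMDiffOn_of_mem_maximalAtlas hc).contMDiffAt
    (c.open_source.mem_nhds hp)).comp_contMDiffWithinAt t (hη t ht)

lemma differentiableWithinAt_coordVelocity (hc : c ∈ charts n M)
    (hη : ContMDiffOn 𝓘(ℝ, ℝ) (𝓡 (n + 1)) ∞ η S) (hS : UniqueDiffOn ℝ S)
    (ht : t ∈ S) (hp : η t ∈ c.source) :
    DifferentiableWithinAt ℝ (coordVelocity c η S) S t := by
  have h1 := (contDiffWithinAt_chart_comp hc hη ht hp).fderivWithin_right (m := 1) hS
    (by norm_cast) ht
  exact (h1.clm_apply contDiffWithinAt_const).differentiableWithinAt (by simp)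

/-- The geodesic vector field `(v, -2G)` on the coordinate domain of the tangent bundle. -/
def geodesicField (ℓ : Coord n → Coord n → ℝ) (p : Coord n × Coord n) : Coord n × Coord n :=
  (p.2, WithLp.toLp 2 fun α => -(2 * spray ℓ α p.1 p.2))

lemma IsGeodesicOn.hasDerivWithinAt_coordVelocity {L : TM n M → ℝ} (hη : IsGeodesicOn L η S)
    (hc : c ∈ charts n M) (hS : UniqueDiffOn ℝ S) (ht : t ∈ S) (hp : η t ∈ c.source) :
    HasDerivWithinAt (coordVelocity c η S)
      (geodesicField (lagr L c) (c (η t), coordVelocity c η S t)).2 S t := by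
  have h1 := (differentiableWithinAt_coordVelocity hc hη.smooth hS ht hp).hasDerivWithinAt
  convert! h1 using 1
  ext α
  have h2 := hη.equation c hc t ht hp α
  simp only [geodesicField, spray]
  linarith

lemma IsGeodesicOn.hasDerivWithinAt_coords {L : TM n M → ℝ} (hη : IsGeodesicOn L η S)
    (hc : c ∈ charts n M) (hS : UniqueDiffOn ℝ S) (ht : t ∈ S) (hp : η t ∈ c.source) :
    HasDerivWithinAt (fun s => (c (η s), coordVelocity c η S s))
      (geodesicField (lagr L c) (c (η t), coordVelocity c η S t)) S t :=
  (hasDerivWithinAt_coord hc hη.smooth hS ht hp).prodMk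
    (hη.hasDerivWithinAt_coordVelocity hc hS ht hp)

/-- The derivative of a function on phase space along the geodesic vector field. -/
def geodesicDeriv (ℓ : Coord n → Coord n → ℝ) (F : Coord n × Coord n → ℝ)
    (p : Coord n × Coord n) : ℝ := fderiv ℝ F p (geodesicField ℓ p)

lemma IsGeodesicOn.hasDerivWithinAt_comp {L : TM n M → ℝ} (hη : IsGeodesicOn L η S)
    (hc : c ∈ charts n M) (hS : UniqueDiffOn ℝ S) (ht : t ∈ S) (hp : η t ∈ c.source)
    {F : Coord n × Coord n → ℝ} (hF : DifferentiableAt ℝ F (c (η t), coordVelocity c η S t)) :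
    HasDerivWithinAt (fun s => F (c (η s), coordVelocity c η S s))
      (geodesicDeriv (lagr L c) F (c (η t), coordVelocity c η S t)) S t :=
  hF.hasFDerivAt.comp_hasDerivWithinAt t (hη.hasDerivWithinAt_coords hc hS ht hp)

end CurvesInCharts

/-! ### The future cone is open -/

section FutureCone

variable {n : ℕ} {M : Type*} [TopologicalSpace M] [ChartedSpace (Coord n) M]
  [IsManifold (𝓡 (n + 1)) ∞ M] {c : OpenPartialHomeomorph M (Coord n)}
  {L : TM n M → ℝ} {T : ∀ x : M, TangentSpace (𝓡 (n + 1)) x}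

lemma IsLorentzFinsler.apply_zero (hL : IsLorentzFinsler L) (p : M) :
    L (⟨p, (0 : TangentSpace (𝓡 (n + 1)) p)⟩ : TM n M) = 0 := by
  have h := hL.homogeneous ⟨p, 0⟩ 2 two_pos
  simp only [smul_zero] at h
  linarith

lemma ne_zero_of_neg (hL : IsLorentzFinsler L) {v : TM n M} (hv : L v < 0) : v.2 ≠ 0 := by
  rintro h
  have : v = ⟨v.proj, 0⟩ := tm_ext rfl h
  rw [this, hL.apply_zero] at hv
  exact lt_irrefl _ hv

omit [IsManifold (𝓡 (n + 1)) ∞ M] in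
lemma neg_of_mem_futureTimelike {v : TM n M} (hv : v ∈ futureTimelike L T) : L v < 0 :=
  (connectedComponentIn_subset _ _ hv :)

lemma futureTimelike_subset_futureCausal (hL : IsLorentzFinsler L) :
    futureTimelike L T ⊆ futureCausal L T := fun _ hv =>
  ⟨subset_closure hv, ne_zero_of_neg hL (neg_of_mem_futureTimelike hv)⟩

lemma continuousOn_comp_field (hT : IsTimeOrientation L T) (hc : c ∈ charts n M) :
    ContinuousOn (fun p => comp c p (T p)) c.source := by
  have h1 := (contMDiffOn_of_mem_maximalAtlas hc).continuousOn_tangentMapWithin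
    (by simp) c.open_source.uniqueMDiffOn
  have h2 : ContinuousOn (fun p => (tangentMapWithin (𝓡 (n + 1)) (𝓡 (n + 1)) c c.source
      (⟨p, T p⟩ : TM n M)).2) c.source :=
    (contMDiff_snd_tangentBundle_modelSpace (Coord n) (𝓡 (n + 1))
      (n := ∞)).continuous.comp_continuousOn
      (h1.comp hT.smooth.continuous.continuousOn fun p hp => hp)
  refine h2.congr fun p hp => ?_
  simp only [tangentMapWithin, comp]
  rw [mfderivWithin_of_isOpen c.open_source hp]

/-- Being future-directed timelike is an open condition: a path in the cone `Ω_x` from `T x` to `v`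
stays timelike, together with a connected neighbourhood, at all base points near `x`. -/
lemma eventually_futureTimelike (hL : IsLorentzFinsler L) (hT : IsTimeOrientation L T)
    (hc : c ∈ charts n M) {p : Coord n × Coord n} (hx : p.1 ∈ c.target)
    (hp : tlift c p ∈ futureTimelike L T) : ∀ᶠ q in 𝓝 p, tlift c q ∈ futureTimelike L T := by
  obtain ⟨x, v⟩ := p
  let W : Set (Coord n × Coord n) := slit c.target ∩ (fun q => lagr L c q.1 q.2) ⁻¹' Iio 0
  have hW : IsOpen W := (smoothOff_lagr hc hL).continuousOn.isOpen_inter_preimage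
    (isOpen_slit c.open_target) isOpen_Iio
  have hW' {y w : Coord n} (hy : y ∈ c.target) (h : L (tlift c (y, w)) < 0) : (y, w) ∈ W := by
    refine ⟨⟨hy, fun h0 => ?_⟩, h⟩
    have h0 : w = 0 := h0
    have h1 : (tlift c (y, w) : TM n M).2 = 0 := by
      subst h0
      exact map_zero (mfderiv (𝓡 (n + 1)) (𝓡 (n + 1)) c.symm y)
    exact ne_zero_of_neg hL h h1
  -- the time orientation in coordinates
  let τ : Coord n → Coord n := fun y => comp c (c.symm y) (T (c.symm y))
  have hτl {y : Coord n} (hy : y ∈ c.target) :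
      mfderiv (𝓡 (n + 1)) (𝓡 (n + 1)) c.symm y (τ y) = T (c.symm y) := by
    have h1 := mfderiv_symm_comp hc (c.map_target hy) (T (c.symm y))
    have h2 : c (c.symm y) = y := c.right_inv hy
    have h3 : ∀ z : Coord n, z = y → ∀ u : Coord n,
      (mfderiv (𝓡 (n + 1)) (𝓡 (n + 1)) c.symm z : Coord n → Coord n) u
        = (mfderiv (𝓡 (n + 1)) (𝓡 (n + 1)) c.symm y : Coord n → Coord n) u := by
      rintro z rfl u
      rfl
    exact (h3 _ h2 (τ y)).symm.trans h1
  have hτ : ContinuousAt τ x :=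
    ((continuousOn_comp_field hT hc).continuousAt (c.open_source.mem_nhds (c.map_target hx))).comp
      (c.continuousAt_symm hx)
  have hcont (y : Coord n) : Continuous
      (mfderiv (𝓡 (n + 1)) (𝓡 (n + 1)) c.symm y : Coord n → Coord n) :=
    (mfderiv (𝓡 (n + 1)) (𝓡 (n + 1)) c.symm y : Coord n →L[ℝ] Coord n).continuous
  -- the slice of `W` over `x` and the component of it which corresponds to `Ω_x`
  let W₀ : Set (Coord n) := (fun w => (x, w)) ⁻¹' W
  have hW₀ : IsOpen W₀ := hW.preimage (by fun_prop)
  let e : Coord n → Coord n := fun u => comp c (c.symm x) u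
  have he : Continuous e :=
    (mfderiv (𝓡 (n + 1)) (𝓡 (n + 1)) c (c.symm x) : Coord n →L[ℝ] Coord n).continuous
  have hpre : IsPreconnected (e '' (futureCone L T (c.symm x))) :=
    isPreconnected_connectedComponentIn.image e he.continuousOn
  have hsub : e '' (futureCone L T (c.symm x)) ⊆ W₀ := by
    rintro _ ⟨u, hu, rfl⟩
    have h1 : L (⟨c.symm x, u⟩ : TM n M) < 0 := (connectedComponentIn_subset _ _ hu :)
    refine hW' hx ?_
    have h2 := tlift_comp hc (c.map_target hx) u
    rw [c.right_inv hx] at h2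
    exact h2 ▸ h1
  have hτx : τ x ∈ e '' (futureCone L T (c.symm x)) :=
    ⟨T (c.symm x), mem_connectedComponentIn (hT.timelike _), rfl⟩
  have hvx : v ∈ e '' (futureCone L T (c.symm x)) := ⟨_, hp, comp_mfderiv_symm hc hx v⟩
  have hjoin : JoinedIn W₀ (τ x) v := by
    have h1 : v ∈ connectedComponentIn W₀ (τ x) :=
      hpre.subset_connectedComponentIn hτx hsub hvx
    have h2 : IsConnected (connectedComponentIn W₀ (τ x)) :=
      isConnected_connectedComponentIn_iff.2 (hsub hτx)
    have h3 := hW₀.connectedComponentIn.isConnected_iff_isPathConnected.1 h2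
    exact (h3.joinedIn _ (mem_connectedComponentIn (hsub hτx)) _ h1).mono
      (connectedComponentIn_subset _ _)
  obtain ⟨γ, hγ⟩ := hjoin
  -- a product neighbourhood of the path stays in `W`; the component `V'` of its second factor
  -- contains all values of the time orientation at nearby points
  obtain ⟨U, V, hU, hV, hxU, hKV, hUV⟩ := generalized_tube_lemma (isCompact_singleton (x := x))
    (isCompact_range γ.continuous) hW (by
      rintro ⟨y, w⟩ ⟨hy, s, rfl⟩
      obtain rfl : y = x := hy
      exact hγ s)
  let V' := connectedComponentIn V (τ x)
  have hV' : IsOpen V' := hV.connectedComponentIn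
  have hKV' : range γ ⊆ V' :=
    (isPreconnected_range γ.continuous).subset_connectedComponentIn ⟨0, γ.source⟩ hKV
  have hev1 : ∀ᶠ q : Coord n × Coord n in 𝓝 (x, v), q.1 ∈ U ∩ c.target ∧ τ q.1 ∈ V' := by
    have h0 : ∀ᶠ y in 𝓝 x, y ∈ U ∩ c.target ∧ τ y ∈ V' := by
      filter_upwards [hU.mem_nhds (hxU rfl), c.open_target.mem_nhds hx,
        hτ.eventually (hV'.mem_nhds (hKV' ⟨0, γ.source⟩))] with y h1 h2 h3 using ⟨⟨h1, h2⟩, h3⟩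
    exact (continuous_fst.tendsto (x, v)).eventually h0
  have hev2 : ∀ᶠ q : Coord n × Coord n in 𝓝 (x, v), q.2 ∈ V' :=
    (continuous_snd.tendsto (x, v)).eventually (hV'.mem_nhds (hKV' ⟨1, γ.target⟩))
  filter_upwards [hev1, hev2] with q hq1 hq2
  have h1 : IsPreconnected ((mfderiv (𝓡 (n + 1)) (𝓡 (n + 1)) c.symm q.1 : Coord n → Coord n) ''
      V') := isPreconnected_connectedComponentIn.image _ (hcont q.1).continuousOn
  refine h1.subset_connectedComponentIn ⟨τ q.1, hq1.2, hτl hq1.1.2⟩ ?_ ⟨q.2, hq2, rfl⟩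
  rintro _ ⟨w, hw, rfl⟩
  exact (hUV (show (q.1, w) ∈ U ×ˢ V from ⟨hq1.1.1, connectedComponentIn_subset _ _ hw⟩)).2

/-- A weight function is smooth in coordinates near a future-directed timelike vector. -/
lemma contDiffAt_lagr_weight (hL : IsLorentzFinsler L) (hT : IsTimeOrientation L T)
    {ψ : TM n M → ℝ} (hψ : IsWeight L T ψ)
    (hc : c ∈ charts n M) {p : Coord n × Coord n} (hx : p.1 ∈ c.target)
    (hp : tlift c p ∈ futureTimelike L T) :
    ContDiffAt ℝ ∞ (fun q : Coord n × Coord n => lagr ψ c q.1 q.2) p := by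
  refine (contDiffOn_lagr hc hψ.smooth).contDiffAt ?_
  filter_upwards [eventually_futureTimelike hL hT hc hx hp,
    continuousAt_fst.eventually (c.open_target.mem_nhds hx)] with q h1 h2
  exact ⟨⟨h2, mem_univ _⟩, futureTimelike_subset_futureCausal hL h1⟩

end FutureCone

/-! ### Invariance of the geodesic equation under changes of coordinates -/

section EulerLagrange

variable {n : ℕ} {O O' : Set (Coord n)} {ℓ ℓ' : Coord n → Coord n → ℝ}

lemma SmoothOff.hasDerivAt_comp {O : Set (Coord n)} {f : Coord n → Coord n → ℝ}
    (hf : SmoothOff O f) (hO : IsOpen O) {x v : ℝ → Coord n} {t : ℝ} (hx : x t ∈ O) (hv : v t ≠ 0)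
    {a b : Coord n} (h1 : HasDerivAt x a t) (h2 : HasDerivAt v b t) :
    HasDerivAt (fun s => f (x s) (v s))
      (∑ α, pdx α f (x t) (v t) * a α + ∑ α, pdv α f (x t) (v t) * b α) t := by
  rw [← hf.fderiv_eq_sum hO hx hv]
  exact (hf.differentiableAt hO hx hv).hasFDerivAt.comp_hasDerivAt t (h1.prodMk h2)

/-- The defect of the geodesic equation is the defect of the Euler-Lagrange equation. -/
lemma IsCoordLagrangian.hasDerivAt_momentum (h : IsCoordLagrangian O ℓ) {x v : ℝ → Coord n} {t : ℝ}
    (hx : x t ∈ O) (hv : v t ≠ 0) {a : Coord n} (h1 : HasDerivAt x (v t) t)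
    (h2 : HasDerivAt v a t) (κ : Fin (n + 1)) :
    HasDerivAt (fun s => pdv κ ℓ (x s) (v s)) (pdx κ ℓ (x t) (v t) +
      ∑ β, gLow ℓ κ β (x t) (v t) * (a β + 2 * spray ℓ β (x t) (v t))) t := by
  convert! (h.smooth.dv h.isOpen κ).hasDerivAt_comp h.isOpen hx hv h1 h2 using 1
  have h3 := h.sum_gLow_spray hx hv κ
  have h4 : ∑ β, pdv β (pdv κ ℓ) (x t) (v t) * a β = ∑ β, gLow ℓ κ β (x t) (v t) * a β :=
    Finset.sum_congr rfl fun β _ => by rw [h.gLow_symm hx hv κ β]; rfl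
  simp only [mul_add, Finset.sum_add_distrib, h3, h4]
  ring

/-- A change of coordinates maps solutions of the geodesic equation to solutions of the geodesic
equation. The momenta `∂ℓ/∂v` are the components of a covector, and comparing their derivatives
along the curve in the two coordinate systems shows that the Euler-Lagrange equation is
invariant. -/
lemma IsCoordLagrangian.accel_eq_of_change (h : IsCoordLagrangian O ℓ)
    (h' : IsCoordLagrangian O' ℓ') {U : Set (Coord n)} (hU : IsOpen U) (hUO : U ⊆ O)
    {φ : Coord n → Coord n} (hφ : ContDiffOn ℝ ∞ φ U) (hφO : MapsTo φ U O')
    (hbij : ∀ x ∈ U, Function.Bijective (fderiv ℝ φ x))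
    (hrel : ∀ x ∈ U, ∀ v : Coord n, ℓ x v = ℓ' (φ x) (fderiv ℝ φ x v))
    {x v : ℝ → Coord n} {t : ℝ} (hxU : x t ∈ U) (hv : v t ≠ 0)
    (h1 : HasDerivAt x (v t) t)
    (h2 : HasDerivAt v (geodesicField ℓ (x t, v t)).2 t) {a : Coord n}
    (h3 : HasDerivAt (fun s => fderiv ℝ φ (x s) (v s)) a t) (β : Fin (n + 1)) :
    a β + 2 * spray ℓ' β (φ (x t)) (fderiv ℝ φ (x t) (v t)) = 0 := by
  have hd : ∀ y ∈ U, DifferentiableAt ℝ φ y := fun y hy =>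
    (hφ.contDiffAt (hU.mem_nhds hy)).differentiableAt (by simp)
  have hne : ∀ y ∈ U, ∀ w : Coord n, w ≠ 0 → fderiv ℝ φ y w ≠ 0 := fun y hy w hw =>
    (map_ne_zero_iff _ (hbij y hy).1).2 hw
  have hdd : DifferentiableAt ℝ (fderiv ℝ φ) (x t) :=
    ((hφ.contDiffAt (hU.mem_nhds hxU)).fderiv_right (m := 1) (by norm_cast)).differentiableAt
      (by simp)
  have hsymm : IsSymmSndFDerivAt ℝ φ (x t) :=
    (hφ.contDiffAt (hU.mem_nhds hxU)).isSymmSndFDerivAt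
      (by simp [minSmoothness_of_isRCLikeNormedField]; norm_cast)
  -- the momenta transform as covectors
  have hmom : ∀ y ∈ U, ∀ w : Coord n, w ≠ 0 → ∀ u : Coord n,
      ∑ κ, pdv κ ℓ y w * u κ =
        ∑ κ, pdv κ ℓ' (φ y) (fderiv ℝ φ y w) * fderiv ℝ φ y u κ := by
    intro y hy w hw u
    have e1 := h.smooth.hasFDerivAt_snd h.isOpen (hUO hy) hw
    have e2 := h'.smooth.hasFDerivAt_snd h'.isOpen (hφO hy) (hne y hy w hw)
    have e3 := (e2.comp w (fderiv ℝ φ y).hasFDerivAt).congr_of_eventuallyEq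
      (f₁ := fun w => ℓ y w) (Filter.Eventually.of_forall (hrel y hy))
    have e4 := congrArg (fun D : Coord n →L[ℝ] ℝ => D u) (e1.unique e3)
    rw [← e1.fderiv, ← e2.fderiv] at e4
    simp only [ContinuousLinearMap.comp_apply] at e4
    rw [clm_eq_sum, clm_eq_sum (fderiv ℝ (fun w => ℓ' (φ y) w) (fderiv ℝ φ y w))] at e4
    exact e4
  -- the transformation of the derivatives with respect to the base point
  have hbase : ∀ u : Coord n, ∑ κ, pdx κ ℓ (x t) (v t) * u κ =
      ∑ κ, pdx κ ℓ' (φ (x t)) (fderiv ℝ φ (x t) (v t)) * fderiv ℝ φ (x t) u κ +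
      ∑ κ, pdv κ ℓ' (φ (x t)) (fderiv ℝ φ (x t) (v t)) *
        fderiv ℝ (fderiv ℝ φ) (x t) u (v t) κ := by
    intro u
    have e1 := h.smooth.hasFDerivAt_fst h.isOpen (hUO hxU) hv
    have e2 := (h'.smooth.differentiableAt h'.isOpen (hφO hxU)
      (hne _ hxU _ hv)).hasFDerivAt
    have e3 := (e2.comp (f := fun y => (φ y, fderiv ℝ φ y (v t))) (x t)
      ((hd _ hxU).hasFDerivAt.prodMk (hdd.hasFDerivAt.clm_apply
        (hasFDerivAt_const (v t) (x t))))).congr_of_eventuallyEq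
      (f₁ := fun y => ℓ y (v t))
      (Filter.eventually_of_mem (hU.mem_nhds hxU) fun y hy => hrel y hy (v t))
    have e4 := congrArg (fun D : Coord n →L[ℝ] ℝ => D u) (e1.unique e3)
    rw [← e1.fderiv] at e4
    simp only [ContinuousLinearMap.comp_apply] at e4
    rw [clm_eq_sum] at e4
    rw [← h'.smooth.fderiv_eq_sum h'.isOpen (hφO hxU) (hne _ hxU _ hv)]
    refine e4.trans ?_
    congr 1
    simp
  have hy1 : HasDerivAt (fun s => φ (x s)) (fderiv ℝ φ (x t) (v t)) t :=
    (hd _ hxU).hasFDerivAt.comp_hasDerivAt t h1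
  -- the defect of the Euler-Lagrange equation in the new coordinates
  set E : Fin (n + 1) → ℝ := fun κ => ∑ β, gLow ℓ' κ β (φ (x t)) (fderiv ℝ φ (x t) (v t)) *
    (a β + 2 * spray ℓ' β (φ (x t)) (fderiv ℝ φ (x t) (v t))) with hE
  have hEu : ∀ u : Coord n, ∑ κ, E κ * fderiv ℝ φ (x t) u κ = 0 := by
    intro u
    have f1 : HasDerivAt (fun s => ∑ κ, pdv κ ℓ (x s) (v s) * u κ)
        (∑ κ, pdx κ ℓ (x t) (v t) * u κ) t := by
      refine HasDerivAt.fun_sum fun κ _ => HasDerivAt.mul_const ?_ _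
      convert! h.hasDerivAt_momentum (hUO hxU) hv h1 h2 κ using 1
      simp [geodesicField]
    have f2 : HasDerivAt (fun s => ∑ κ, pdv κ ℓ' (φ (x s)) (fderiv ℝ φ (x s) (v s)) *
        fderiv ℝ φ (x s) u κ) (∑ κ, ((pdx κ ℓ' (φ (x t)) (fderiv ℝ φ (x t) (v t)) + E κ) *
          fderiv ℝ φ (x t) u κ + pdv κ ℓ' (φ (x t)) (fderiv ℝ φ (x t) (v t)) *
          fderiv ℝ (fderiv ℝ φ) (x t) (v t) u κ)) t := by
      refine HasDerivAt.fun_sum fun κ _ => HasDerivAt.fun_mul ?_ ?_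
      · exact h'.hasDerivAt_momentum (hφO hxU) (hne _ hxU _ hv) hy1 h3 κ
      · have g1 : HasDerivAt (fun s => fderiv ℝ φ (x s)) (fderiv ℝ (fderiv ℝ φ) (x t) (v t)) t :=
          hdd.hasFDerivAt.comp_hasDerivAt t h1
        have g2 : HasDerivAt (fun s => fderiv ℝ φ (x s) u)
            (fderiv ℝ (fderiv ℝ φ) (x t) (v t) u) t := by
          simpa using g1.clm_apply (hasDerivAt_const t u)
        exact (EuclideanSpace.proj (𝕜 := ℝ) κ).hasFDerivAt.comp_hasDerivAt t g2
    have f3 : (fun s => ∑ κ, pdv κ ℓ (x s) (v s) * u κ) =ᶠ[𝓝 t]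
        fun s => ∑ κ, pdv κ ℓ' (φ (x s)) (fderiv ℝ φ (x s) (v s)) * fderiv ℝ φ (x s) u κ := by
      filter_upwards [h1.continuousAt.eventually (hU.mem_nhds hxU),
        h2.continuousAt.eventually (isOpen_compl_singleton.mem_nhds hv)] with s hs1 hs2
      exact hmom _ hs1 _ hs2 u
    have f4 := f1.unique (f2.congr_of_eventuallyEq f3)
    rw [hbase] at f4
    have f5 : fderiv ℝ (fderiv ℝ φ) (x t) u (v t) = fderiv ℝ (fderiv ℝ φ) (x t) (v t) u :=
      hsymm u (v t)
    simp only [add_mul, Finset.sum_add_distrib, f5] at f4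
    linarith
  have hE0 : E = 0 := by
    ext κ
    obtain ⟨u, hu⟩ := (hbij _ hxU).2 (EuclideanSpace.single κ 1)
    have := hEu u
    rw [hu] at this
    simpa using this
  have hker : (Matrix.of fun i j => gLow ℓ' i j (φ (x t)) (fderiv ℝ φ (x t) (v t))).mulVec
      (fun β => a β + 2 * spray ℓ' β (φ (x t)) (fderiv ℝ φ (x t) (v t))) = 0 := by
    rw [← hE0]
    rfl
  exact congrFun (Matrix.eq_zero_of_mulVec_eq_zero
    (h'.isUnit_det _ (hφO hxU) _ (hne _ hxU _ hv)).ne_zero hker) β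

end EulerLagrange

/-! ### Existence of geodesics -/

section Existence

variable {n : ℕ} {M : Type*} [TopologicalSpace M] [ChartedSpace (Coord n) M]
  [IsManifold (𝓡 (n + 1)) ∞ M] {L : TM n M → ℝ}

lemma IsCoordLagrangian.contDiffOn_geodesicField {O : Set (Coord n)} {ℓ : Coord n → Coord n → ℝ}
    (h : IsCoordLagrangian O ℓ) : ContDiffOn ℝ ∞ (geodesicField ℓ) (slit O) := by
  refine contDiff_snd.contDiffOn.prodMk ?_
  rw [contDiffOn_euclidean]
  exact fun α => (contDiffOn_const.mul (h.smooth_spray α)).neg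

/-- Local existence of geodesics: the solution of the geodesic equation in one chart satisfies the
geodesic equation in every chart. -/
lemma exists_geodesic (hL : IsLorentzFinsler L) (v : TM n M) (hv : v.2 ≠ 0) :
    ∃ γ : ℝ → M, ∃ δ > 0, IsGeodesicOn L γ (Ioo (-δ) δ) ∧ velocity γ (Ioo (-δ) δ) 0 = v := by
  set c := chartAt (Coord n) v.proj with hcdef
  have hc : c ∈ charts n M := chartAt_mem_charts v.proj
  have hp : v.proj ∈ c.source := mem_chart_source _ _
  have hℓ := isCoordLagrangian_lagr hc hL
  set Z := geodesicField (lagr L c) with hZ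
  have hZs := hℓ.contDiffOn_geodesicField
  set p : Coord n × Coord n := (c v.proj, comp c v.proj v.2) with hpdef
  have hpW : p ∈ slit c.target := ⟨c.map_source hp, by
    change compEquiv hc hp v.2 ≠ 0
    exact (map_ne_zero_iff _ (compEquiv hc hp).injective).2 hv⟩
  have hW := isOpen_slit c.open_target
  obtain ⟨r, hr, ε, hε, hsol⟩ :=
    ((hZs.contDiffAt (hW.mem_nhds hpW)).of_le (m := 1)
      (by norm_cast)).exists_forall_mem_closedBall_exists_eq_forall_mem_Ioo_hasDerivAt 0
  obtain ⟨α, hα0, hα⟩ := hsol p (Metric.mem_closedBall_self hr.le)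
  have hα0' : HasDerivAt α (Z (α 0)) 0 := hα 0 ⟨by linarith, by linarith⟩
  -- the part of the integral curve which stays in the domain of the geodesic vector field
  obtain ⟨δ, hδ, hδW⟩ : ∃ δ > 0, Icc (-δ) δ ⊆ α ⁻¹' (slit c.target) ∩ Ioo (0 - ε) (0 + ε) := by
    have h1 : α ⁻¹' (slit c.target) ∩ Ioo (0 - ε) (0 + ε) ∈ 𝓝 (0 : ℝ) :=
      Filter.inter_mem (hα0'.continuousAt (hW.mem_nhds (hα0 ▸ hpW)))
        (Ioo_mem_nhds (by linarith) (by linarith))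
    obtain ⟨δ, hδ, h2⟩ := Metric.nhds_basis_closedBall.mem_iff.1 h1
    refine ⟨δ, hδ, ?_⟩
    rwa [Real.closedBall_eq_Icc, zero_sub, zero_add] at h2
  set S := Ioo (-δ) δ with hS
  have hSo : IsOpen S := isOpen_Ioo
  have hSu : UniqueDiffOn ℝ S := hSo.uniqueDiffOn
  have hαS : ∀ t ∈ S, α t ∈ slit c.target ∧ HasDerivAt α (Z (α t)) t := fun t ht =>
    ⟨(hδW (Ioo_subset_Icc_self ht)).1, hα t (hδW (Ioo_subset_Icc_self ht)).2⟩
  have hαs : ContDiffOn ℝ ∞ α S := by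
    refine ContDiffOn.mono (ODE.contDiffOn_enat_Icc_of_hasDerivWithinAt (n := ⊤)
      (f := fun _ => Z) (u := slit c.target) ?_ ?_ ?_) Ioo_subset_Icc_self
    · exact hZs.comp contDiff_snd.contDiffOn fun q hq => hq.2
    · exact fun t ht => (hα t (hδW ht).2).hasDerivWithinAt
    · exact fun t ht => (hδW ht).1
  have hx1 : ∀ t ∈ S, HasDerivAt (fun s => (α s).1) (α t).2 t := fun t ht => (hαS t ht).2.fst
  have hv1 : ∀ t ∈ S, HasDerivAt (fun s => (α s).2) (Z (α t)).2 t := fun t ht => (hαS t ht).2.snd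
  set γ : ℝ → M := fun t => c.symm (α t).1 with hγ
  have hγs : ContMDiffOn 𝓘(ℝ, ℝ) (𝓡 (n + 1)) ∞ γ S :=
    (contMDiffOn_symm_of_mem_maximalAtlas hc).comp
      (contMDiffOn_iff_contDiffOn.2 hαs.fst) fun t ht => (hαS t ht).1.1
  have hγc : ∀ t ∈ S, γ t ∈ c.source ∧ c (γ t) = (α t).1 := fun t ht =>
    ⟨c.map_target (hαS t ht).1.1, c.right_inv (hαS t ht).1.1⟩
  have hcv : ∀ t ∈ S, coordVelocity c γ S t = (α t).2 := by
    intro t ht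
    rw [coordVelocity, derivWithin_congr (f := fun s => (α s).1) (fun s hs => (hγc s hs).2)
      (hγc t ht).2]
    exact (hx1 t ht).hasDerivWithinAt.derivWithin (hSu t ht)
  have h0S : (0 : ℝ) ∈ S := ⟨by linarith, hδ⟩
  refine ⟨γ, δ, hδ, ⟨hγs, ?_⟩, ?_⟩
  · intro c' hc' t ht htc κ
    have hℓ' := isCoordLagrangian_lagr hc' hL
    set U : Set (Coord n) := c.target ∩ c.symm ⁻¹' c'.source with hUdef
    have hU : IsOpen U := c.symm.isOpen_inter_preimage c'.open_source
    -- the change of coordinates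
    set φ : Coord n → Coord n := fun y => c' (c.symm y) with hφdef
    have hφ : ContDiffOn ℝ ∞ φ U := by
      rw [← contMDiffOn_iff_contDiffOn]
      exact (contMDiffOn_of_mem_maximalAtlas hc').comp
        ((contMDiffOn_symm_of_mem_maximalAtlas hc).mono inter_subset_left) fun y hy => hy.2
    have hDφ : ∀ y ∈ U, ∀ w : Coord n, fderiv ℝ φ y w =
        comp c' (c.symm y) (mfderiv (𝓡 (n + 1)) (𝓡 (n + 1)) c.symm y w) := by
      intro y hy w
      have g1 := ((mdifferentiable_of_mem_charts hc).mdifferentiableAt_symm hy.1).hasMFDerivAt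
      have g2 := ((mdifferentiable_of_mem_charts hc').mdifferentiableAt hy.2).hasMFDerivAt
      have g3 : HasFDerivAt φ ((mfderiv (𝓡 (n + 1)) (𝓡 (n + 1)) c' (c.symm y) :
          Coord n →L[ℝ] Coord n).comp (mfderiv (𝓡 (n + 1)) (𝓡 (n + 1)) c.symm y :
          Coord n →L[ℝ] Coord n)) y := hasMFDerivAt_iff_hasFDerivAt.1 (g2.comp y g1)
      have g4 (A B : Coord n →L[ℝ] Coord n) (h : HasFDerivAt φ (A.comp B) y) :
          fderiv ℝ φ y w = A (B w) := by
        rw [h.fderiv]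
        rfl
      exact g4 _ _ g3
    have hbij : ∀ y ∈ U, Function.Bijective (fderiv ℝ φ y) := by
      intro y hy
      have g1 : (fderiv ℝ φ y : Coord n → Coord n) = (fun u : Coord n => comp c' (c.symm y) u) ∘
          (mfderiv (𝓡 (n + 1)) (𝓡 (n + 1)) c.symm y : Coord n → Coord n) :=
        funext (hDφ y hy)
      rw [g1]
      exact ((mdifferentiable_of_mem_charts hc').mfderiv_bijective hy.2).comp
        ((mdifferentiable_of_mem_charts hc).symm.mfderiv_bijective (x := y) hy.1)
    have hrel : ∀ y ∈ U, ∀ w : Coord n,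
        lagr L c y w = lagr L c' (φ y) (fderiv ℝ φ y w) := by
      intro y hy w
      rw [hDφ y hy]
      exact (lagr_comp hc' L hy.2 _).symm
    have htU : (α t).1 ∈ U := ⟨(hαS t ht).1.1, htc⟩
    have hw : coordVelocity c' γ S =ᶠ[𝓝 t] fun s => fderiv ℝ φ (α s).1 (α s).2 := by
      filter_upwards [hSo.mem_nhds ht,
        (hx1 t ht).continuousAt.eventually (hU.mem_nhds htU)] with s hs hsU
      have g0 : HasFDerivAt φ (fderiv ℝ φ (α s).1) (α s).1 :=
        ((hφ.contDiffAt (hU.mem_nhds hsU)).differentiableAt (by simp)).hasFDerivAt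
      have g1 : HasDerivAt (fun s => φ (α s).1) (fderiv ℝ φ (α s).1 (α s).2) s :=
        HasFDerivAt.comp_hasDerivAt (l := φ) (f := fun s => (α s).1) s g0 (hx1 s hs)
      exact g1.hasDerivWithinAt.derivWithin (hSu s hs)
    have hd : HasDerivAt (coordVelocity c' γ S) (derivWithin (coordVelocity c' γ S) S t) t :=
      (differentiableWithinAt_coordVelocity hc' hγs hSu ht htc).hasDerivWithinAt.hasDerivAt
        (hSo.mem_nhds ht)
    have key := hℓ.accel_eq_of_change hℓ' hU inter_subset_left hφ (fun y hy => c'.map_source hy.2)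
      hbij hrel (x := fun s => (α s).1) (v := fun s => (α s).2) htU (hαS t ht).1.2 (hx1 t ht)
      (hv1 t ht) (hd.congr_of_eventuallyEq hw.symm) κ
    rw [hw.self_of_nhds]
    rw [spray] at key
    change _ + ∑ β, ∑ γ', christoffel (lagr L c') κ β γ' (φ (α t).1) _ * _ * _ = 0
    linarith
  · rw [← tlift_coordVelocity hc hγs hSu h0S (hγc 0 h0S).1, (hγc 0 h0S).2, hcv 0 h0S, hα0]
    exact tlift_comp hc hp v.2

end Existence

/-! ### The weight along geodesics and homogeneity -/

section Weight

variable {n : ℕ} {M : Type*} [TopologicalSpace M] [ChartedSpace (Coord n) M]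

/-- The coordinates `(x, v)` of a tangent vector in a chart. -/
def phase (c : OpenPartialHomeomorph M (Coord n)) (v : TM n M) : Coord n × Coord n :=
  (c v.proj, comp c v.proj v.2)

/-- The multiple `r v` of a tangent vector `v`. -/
def scale (r : ℝ) (v : TM n M) : TM n M := ⟨v.proj, r • v.2⟩

/-- A function of tangent vectors as a function of coordinates. -/
def inCoords (F : TM n M → ℝ) (c : OpenPartialHomeomorph M (Coord n)) (p : Coord n × Coord n) : ℝ :=
  F (tlift c p)

variable {c : OpenPartialHomeomorph M (Coord n)} {η : ℝ → M} {S : Set ℝ} {t : ℝ}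

lemma phase_velocity (hc : c ∈ charts n M)
    (hη : ContMDiffOn 𝓘(ℝ, ℝ) (𝓡 (n + 1)) ∞ η S) (hS : UniqueDiffOn ℝ S)
    (ht : t ∈ S) (hp : η t ∈ c.source) :
    phase c (velocity η S t) = (c (η t), coordVelocity c η S t) := by
  rw [coordVelocity_eq hc hη hS ht hp]
  rfl

lemma tlift_phase (hc : c ∈ charts n M) {v : TM n M} (hp : v.proj ∈ c.source) :
    tlift c (phase c v) = v := tlift_comp hc hp v.2

lemma phase_mem_slit (hc : c ∈ charts n M) {v : TM n M} (hp : v.proj ∈ c.source) (hv : v.2 ≠ 0) :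
    phase c v ∈ slit c.target :=
  ⟨c.map_source hp, (map_ne_zero_iff _ (compEquiv hc hp).injective).2 hv⟩

variable [IsManifold (𝓡 (n + 1)) ∞ M] {L : TM n M → ℝ}

lemma contDiffAt_geodesicDeriv (hL : IsLorentzFinsler L) (hc : c ∈ charts n M)
    {F : Coord n × Coord n → ℝ} {p : Coord n × Coord n} (hp : p ∈ slit c.target)
    (hF : ContDiffAt ℝ ∞ F p) : ContDiffAt ℝ ∞ (geodesicDeriv (lagr L c) F) p :=
  (hF.fderiv_right (m := ∞) (by simp)).clm_apply
    ((isCoordLagrangian_lagr hc hL).contDiffOn_geodesicField.contDiffAt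
      ((isOpen_slit c.open_target).mem_nhds hp))

/-- The first two derivatives of the weight along a geodesic are given by the geodesic vector field,
so that they only depend on the velocity at the time considered. -/
lemma psiAlong_derivatives (hL : IsLorentzFinsler L) (ψ : TM n M → ℝ) (hη : IsGeodesicOn L η S)
    (hc : c ∈ charts n M) (hS : UniqueDiffOn ℝ S) (ht : t ∈ S) (hp : η t ∈ c.source)
    (hv : (velocity η S t : TM n M).2 ≠ 0)
    (hψ : ContDiffAt ℝ ∞ (inCoords ψ c) (phase c (velocity η S t))) :
    HasDerivWithinAt (psiAlong ψ η S)
      (geodesicDeriv (lagr L c) (inCoords ψ c) (phase c (velocity η S t))) S t ∧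
    HasDerivWithinAt (derivWithin (psiAlong ψ η S) S)
      (geodesicDeriv (lagr L c) (geodesicDeriv (lagr L c) (inCoords ψ c))
        (phase c (velocity η S t))) S t := by
  set F := inCoords ψ c with hF
  set D := geodesicDeriv (lagr L c) F with hD
  have hsrc := eventually_mem_source hη.smooth ht hp
  have hψeq : ∀ s ∈ S, η s ∈ c.source → psiAlong ψ η S s = F (c (η s), coordVelocity c η S s) := by
    intro s hs hps
    rw [psiAlong, hF, inCoords, tlift_coordVelocity hc hη.smooth hS hs hps]
  have step : ∀ s ∈ S, η s ∈ c.source → DifferentiableAt ℝ F (c (η s), coordVelocity c η S s) →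
      HasDerivWithinAt (psiAlong ψ η S) (D (c (η s), coordVelocity c η S s)) S s := by
    intro s hs hps hd
    refine (hη.hasDerivWithinAt_comp hc hS hs hps hd).congr_of_eventuallyEq ?_ (hψeq s hs hps)
    filter_upwards [eventually_mem_source hη.smooth hs hps] with r hr using hψeq r hr.1 hr.2
  have hDs := contDiffAt_geodesicDeriv hL hc (phase_mem_slit (v := velocity η S t) hc hp hv) hψ
  rw [phase_velocity hc hη.smooth hS ht hp] at hψ hDs ⊢
  refine ⟨step t ht hp (hψ.differentiableAt (by simp)), ?_⟩
  have hcont : Filter.Tendsto (fun s => (c (η s), coordVelocity c η S s)) (𝓝[S] t)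
      (𝓝 (c (η t), coordVelocity c η S t)) :=
    (hη.hasDerivWithinAt_coords hc hS ht hp).continuousWithinAt
  have hev := hcont.eventually ((hψ.of_le (m := 1) (by norm_cast)).eventually (by simp))
  have heq : ∀ᶠ s in 𝓝[S] t, derivWithin (psiAlong ψ η S) S s =
      D (c (η s), coordVelocity c η S s) := by
    filter_upwards [hev, hsrc] with s h1 h2
    exact (step s h2.1 h2.2 (h1.differentiableAt (by simp))).derivWithin (hS s h2.1)
  refine (hη.hasDerivWithinAt_comp hc hS ht hp
    (hDs.differentiableAt (by simp))).congr_of_eventuallyEq heq ?_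
  exact (step t ht hp (hψ.differentiableAt (by simp))).derivWithin (hS t ht)

lemma geodesicFrom_spec (hL : IsLorentzFinsler L) {v : TM n M} (hv : v.2 ≠ 0) :
    ∃ δ > 0, IsGeodesicOn L (geodesicFrom L v) (Ioo (-δ) δ) ∧
      velocity (geodesicFrom L v) (Ioo (-δ) δ) 0 = v := by
  rw [geodesicFrom, dif_pos (exists_geodesic hL v hv)]
  exact (exists_geodesic hL v hv).choose_spec

/-- The derivatives which enter the weighted Ricci curvature. -/
lemma psiAlong_geodesicFrom (hL : IsLorentzFinsler L) (ψ : TM n M → ℝ) (hc : c ∈ charts n M)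
    {v : TM n M} (hp : v.proj ∈ c.source) (hv : v.2 ≠ 0)
    (hψ : ContDiffAt ℝ ∞ (inCoords ψ c) (phase c v)) :
    deriv (psiAlong ψ (geodesicFrom L v) univ) 0 =
      geodesicDeriv (lagr L c) (inCoords ψ c) (phase c v) ∧
    deriv (deriv (psiAlong ψ (geodesicFrom L v) univ)) 0 =
      geodesicDeriv (lagr L c) (geodesicDeriv (lagr L c) (inCoords ψ c)) (phase c v) := by
  obtain ⟨δ, hδ, hγ, h0⟩ := geodesicFrom_spec hL hv
  set γ := geodesicFrom L v
  set S := Ioo (-δ) δ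
  have hSo : IsOpen S := isOpen_Ioo
  have h0S : (0 : ℝ) ∈ S := ⟨by linarith, hδ⟩
  have hp0 : γ 0 ∈ c.source := by
    have : γ 0 = v.proj := congrArg Bundle.TotalSpace.proj h0
    rwa [this]
  obtain ⟨h1, h2⟩ := psiAlong_derivatives hL ψ hγ hc hSo.uniqueDiffOn h0S hp0 (h0 ▸ hv)
    (h0 ▸ hψ)
  rw [h0] at h1 h2
  -- `geodesicFrom` is extended arbitrarily beyond `S`, which does not matter at time zero
  have heq : psiAlong ψ γ univ =ᶠ[𝓝 0] psiAlong ψ γ S := by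
    filter_upwards [hSo.mem_nhds h0S] with s hs
    simp only [psiAlong, velocity]
    rw [mfderivWithin_of_isOpen hSo hs, mfderivWithin_univ]
  have heq2 : deriv (psiAlong ψ γ univ) =ᶠ[𝓝 0] derivWithin (psiAlong ψ γ S) S := by
    filter_upwards [heq.eventuallyEq_nhds, hSo.mem_nhds h0S] with s hs hsS
    rw [hs.deriv_eq, derivWithin_of_isOpen hSo hsS]
  exact ⟨heq.deriv_eq.trans (h1.hasDerivAt (hSo.mem_nhds h0S)).deriv,
    heq2.deriv_eq.trans (h2.hasDerivAt (hSo.mem_nhds h0S)).deriv⟩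

/-- The dilation `(x, v) ↦ (x, r v)`. -/
def dilation (n : ℕ) (r : ℝ) : (Coord n × Coord n) →L[ℝ] (Coord n × Coord n) :=
  (ContinuousLinearMap.fst ℝ _ _).prod (r • ContinuousLinearMap.snd ℝ _ _)

omit [TopologicalSpace M] [ChartedSpace (Coord n) M] [IsManifold (𝓡 (n + 1)) ∞ M] in
@[simp] lemma dilation_apply (r : ℝ) (p : Coord n × Coord n) :
    dilation n r p = (p.1, r • p.2) := rfl

omit [IsManifold (𝓡 (n + 1)) ∞ M] in
lemma phase_smul (v : TM n M) (r : ℝ) :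
    phase c (scale r v) = dilation n r (phase c v) :=
  Prod.ext rfl (map_smul (mfderiv (𝓡 (n + 1)) (𝓡 (n + 1)) c v.proj) r v.2)

/-- The geodesic vector field is homogeneous: derivatives along it raise the degree by one. -/
lemma geodesicDeriv_dilation (hL : IsLorentzFinsler L) (hc : c ∈ charts n M)
    {F : Coord n × Coord n → ℝ} {p : Coord n × Coord n} (hp : p ∈ slit c.target) {r k : ℝ}
    (hr : 0 < r) (hF : DifferentiableAt ℝ F (dilation n r p))
    (hh : ∀ᶠ q in 𝓝 p, F (dilation n r q) = k * F q) :
    geodesicDeriv (lagr L c) F (dilation n r p) = r * k * geodesicDeriv (lagr L c) F p := by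
  have h1 : HasFDerivAt (fun q => F (dilation n r q))
      ((fderiv ℝ F (dilation n r p)).comp (dilation n r)) p :=
    hF.hasFDerivAt.comp p (dilation n r).hasFDerivAt
  have h2 : fderiv ℝ (fun q => F (dilation n r q)) p = k • fderiv ℝ F p := by
    rw [Filter.EventuallyEq.fderiv_eq (f₁ := fun q => F (dilation n r q)) (f := k • F) hh,
      fderiv_const_smul_field]
    rfl
  have h3 : geodesicField (lagr L c) (dilation n r p) =
      r • dilation n r (geodesicField (lagr L c) p) := by
    refine Prod.ext rfl ?_
    ext α
    have := (isCoordLagrangian_lagr hc hL).homog_spray α p.1 hp.1 p.2 hp.2 r hr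
    simp only [geodesicField, dilation_apply, this, Prod.smul_mk, PiLp.smul_apply, smul_eq_mul]
    ring
  have h4 := congrArg (fun A => A (geodesicField (lagr L c) p)) (h1.fderiv.symm.trans h2)
  simp only [ContinuousLinearMap.comp_apply, smul_apply, smul_eq_mul] at h4
  rw [geodesicDeriv, h3, map_smul, h4, smul_eq_mul, geodesicDeriv, mul_assoc]

variable {T : ∀ x : M, TangentSpace (𝓡 (n + 1)) x} {ψ : TM n M → ℝ}

/-- The derivatives which enter the weighted Ricci curvature of a positive multiple `r η'` of the
velocity of a timelike geodesic `η`, in terms of `ψ_η`. -/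
lemma weight_derivatives_smul_velocity (hL : IsLorentzFinsler L) (hT : IsTimeOrientation L T)
    (hψ : IsWeight L T ψ) (hη : IsGeodesicOn L η S) (hS : UniqueDiffOn ℝ S) (ht : t ∈ S)
    (hf : velocity η S t ∈ futureTimelike L T) {r : ℝ} (hr : 0 < r) :
    ∃ a b : ℝ, HasDerivWithinAt (psiAlong ψ η S) a S t ∧
      HasDerivWithinAt (derivWithin (psiAlong ψ η S) S) b S t ∧
      deriv (psiAlong ψ (geodesicFrom L (scale r (velocity η S t))) univ) 0 = r * a ∧
      deriv (deriv (psiAlong ψ (geodesicFrom L (scale r (velocity η S t))) univ)) 0 =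
        r ^ 2 * b := by
  set c := chartAt (Coord n) (η t)
  have hc : c ∈ charts n M := chartAt_mem_charts _
  have hp : η t ∈ c.source := mem_chart_source _ _
  set v : TM n M := velocity η S t with hv
  have hv0 : v.2 ≠ 0 := ne_zero_of_neg hL (neg_of_mem_futureTimelike hf)
  have hps : phase c v ∈ slit c.target := phase_mem_slit hc hp hv0
  have htl : tlift c (phase c v) ∈ futureTimelike L T := by rwa [tlift_phase hc hp]
  have hF : ContDiffAt ℝ ∞ (inCoords ψ c) (phase c v) :=
    contDiffAt_lagr_weight hL hT hψ hc hps.1 htl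
  have hhom : ∀ᶠ q in 𝓝 (phase c v), inCoords ψ c (dilation n r q) = inCoords ψ c q := by
    filter_upwards [eventually_futureTimelike hL hT hc hps.1 htl] with q hq
    rw [inCoords, dilation_apply, tlift_smul]
    exact hψ.homogeneous _ (futureTimelike_subset_futureCausal hL hq) r hr
  have hinv (q : Coord n × Coord n) : dilation n r (dilation n r⁻¹ q) = q := by
    simp [smul_smul, hr.ne']
  have hinv' (q : Coord n × Coord n) : dilation n r⁻¹ (dilation n r q) = q := by
    simp [smul_smul, hr.ne']
  -- smoothness is transported from `v` to `r v` by homogeneity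
  have hF' : ContDiffAt ℝ ∞ (inCoords ψ c) (dilation n r (phase c v)) := by
    have h1 : ContDiffAt ℝ ∞ (fun q => inCoords ψ c (dilation n r⁻¹ q))
        (dilation n r (phase c v)) := by
      refine ContDiffAt.comp (g := inCoords ψ c) _ ?_ (dilation n r⁻¹).contDiff.contDiffAt
      rwa [hinv']
    refine h1.congr_of_eventuallyEq ?_
    have h2 : Filter.Tendsto (dilation n r⁻¹) (𝓝 (dilation n r (phase c v))) (𝓝 (phase c v)) := by
      have := (dilation n r⁻¹).continuous.tendsto (dilation n r (phase c v))
      rwa [hinv'] at this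
    filter_upwards [h2.eventually hhom] with q hq
    rw [← hq, hinv]
  have hps' : dilation n r (phase c v) ∈ slit c.target :=
    ⟨hps.1, smul_ne_zero hr.ne' hps.2⟩
  have hD1 : ∀ᶠ q in 𝓝 (phase c v), geodesicDeriv (lagr L c) (inCoords ψ c) (dilation n r q) =
      r * geodesicDeriv (lagr L c) (inCoords ψ c) q := by
    have h1 := ((dilation n r).continuous.tendsto (phase c v)).eventually
      ((hF'.of_le (m := 1) (by norm_cast)).eventually (by simp))
    filter_upwards [h1, hhom.eventually_nhds, (isOpen_slit c.open_target).mem_nhds hps]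
      with q h1 h2 h3
    have := geodesicDeriv_dilation hL hc h3 hr (h1.differentiableAt (by simp)) (k := 1) (by
      filter_upwards [h2] with q' hq' using by rw [hq', one_mul])
    rwa [mul_one] at this
  have hD2 := geodesicDeriv_dilation hL hc hps hr
    ((contDiffAt_geodesicDeriv hL hc hps' hF').differentiableAt (by simp)) hD1
  obtain ⟨h1, h2⟩ := psiAlong_derivatives hL ψ hη hc hS ht hp hv0 hF
  obtain ⟨h3, h4⟩ := psiAlong_geodesicFrom hL ψ hc (v := scale r v) hp
    (smul_ne_zero hr.ne' hv0) (by rw [phase_smul v r]; exact hF')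
  rw [phase_smul v r] at h3 h4
  refine ⟨_, _, h1, h2, ?_, ?_⟩
  · rw [h3, hD1.self_of_nhds]
  · rw [h4, hD2, sq]

lemma ric_smul (hL : IsLorentzFinsler L) {v : TM n M} (hv : v.2 ≠ 0) {r : ℝ} (hr : 0 < r) :
    ric L (scale r v) = r ^ 2 * ric L v := by
  have hc : chartAt (Coord n) v.proj ∈ charts n M := chartAt_mem_charts _
  have hps := phase_mem_slit hc (mem_chart_source _ _) hv
  have h2 : comp (chartAt (Coord n) v.proj) v.proj (r • v.2) =
    r • comp (chartAt (Coord n) v.proj) v.proj v.2 := congrArg Prod.snd (phase_smul v r)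
  simp only [ric, scale, Finset.mul_sum]
  refine Finset.sum_congr rfl fun α _ => ?_
  rw [h2]
  exact (isCoordLagrangian_lagr hc hL).homog_curv α α _ hps.1 _ hps.2 r hr

end Weight

/-! ### Change of parameter -/

section ProperTime

variable {I : Set ℝ} {τ ρ : ℝ → ℝ} {t : ℝ}

lemma uniqueDiffOn_of_ordConnected (hI : I.OrdConnected) (hI' : (interior I).Nonempty) :
    UniqueDiffOn ℝ I := uniqueDiffOn_convex hI.convex hI'

lemma strictMonoOn_of_hasDerivWithinAt_pos (hI : I.OrdConnected)
    (hτ : ∀ t ∈ I, HasDerivWithinAt τ (ρ t) I t) (hρ : ∀ t, 0 < ρ t) : StrictMonoOn τ I := by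
  refine strictMonoOn_of_deriv_pos hI.convex (fun t ht => (hτ t ht).continuousWithinAt) ?_
  intro t ht
  rw [((hτ t (interior_subset ht)).hasDerivAt (mem_interior_iff_mem_nhds.1 ht)).deriv]
  exact hρ t

lemma tauInv_apply (hτ : StrictMonoOn τ I) (ht : t ∈ I) : tauInv τ I (τ t) = t :=
  hτ.injOn.leftInvOn_invFunOn ht

lemma mapsTo_tauInv (hτ : StrictMonoOn τ I) : MapsTo (tauInv τ I) (τ '' I) I := by
  rintro _ ⟨s, hs, rfl⟩
  rwa [tauInv_apply hτ hs]

lemma continuousOn_tauInv (hI : I.OrdConnected) (hτ : StrictMonoOn τ I) (hc : ContinuousOn τ I) :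
    ContinuousOn (tauInv τ I) (τ '' I) := by
  have hK : (τ '' I).OrdConnected := (hI.isPreconnected.image τ hc).ordConnected
  rw [continuousOn_iff_continuous_domRestrict]
  have h := continuous_subtype_val.comp (hτ.orderIso τ I).symm.continuous
  convert! h using 1
  ext ⟨_, s, hs, rfl⟩
  have h1 : (hτ.orderIso τ I).symm ⟨τ s, s, hs, rfl⟩ = ⟨s, hs⟩ := by
    rw [OrderIso.symm_apply_eq]
    rfl
  simp [h1, tauInv_apply hτ hs]

lemma hasDerivWithinAt_tauInv (hI : I.OrdConnected)
    (hτ : ∀ t ∈ I, HasDerivWithinAt τ (ρ t) I t) (hρ : ∀ t, 0 < ρ t) (ht : t ∈ I) :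
    HasDerivWithinAt (tauInv τ I) (ρ t)⁻¹ (τ '' I) (τ t) := by
  have hm := strictMonoOn_of_hasDerivWithinAt_pos hI hτ hρ
  have hcont := continuousOn_tauInv hI hm fun t ht => (hτ t ht).continuousWithinAt
  have h1 : HasFDerivWithinAt τ ((ContinuousLinearEquiv.unitsEquivAut ℝ
      (Units.mk0 (ρ t) (hρ t).ne') : ℝ ≃L[ℝ] ℝ) : ℝ →L[ℝ] ℝ) I (tauInv τ I (τ t)) := by
    rw [tauInv_apply hm ht]
    convert! (hτ t ht).hasFDerivWithinAt using 1
  have h2 := h1.of_local_left_inverse (s := τ '' I) (a := τ t)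
    (tendsto_nhdsWithin_iff.2 ⟨hcont _ ⟨t, ht, rfl⟩,
      Filter.eventually_of_mem self_mem_nhdsWithin (mapsTo_tauInv hm)⟩) ⟨t, ht, rfl⟩
    (Filter.eventually_of_mem self_mem_nhdsWithin (by
      rintro _ ⟨s, hs, rfl⟩
      exact congrArg τ (tauInv_apply hm hs)))
  convert! h2.hasDerivWithinAt using 1
  simp

lemma uniqueDiffWithinAt_image (hI : I.OrdConnected) (hI' : (interior I).Nonempty)
    (hτ : ∀ t ∈ I, HasDerivWithinAt τ (ρ t) I t) (hρ : ∀ t, 0 < ρ t) (ht : t ∈ I) :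
    UniqueDiffWithinAt ℝ (τ '' I) (τ t) := by
  refine (hτ t ht).hasFDerivWithinAt.uniqueDiffWithinAt
    (uniqueDiffOn_of_ordConnected hI hI' t ht) (Function.Surjective.denseRange fun y => ?_)
  exact ⟨y / ρ t, by simp [(hρ t).ne']⟩

lemma hasDerivWithinAt_comp_tauInv (hI : I.OrdConnected)
    (hτ : ∀ t ∈ I, HasDerivWithinAt τ (ρ t) I t) (hρ : ∀ t, 0 < ρ t) (ht : t ∈ I)
    {f : ℝ → ℝ} {f' : ℝ} (hf : HasDerivWithinAt f f' I t) :
    HasDerivWithinAt (f ∘ tauInv τ I) ((ρ t)⁻¹ * f') (τ '' I) (τ t) := by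
  have hm := strictMonoOn_of_hasDerivWithinAt_pos hI hτ hρ
  rw [mul_comm]
  refine HasDerivWithinAt.comp (τ t) ?_ (hasDerivWithinAt_tauInv hI hτ hρ ht) (mapsTo_tauInv hm)
  rwa [tauInv_apply hm ht]

lemma starDeriv_eq (hI : I.OrdConnected) (hI' : (interior I).Nonempty)
    (hτ : ∀ t ∈ I, HasDerivWithinAt τ (ρ t) I t) (hρ : ∀ t, 0 < ρ t) (ht : t ∈ I)
    {f : ℝ → ℝ} {f' : ℝ} (hf : HasDerivWithinAt f f' I t) :
    starDeriv τ I f t = (ρ t)⁻¹ * f' :=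
  (hasDerivWithinAt_comp_tauInv hI hτ hρ ht hf).derivWithin
    (uniqueDiffWithinAt_image hI hI' hτ hρ ht)

lemma differentiableOn_comp_tauInv (hI : I.OrdConnected)
    (hτ : ∀ t ∈ I, HasDerivWithinAt τ (ρ t) I t) (hρ : ∀ t, 0 < ρ t) {f : ℝ → ℝ}
    (hf : DifferentiableOn ℝ f I) : DifferentiableOn ℝ (f ∘ tauInv τ I) (τ '' I) := by
  rintro _ ⟨t, ht, rfl⟩
  exact (hasDerivWithinAt_comp_tauInv hI hτ hρ ht (hf t ht).hasDerivWithinAt).differentiableWithinAt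

lemma starVelocity_eq {n : ℕ} {M : Type*} [TopologicalSpace M] [ChartedSpace (Coord n) M]
    (hI : I.OrdConnected) (hI' : (interior I).Nonempty)
    (hτ : ∀ t ∈ I, HasDerivWithinAt τ (ρ t) I t) (hρ : ∀ t, 0 < ρ t) (ht : t ∈ I)
    {η : ℝ → M} (hη : ContMDiffOn 𝓘(ℝ, ℝ) (𝓡 (n + 1)) ∞ η I) :
    starVelocity τ I η t = scale (ρ t)⁻¹ (velocity η I t : TM n M) := by
  have hm := strictMonoOn_of_hasDerivWithinAt_pos hI hτ hρ
  have h0 := tauInv_apply hm ht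
  have h1 := (hη.mdifferentiableOn (by simp) _ (mapsTo_tauInv hm ⟨t, ht, rfl⟩)).hasMFDerivWithinAt
  have h2 : HasMFDerivWithinAt 𝓘(ℝ, ℝ) 𝓘(ℝ, ℝ) (tauInv τ I) (τ '' I) (τ t) _ :=
    hasMFDerivWithinAt_iff_hasFDerivWithinAt.2
      (hasDerivWithinAt_tauInv hI hτ hρ ht).hasFDerivWithinAt
  have h3 := (h1.comp (τ t) h2 (mapsTo_tauInv hm)).mfderivWithin
    (uniqueDiffWithinAt_image hI hI' hτ hρ ht).uniqueMDiffWithinAt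
  refine tm_ext (congrArg η h0) ?_
  rw [h3]
  -- the derivative of `η` with values in a fixed space, so that the base point can be replaced
  let D : ℝ → ℝ →L[ℝ] Coord n := fun s => mfderivWithin 𝓘(ℝ, ℝ) (𝓡 (n + 1)) η I s
  have h4 : ∀ s, s = t → D s (ρ t)⁻¹ = (ρ t)⁻¹ • D t 1 := by
    rintro s rfl
    rw [← map_smul]
    simp
  refine Eq.trans ?_ (h4 _ h0)
  change D (tauInv τ I (τ t)) (ContinuousLinearMap.toSpanSingleton ℝ (ρ t)⁻¹ (1 : ℝ)) = _
  simp

end ProperTime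

/-! ### Derivatives of determinants and traces -/

section MatrixCalculus

variable {ι : Type*} [Fintype ι] [DecidableEq ι] {S : Set ℝ} {t : ℝ}

/-- The matrix-valued function `A` is differentiable at `t` within `S`, entry by entry, with
derivative `A'`. -/
def MatDerivWithin (A : ℝ → Matrix ι ι ℝ) (A' : Matrix ι ι ℝ) (S : Set ℝ) (t : ℝ) : Prop :=
  ∀ i j, HasDerivWithinAt (fun s => A s i j) (A' i j) S t

variable {A B : ℝ → Matrix ι ι ℝ} {A' B' : Matrix ι ι ℝ}

omit [Fintype ι] [DecidableEq ι] in
lemma MatDerivWithin.congr (hA : MatDerivWithin A A' S t) (h : ∀ᶠ s in 𝓝[S] t, B s = A s)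
    (h' : B t = A t) : MatDerivWithin B A' S t := fun i j =>
  (hA i j).congr_of_eventuallyEq (h.mono fun _ hs => congrFun (congrFun hs i) j)
    (congrFun (congrFun h' i) j)

omit [Fintype ι] [DecidableEq ι] in
lemma MatDerivWithin.add (hA : MatDerivWithin A A' S t) (hB : MatDerivWithin B B' S t) :
    MatDerivWithin (fun s => A s + B s) (A' + B') S t := fun i j => (hA i j).add (hB i j)

omit [Fintype ι] [DecidableEq ι] in
lemma MatDerivWithin.sub (hA : MatDerivWithin A A' S t) (hB : MatDerivWithin B B' S t) :
    MatDerivWithin (fun s => A s - B s) (A' - B') S t := fun i j => (hA i j).sub (hB i j)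

omit [DecidableEq ι] in
lemma MatDerivWithin.mul (hA : MatDerivWithin A A' S t) (hB : MatDerivWithin B B' S t) :
    MatDerivWithin (fun s => A s * B s) (A' * B t + A t * B') S t := by
  intro i j
  simp only [Matrix.add_apply, Matrix.mul_apply, ← Finset.sum_add_distrib]
  exact HasDerivWithinAt.fun_sum fun k _ => (hA i k).mul (hB k j)

omit [DecidableEq ι] in
lemma MatDerivWithin.trace (hA : MatDerivWithin A A' S t) :
    HasDerivWithinAt (fun s => (A s).trace) A'.trace S t :=
  HasDerivWithinAt.fun_sum fun i _ => hA i i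

/-- Jacobi's formula. -/
lemma MatDerivWithin.det (hA : MatDerivWithin A A' S t) :
    HasDerivWithinAt (fun s => (A s).det) ((A t).adjugate * A').trace S t := by
  have h1 : HasDerivWithinAt (fun s => (A s).det) (∑ σ : Equiv.Perm ι, (Equiv.Perm.sign σ : ℝ) *
      ∑ i, (∏ j ∈ Finset.univ.erase i, A t (σ j) j) • A' (σ i) i) S t := by
    simp only [Matrix.det_apply']
    refine HasDerivWithinAt.fun_sum fun σ _ => HasDerivWithinAt.const_mul _ ?_
    exact HasDerivWithinAt.fun_finsetProd fun i _ => hA (σ i) i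
  convert! h1 using 1
  have h2 (i : ι) : ((A t).adjugate * A') i i = ((A t).updateCol i (fun k => A' k i)).det := by
    rw [← Matrix.cramer_apply, Matrix.cramer_eq_adjugate_mulVec]
    rfl
  have h3 (i : ι) : ((A t).updateCol i (fun k => A' k i)).det = ∑ σ : Equiv.Perm ι,
      (Equiv.Perm.sign σ : ℝ) * ((∏ j ∈ Finset.univ.erase i, A t (σ j) j) • A' (σ i) i) := by
    rw [Matrix.det_apply']
    refine Finset.sum_congr rfl fun σ _ => ?_
    rw [← Finset.prod_erase_mul _ _ (Finset.mem_univ i), smul_eq_mul, Matrix.updateCol_self]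
    congr 2
    refine Finset.prod_congr rfl fun j hj => ?_
    rw [Matrix.updateCol_ne (Finset.ne_of_mem_erase hj)]
  simp only [Matrix.trace, Matrix.diag, h2, h3, Finset.mul_sum]
  exact Finset.sum_comm

lemma MatDerivWithin.inv (hA : MatDerivWithin A A' S t) (hS : UniqueDiffWithinAt ℝ S t)
    (hdet : (A t).det ≠ 0) :
    MatDerivWithin (fun s => (A s)⁻¹) (-((A t)⁻¹ * A' * (A t)⁻¹)) S t := by
  have hadj (i j : ι) : DifferentiableWithinAt ℝ (fun s => (A s).adjugate i j) S t := by
    have h1 : MatDerivWithin (fun s => (A s).updateRow j (Pi.single i 1))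
        (A'.updateRow j 0) S t := by
      intro k l
      by_cases hk : k = j
      · subst hk
        simpa using hasDerivWithinAt_const t S ((Pi.single i 1 : ι → ℝ) l)
      · simpa [Matrix.updateRow_ne hk] using hA k l
    simp only [Matrix.adjugate_apply]
    exact h1.det.differentiableWithinAt
  -- by Cramer's rule the inverse is differentiable; its derivative is found from `A A⁻¹ = 1`
  have hX : ∃ X' : Matrix ι ι ℝ, MatDerivWithin (fun s => (A s)⁻¹) X' S t := by
    have h1 (i j : ι) : DifferentiableWithinAt ℝ (fun s => (A s)⁻¹ i j) S t := by
      simp only [Matrix.inv_def, Matrix.smul_apply, Ring.inverse_eq_inv', smul_eq_mul]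
      exact (hA.det.differentiableWithinAt.inv hdet).mul (hadj i j)
    exact ⟨_, fun i j => (h1 i j).hasDerivWithinAt⟩
  obtain ⟨X', hX'⟩ := hX
  have hu : IsUnit (A t).det := isUnit_iff_ne_zero.2 hdet
  have h0 : MatDerivWithin (fun s => A s * (A s)⁻¹) 0 S t := by
    refine MatDerivWithin.congr (A := fun _ => 1) (fun i j => hasDerivWithinAt_const t S _) ?_ ?_
    · filter_upwards [hA.det.continuousWithinAt.eventually (isOpen_ne.mem_nhds hdet)] with s hs
      exact Matrix.mul_nonsing_inv _ (isUnit_iff_ne_zero.2 hs)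
    · exact Matrix.mul_nonsing_inv _ hu
  have h1 : A' * (A t)⁻¹ + A t * X' = 0 := by
    ext i j
    exact hS.eq_deriv _ (hA.mul hX' i j) (h0 i j)
  have h2 : X' = -((A t)⁻¹ * A' * (A t)⁻¹) := by
    have h3 := congrArg (fun Y => (A t)⁻¹ * Y) h1
    simp only [mul_add, mul_zero, ← mul_assoc, Matrix.nonsing_inv_mul _ hu, one_mul] at h3
    exact eq_neg_of_add_eq_zero_right h3
  rwa [← h2]

/-- The matrix Riccati equation: if `A` solves the Jacobi equation `A'' + R A = 0` in a frame with
connection matrix `Γ`, then the trace of `A' A⁻¹` is the logarithmic derivative of `det A`, with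
derivative `-tr R - tr ((A' A⁻¹)²)`. -/
lemma riccati_trace {A A₁ : ℝ → Matrix ι ι ℝ} {Γ R : Matrix ι ι ℝ} (hS : UniqueDiffWithinAt ℝ S t)
    (hdet : (A t).det ≠ 0)
    (hA : MatDerivWithin A (A₁ t - (Γ * A t - A t * Γ)) S t)
    (hA₁ : MatDerivWithin A₁ (-(R * A t) - (Γ * A₁ t - A₁ t * Γ)) S t) :
    HasDerivWithinAt (fun s => (A s).det) ((A t).det * (A₁ t * (A t)⁻¹).trace) S t ∧
    HasDerivWithinAt (fun s => (A₁ s * (A s)⁻¹).trace)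
      (-R.trace - (A₁ t * (A t)⁻¹ * (A₁ t * (A t)⁻¹)).trace) S t := by
  have hu : IsUnit (A t).det := isUnit_iff_ne_zero.2 hdet
  have e1 : A t * (A t)⁻¹ = 1 := Matrix.mul_nonsing_inv _ hu
  have e2 : (A t)⁻¹ * A t = 1 := Matrix.nonsing_inv_mul _ hu
  constructor
  · convert! hA.det using 1
    have h1 : (A t).adjugate = (A t).det • (A t)⁻¹ := by
      rw [Matrix.inv_def, smul_smul, Ring.mul_inverse_cancel _ hu, one_smul]
    rw [h1, Matrix.smul_mul, Matrix.trace_smul, smul_eq_mul]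
    congr 1
    have h2 : (A t)⁻¹ * (Γ * A t - A t * Γ) = (A t)⁻¹ * (Γ * A t) - Γ := by
      rw [mul_sub, ← mul_assoc _ (A t) Γ, e2, one_mul]
    rw [mul_sub, h2, Matrix.trace_sub, Matrix.trace_sub, Matrix.trace_mul_comm (A t)⁻¹ (Γ * A t),
      mul_assoc, e1, mul_one, sub_self, sub_zero, Matrix.trace_mul_comm]
  · convert! (hA₁.mul (hA.inv hS hdet)).trace using 1
    have h3 : (-(R * A t) - (Γ * A₁ t - A₁ t * Γ)) * (A t)⁻¹ +
        A₁ t * -((A t)⁻¹ * (A₁ t - (Γ * A t - A t * Γ)) * (A t)⁻¹) =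
        -R - A₁ t * (A t)⁻¹ * (A₁ t * (A t)⁻¹)
          - (Γ * (A₁ t * (A t)⁻¹) - (A₁ t * (A t)⁻¹) * Γ) := by
      have f1 : (-(R * A t) - (Γ * A₁ t - A₁ t * Γ)) * (A t)⁻¹ =
          -R - Γ * (A₁ t * (A t)⁻¹) + A₁ t * Γ * (A t)⁻¹ := by
        have : R * A t * (A t)⁻¹ = R := by rw [mul_assoc, e1, mul_one]
        rw [sub_mul, neg_mul, this, sub_mul, mul_assoc Γ]
        abel
      have f2 : (A t)⁻¹ * (A₁ t - (Γ * A t - A t * Γ)) * (A t)⁻¹ =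
          (A t)⁻¹ * A₁ t * (A t)⁻¹ - (A t)⁻¹ * Γ + Γ * (A t)⁻¹ := by
        have g1 : (A t)⁻¹ * (Γ * A t) * (A t)⁻¹ = (A t)⁻¹ * Γ := by
          rw [mul_assoc, mul_assoc, e1, mul_one]
        have g2 : (A t)⁻¹ * (A t * Γ) * (A t)⁻¹ = Γ * (A t)⁻¹ := by
          rw [← mul_assoc, e2, one_mul]
        rw [mul_sub, mul_sub, sub_mul, sub_mul, g1, g2]
        abel
      rw [f1, f2]
      simp only [mul_neg, mul_add, mul_sub, mul_assoc]
      abel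
    rw [h3, Matrix.trace_sub, Matrix.trace_sub, Matrix.trace_sub, Matrix.trace_neg,
      Matrix.trace_mul_comm Γ, sub_self, sub_zero]

end MatrixCalculus

/-! ### Endomorphisms of a complemented subspace -/

section Extension

variable {ι : Type*} [Fintype ι] [DecidableEq ι] {V W : Type*} [AddCommGroup V] [Module ℝ V]
  [AddCommGroup W] [Module ℝ W] [Module.Finite ℝ W]

/-- The matrix of the extension by zero `i ∘ E ∘ q` of an endomorphism `E` of `W`, where `q` is a
left inverse of `i : W → V`. -/
def extMatrix (b : Module.Basis ι ℝ V) (i : W →ₗ[ℝ] V) (q : V →ₗ[ℝ] W) (E : Module.End ℝ W) :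
    Matrix ι ι ℝ := LinearMap.toMatrix b b (i ∘ₗ E ∘ₗ q)

variable {b : Module.Basis ι ℝ V} {i : W →ₗ[ℝ] V} {q : V →ₗ[ℝ] W}

omit [Module.Finite ℝ W] in
lemma extMatrix_mul (h : q ∘ₗ i = LinearMap.id) (E F : Module.End ℝ W) :
    extMatrix b i q (E * F) = extMatrix b i q E * extMatrix b i q F := by
  rw [extMatrix, extMatrix, extMatrix, ← LinearMap.toMatrix_comp]
  congr 1
  ext v
  simpa using congrArg (fun w => i (E w)) (DFunLike.congr_fun h (F (q v))).symm

lemma trace_extMatrix (h : q ∘ₗ i = LinearMap.id) (E : Module.End ℝ W) :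
    (extMatrix b i q E).trace = LinearMap.trace ℝ W E := by
  have : Module.Finite ℝ V := Module.Finite.of_basis b
  rw [extMatrix, ← LinearMap.trace_eq_matrix_trace, LinearMap.trace_comp_comm',
    LinearMap.comp_assoc, h, LinearMap.comp_id]

/-- The extension by the identity on the complement `ker q` has the same determinant. -/
lemma det_extMatrix (h : q ∘ₗ i = LinearMap.id) (E : Module.End ℝ W) :
    (extMatrix b i q E + (1 - extMatrix b i q 1)).det = LinearMap.det E := by
  classical
  let w := Module.finBasis ℝ W
  have h1 : extMatrix b i q E + (1 - extMatrix b i q 1) =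
      1 + LinearMap.toMatrix w b i * LinearMap.toMatrix b w ((E - 1) ∘ₗ q) := by
    rw [← LinearMap.toMatrix_comp, extMatrix, extMatrix, LinearMap.sub_comp, LinearMap.comp_sub,
      map_sub]
    abel
  rw [h1, Matrix.det_one_add_mul_comm, ← LinearMap.toMatrix_comp, LinearMap.comp_assoc, h,
    LinearMap.comp_id, map_sub, ← LinearMap.toMatrix_one w, add_sub_cancel, LinearMap.det_toMatrix]

/-- `(tr B)² ≤ n tr(B²)` for endomorphisms which are symmetric with respect to a positive definite
form. -/
lemma sq_trace_le (g : LinearMap.BilinForm ℝ W) (hg : LinearMap.IsSymm g)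
    (hpos : ∀ w, w ≠ 0 → 0 < g w w) (B : Module.End ℝ W) (hB : ∀ a b, g (B a) b = g a (B b)) :
    LinearMap.trace ℝ W B ^ 2 ≤ Module.finrank ℝ W * LinearMap.trace ℝ W (B * B) := by
  classical
  have : Invertible (2 : ℝ) := invertibleOfNonzero two_ne_zero
  obtain ⟨w, hw⟩ := LinearMap.BilinForm.exists_orthogonal_basis hg
  rw [LinearMap.isOrthoᵢ_def] at hw
  have hd (k) : 0 < g (w k) (w k) := hpos _ (w.ne_zero k)
  set m := LinearMap.toMatrix w w B with hm
  have hBw (j) : B (w j) = ∑ k, m k j • w k := by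
    conv_lhs => rw [← w.sum_repr (B (w j))]
    exact Finset.sum_congr rfl fun k _ => by rw [hm, LinearMap.toMatrix_apply]
  have hgm (k j) : g (w k) (B (w j)) = m k j * g (w k) (w k) := by
    rw [hBw, map_sum, Finset.sum_eq_single k]
    · simp
    · intro l _ hl
      simp [hw k l hl.symm]
    · simp
  have hsym (k j) : m k j * g (w k) (w k) = m j k * g (w j) (w j) := by
    rw [← hgm, ← hgm, ← hB]
    exact hg.eq (B (w k)) (w j)
  have h1 : LinearMap.trace ℝ W B = ∑ k, m k k := LinearMap.trace_eq_matrix_trace ℝ w B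
  have h2 : LinearMap.trace ℝ W (B * B) = ∑ k, ∑ j, m k j * m j k := by
    rw [LinearMap.trace_eq_matrix_trace ℝ w, LinearMap.toMatrix_mul]
    rfl
  -- the off-diagonal products are nonnegative, being squares up to a positive factor
  have h3 : ∑ k, m k k ^ 2 ≤ ∑ k, ∑ j, m k j * m j k := by
    refine Finset.sum_le_sum fun k _ => ?_
    rw [sq]
    refine Finset.single_le_sum (f := fun j => m k j * m j k) (fun j _ => ?_) (Finset.mem_univ k)
    have h4 : m k j * m j k = m k j ^ 2 * (g (w k) (w k) / g (w j) (w j)) := by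
      have := hsym k j
      have h5 := (hd j).ne'
      field_simp
      linear_combination (-m k j) * this
    rw [h4]
    have := hd k
    have := hd j
    positivity
  have h5 := sq_sum_le_card_mul_sum_sq (s := Finset.univ) (f := fun k => m k k)
  rw [h1, h2]
  refine h5.trans ?_
  rw [Finset.card_univ, Fintype.card_fin]
  exact mul_le_mul_of_nonneg_left h3 (Nat.cast_nonneg _)

end Extension

/-! ### The fundamental tensor at a timelike vector -/

section TimelikeMetric

variable {n : ℕ} {M : Type*} [TopologicalSpace M] [ChartedSpace (Coord n) M]
  [IsManifold (𝓡 (n + 1)) ∞ M] {L : TM n M → ℝ} {v : TM n M}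

lemma metric_symm (hL : IsLorentzFinsler L) (hv : v.2 ≠ 0)
    (a b : TangentSpace (𝓡 (n + 1)) v.proj) : metric L v a b = metric L v b a := by
  have hc : chartAt (Coord n) v.proj ∈ charts n M := chartAt_mem_charts _
  have hp := mem_chart_source (Coord n) v.proj
  have hps := phase_mem_slit hc hp hv
  rw [metric_eq hc hL v hp hv, metric_eq hc hL v hp hv, Finset.sum_comm]
  refine Finset.sum_congr rfl fun α _ => Finset.sum_congr rfl fun β _ => ?_
  have h1 : gLow (lagr L (chartAt (Coord n) v.proj)) β α (chartAt (Coord n) v.proj v.proj)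
      (comp (chartAt (Coord n) v.proj) v.proj v.2) = gLow (lagr L (chartAt (Coord n) v.proj)) α β
      (chartAt (Coord n) v.proj v.proj) (comp (chartAt (Coord n) v.proj) v.proj v.2) :=
    (isCoordLagrangian_lagr hc hL).gLow_symm hps.1 hps.2 β α
  rw [h1]
  ring

lemma metric_self (hL : IsLorentzFinsler L) (hv : v.2 ≠ 0) : metric L v v.2 v.2 = 2 * L v := by
  have hc : chartAt (Coord n) v.proj ∈ charts n M := chartAt_mem_charts _
  have hp := mem_chart_source (Coord n) v.proj
  have hps := phase_mem_slit hc hp hv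
  rw [metric_eq hc hL v hp hv]
  exact ((isCoordLagrangian_lagr hc hL).sum_sum_gLow_mul hps.1 hps.2).trans
    (congrArg (2 * ·) (lagr_comp hc L hp v.2))

/-- The orthogonal complement of a timelike vector is spacelike. -/
lemma metric_pos_of_mem_normalSpace (hL : IsLorentzFinsler L) (hv : L v < 0)
    {w : TangentSpace (𝓡 (n + 1)) v.proj} (hw : w ∈ normalSpace L v) (hw0 : w ≠ 0) :
    0 < metric L v w w := by
  have hv0 := ne_zero_of_neg hL hv
  obtain ⟨b, hb⟩ := hL.signature v hv0
  have hvv : metric L v v.2 v.2 < 0 := by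
    rw [metric_self hL hv0]
    linarith
  have hvw : metric L v v.2 w = 0 := hw
  have hwv : metric L v w v.2 = 0 := by rw [metric_symm hL hv0, hvw]
  -- on vectors without `b 0`-component the metric is a sum of squares
  have hQ (u : TangentSpace (𝓡 (n + 1)) v.proj) (hu : b.repr u 0 = 0) :
      metric L v u u = ∑ i, b.repr u i ^ 2 := by
    have h1 : metric L v u u = ∑ i, b.repr u i * metric L v (b i) u := by
      have h3 := congrArg (fun z => metric L v z u) (b.sum_repr u)
      simp only [map_sum, map_smul, sum_apply, smul_apply, smul_eq_mul] at h3
      exact h3.symm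
    have h2 (i) : metric L v (b i) u = b.repr u i * (if i = 0 then -1 else 1) := by
      conv_lhs => rw [← b.sum_repr u]
      simp only [map_sum, map_smul, hb, smul_eq_mul, mul_ite, mul_zero]
      rw [Finset.sum_ite_eq]
      simp
    rw [h1]
    refine Finset.sum_congr rfl fun i _ => ?_
    rw [h2]
    split_ifs with h0
    · rw [h0, hu]
      ring
    · ring
  have hQ0 (u : TangentSpace (𝓡 (n + 1)) v.proj) (hu : b.repr u 0 = 0) (h : metric L v u u ≤ 0) :
      u = 0 := by
    rw [hQ u hu] at h
    have h1 := (Finset.sum_eq_zero_iff_of_nonneg fun i _ => sq_nonneg (b.repr u i)).1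
      (le_antisymm h (Finset.sum_nonneg fun i _ => sq_nonneg _))
    rw [← b.sum_repr u]
    exact Finset.sum_eq_zero fun i hi => by
      rw [pow_eq_zero_iff two_ne_zero |>.1 (h1 i hi), zero_smul]
  by_contra! hneg
  -- the combination of `v` and `w` without `b 0`-component
  set r := b.repr w 0 with hr
  set s := b.repr v.2 0 with hs
  have hs0 : s ≠ 0 := fun h => by
    rw [hQ v.2 h] at hvv
    exact absurd hvv (not_lt.2 (Finset.sum_nonneg fun i _ => sq_nonneg _))
  have hu0 : b.repr (r • v.2 - s • w) 0 = 0 := by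
    simp only [map_sub, map_smul, Finsupp.sub_apply, Finsupp.smul_apply, smul_eq_mul, ← hr, ← hs]
    ring
  have huu : metric L v (r • v.2 - s • w) (r • v.2 - s • w) =
      r ^ 2 * metric L v v.2 v.2 + s ^ 2 * metric L v w w := by
    simp only [map_sub, map_smul, sub_apply, smul_apply, smul_eq_mul, hvw, hwv]
    ring
  have hle : metric L v (r • v.2 - s • w) (r • v.2 - s • w) ≤ 0 := by
    rw [huu]
    nlinarith [sq_nonneg r, sq_nonneg s]
  have hu := hQ0 _ hu0 hle
  rw [hu] at huu
  have hr0 : r = 0 := by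
    have h1 : r ^ 2 * metric L v v.2 v.2 = 0 := by
      have h2 : metric L v (0 : TangentSpace (𝓡 (n + 1)) v.proj) 0 = 0 := map_zero _
      rw [h2] at huu
      nlinarith [sq_nonneg r, sq_nonneg s, mul_nonneg (sq_nonneg r) (neg_nonneg.2 hvv.le),
        mul_nonneg (sq_nonneg s) (neg_nonneg.2 hneg)]
    simpa [hvv.ne] using h1
  rw [hr0, zero_smul, zero_sub, neg_eq_zero] at hu
  exact (smul_ne_zero hs0 hw0) hu

lemma finrank_normalSpace (hL : IsLorentzFinsler L) (hv : L v < 0) :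
    Module.finrank ℝ (normalSpace L v) = n := by
  have hv0 := ne_zero_of_neg hL hv
  let f : Module.Dual ℝ (Coord n) := (metric L v v.2).toLinearMap
  have hf : f ≠ 0 := by
    intro h
    have h1 : metric L v v.2 v.2 = 0 := DFunLike.congr_fun h (v.2 : Coord n)
    rw [metric_self hL hv0] at h1
    linarith
  have h2 := Module.Dual.finrank_ker_add_one_of_ne_zero hf
  rw [finrank_euclideanSpace_fin] at h2
  have h3 : Module.finrank ℝ (normalSpace L v) = Module.finrank ℝ (LinearMap.ker f) := rfl
  omega

end TimelikeMetric

/-! ### The orthogonal projection in coordinates -/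

section Frame

/-- The part of metric compatibility which says that the orthogonal projection along the velocity of
a geodesic is parallel. -/
lemma IsCoordLagrangian.sum_pdv_mul_conn {n : ℕ} {O : Set (Coord n)} {ℓ : Coord n → Coord n → ℝ}
    {x v : Coord n} (h : IsCoordLagrangian O ℓ) (hx : x ∈ O) (hv : v ≠ 0) (γ : Fin (n + 1)) :
    ∑ δ, pdv δ ℓ x v * conn ℓ δ γ x v = pdx γ ℓ x v := by
  have h1 (β) : ∑ α, pdx β (gLow ℓ α γ) x v * v α = pdx β (pdv γ ℓ) x v := by
    rw [← pdx_sum_mul_coord (fun α => h.smooth_gLow α γ) h.isOpen hx hv]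
    refine pdx_congr h.isOpen (fun y hy w hw => ?_) hx hv β
    rw [← h.sum_gLow_mul hy hw γ]
    exact Finset.sum_congr rfl fun α _ => by rw [h.gLow_symm hy hw]
  have h2 (μ) : ∑ α, pdv μ (gLow ℓ α γ) x v * v α = 0 := by
    rw [← h.sum_pdv_gLow_mul hx hv μ γ]
    exact Finset.sum_congr rfl fun α _ => by rw [h.pdv_gLow_symm hx hv]
  have h3 : ∑ α, v α * ∑ δ, gLow ℓ γ δ x v * conn ℓ δ α x v =
      ∑ β, pdx β (pdv γ ℓ) x v * v β - pdx γ ℓ x v := by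
    rw [← h.sum_gLow_spray hx hv γ]
    simp only [← h.sum_conn_mul hx hv, Finset.mul_sum]
    rw [Finset.sum_comm]
    exact Finset.sum_congr rfl fun α _ => Finset.sum_congr rfl fun β _ => by ring
  have h4 : ∑ α, v α * ∑ δ, gLow ℓ α δ x v * conn ℓ δ γ x v =
      ∑ δ, pdv δ ℓ x v * conn ℓ δ γ x v := by
    simp only [← h.sum_gLow_mul hx hv, Finset.mul_sum, Finset.sum_mul]
    rw [Finset.sum_comm]
    exact Finset.sum_congr rfl fun δ _ => Finset.sum_congr rfl fun α _ => by
      rw [h.gLow_symm hx hv]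
      ring
  have h5 : ∑ α, v α * ∑ β, pdx β (gLow ℓ α γ) x v * v β = ∑ β, pdx β (pdv γ ℓ) x v * v β := by
    simp only [← h1, Finset.mul_sum, Finset.sum_mul]
    rw [Finset.sum_comm]
    exact Finset.sum_congr rfl fun δ _ => Finset.sum_congr rfl fun α _ => by ring
  have h6 : ∑ α, v α * ∑ μ, pdv μ (gLow ℓ α γ) x v * (-(2 * spray ℓ μ x v)) = 0 := by
    calc _ = ∑ μ, (∑ α, pdv μ (gLow ℓ α γ) x v * v α) * (-(2 * spray ℓ μ x v)) := by
          simp only [Finset.mul_sum, Finset.sum_mul]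
          rw [Finset.sum_comm]
          exact Finset.sum_congr rfl fun δ _ => Finset.sum_congr rfl fun α _ => by ring
      _ = 0 := by simp [h2]
  have h7 : ∑ α, v α * (∑ β, pdx β (gLow ℓ α γ) x v * v β +
      ∑ μ, pdv μ (gLow ℓ α γ) x v * (-(2 * spray ℓ μ x v))) =
      ∑ α, v α * (∑ δ, gLow ℓ α δ x v * conn ℓ δ γ x v + ∑ δ, gLow ℓ γ δ x v * conn ℓ δ α x v) :=
    Finset.sum_congr rfl fun α _ => by rw [h.metric_compatible hx hv α γ]
  simp only [mul_add, Finset.sum_add_distrib] at h7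
  linarith

variable {n : ℕ} {M : Type*} [TopologicalSpace M] [ChartedSpace (Coord n) M]

/-- The orthogonal projection of the tangent space to the normal space of a vector `v` with
`g_v(v, v) = -1` (zero for other `v`). -/
def normalProj (L : TM n M → ℝ) (v : TM n M) :
    TangentSpace (𝓡 (n + 1)) v.proj →ₗ[ℝ] normalSpace L v :=
  open Classical in
  if h : metric L v v.2 v.2 = -1 then
    LinearMap.codRestrict (normalSpace L v)
      (LinearMap.id + (metric L v v.2).toLinearMap.smulRight v.2)
      fun a => by simp [normalSpace, h]
  else 0

/-- The component map of a chart on the normal space. -/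
def normalIncl (L : TM n M → ℝ) (c : OpenPartialHomeomorph M (Coord n)) (v : TM n M) :
    normalSpace L v →ₗ[ℝ] Coord n :=
  (mfderiv (𝓡 (n + 1)) (𝓡 (n + 1)) c v.proj).toLinearMap ∘ₗ (normalSpace L v).subtype

/-- The orthogonal projection to the normal space in the coordinates of a chart. -/
def normalProjIn (L : TM n M → ℝ) (c : OpenPartialHomeomorph M (Coord n)) (v : TM n M) :
    Coord n →ₗ[ℝ] normalSpace L v :=
  LinearMap.comp (M₂ := TangentSpace (𝓡 (n + 1)) v.proj) (normalProj L v)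
    (ContinuousLinearMap.toLinearMap (M₂ := Coord n)
      (mfderiv (𝓡 (n + 1)) (𝓡 (n + 1)) c.symm (c v.proj)))

/-- The standard basis of coordinate space. -/
def stdBasis (n : ℕ) : Module.Basis (Fin (n + 1)) ℝ (Coord n) :=
  (EuclideanSpace.basisFun (Fin (n + 1)) ℝ).toBasis

/-- The matrix in the chart `c` of an endomorphism of the normal space of `v`, extended by zero on
the line spanned by `v`. -/
def normalMatrix (L : TM n M → ℝ) (c : OpenPartialHomeomorph M (Coord n)) (v : TM n M)
    (E : Module.End ℝ (normalSpace L v)) : Matrix (Fin (n + 1)) (Fin (n + 1)) ℝ :=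
  extMatrix (stdBasis n) (normalIncl L c v) (normalProjIn L c v) E

variable {L : TM n M → ℝ} {c : OpenPartialHomeomorph M (Coord n)} {v : TM n M}

lemma normalProj_apply (h : metric L v v.2 v.2 = -1) (a : TangentSpace (𝓡 (n + 1)) v.proj) :
    (normalProj L v a).1 = a + metric L v v.2 a • v.2 := by
  rw [normalProj, dif_pos h]
  rfl

lemma normalIncl_apply (a : normalSpace L v) : normalIncl L c v a = comp c v.proj a.1 := rfl

lemma normalProjIn_comp (hc : c ∈ charts n M) (hp : v.proj ∈ c.source)
    (a : TangentSpace (𝓡 (n + 1)) v.proj) :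
    normalProjIn L c v (comp c v.proj a) = normalProj L v a :=
  congrArg (normalProj L v) (mfderiv_symm_comp hc hp a)

lemma normalProjIn_normalIncl (hc : c ∈ charts n M) (hp : v.proj ∈ c.source)
    (h : metric L v v.2 v.2 = -1) :
    normalProjIn L c v ∘ₗ normalIncl L c v = LinearMap.id := by
  ext a
  have h1 : metric L v v.2 a.1 = 0 := a.2
  rw [LinearMap.comp_apply, normalIncl_apply, normalProjIn_comp hc hp, normalProj_apply h, h1,
    zero_smul, add_zero]
  rfl

lemma normalMatrix_apply (E : Module.End ℝ (normalSpace L v)) (α j : Fin (n + 1)) :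
    normalMatrix L c v E α j =
      comp c v.proj (E (normalProjIn L c v (EuclideanSpace.single j 1))).1 α := by
  rw [normalMatrix, extMatrix, LinearMap.toMatrix_apply]
  simp only [stdBasis, OrthonormalBasis.coe_toBasis, EuclideanSpace.basisFun_apply]
  rfl

lemma sum_normalMatrix_mul (E : Module.End ℝ (normalSpace L v)) (u : Coord n) (α : Fin (n + 1)) :
    ∑ j, normalMatrix L c v E α j * u j = comp c v.proj (E (normalProjIn L c v u)).1 α := by
  have h := congrFun (LinearMap.toMatrix_mulVec_repr (stdBasis n) (stdBasis n)
    (normalIncl L c v ∘ₗ E ∘ₗ normalProjIn L c v) u) α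
  exact h

variable [IsManifold (𝓡 (n + 1)) ∞ M]

/-- The orthogonal projection in coordinates; the derivatives `∂L/∂v^α` are the components of the
covector `g_v(v, ·)`. -/
lemma comp_normalProjIn (hL : IsLorentzFinsler L) (hc : c ∈ charts n M) (hp : v.proj ∈ c.source)
    (h : metric L v v.2 v.2 = -1) (u : Coord n) (α : Fin (n + 1)) :
    comp c v.proj (normalProjIn L c v u).1 α =
      u α + (∑ β, pdv β (lagr L c) (phase c v).1 (phase c v).2 * u β) * (phase c v).2 α := by
  have hv : v.2 ≠ 0 := by
    intro h0
    rw [h0] at h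
    simp at h
  have hps := phase_mem_slit hc hp hv
  obtain ⟨a, rfl⟩ := (compEquiv hc hp).surjective u
  rw [compEquiv_apply, normalProjIn_comp hc hp, normalProj_apply h]
  have h1 : metric L v v.2 a = ∑ β, pdv β (lagr L c) (phase c v).1 (phase c v).2 *
      comp c v.proj a β := by
    rw [metric_eq hc hL v hp hv, Finset.sum_comm]
    refine Finset.sum_congr rfl fun β _ => ?_
    rw [← (isCoordLagrangian_lagr hc hL).sum_gLow_mul hps.1 hps.2, Finset.sum_mul]
    refine Finset.sum_congr rfl fun δ _ => ?_
    rw [(isCoordLagrangian_lagr hc hL).gLow_symm hps.1 hps.2 β δ]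
    rfl
  rw [h1]
  have h2 (r : ℝ) : comp c v.proj (a + r • v.2) = comp c v.proj a + r • comp c v.proj v.2 := by
    rw [← compEquiv_apply hc hp, map_add, map_smul]
    rfl
  rw [h2]
  rfl

end Frame

/-! ### Covariant derivatives in coordinates -/

section CovariantDerivative

variable {n : ℕ} {M : Type*} [TopologicalSpace M] [ChartedSpace (Coord n) M]
  [IsManifold (𝓡 (n + 1)) ∞ M] {L : TM n M → ℝ} {c : OpenPartialHomeomorph M (Coord n)}
  {η : ℝ → M} {I : Set ℝ} {t : ℝ}

/-- The matrix `Γ^α_{βγ}(v) v^β` in a chart. -/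
def connMatrix (L : TM n M → ℝ) (c : OpenPartialHomeomorph M (Coord n)) (v : TM n M) :
    Matrix (Fin (n + 1)) (Fin (n + 1)) ℝ :=
  Matrix.of fun α γ => conn (lagr L c) α γ (phase c v).1 (phase c v).2

omit [IsManifold (𝓡 (n + 1)) ∞ M] in
lemma hasCovDerivIn_iff (hc : c ∈ charts n M) (hη : ContMDiffOn 𝓘(ℝ, ℝ) (𝓡 (n + 1)) ∞ η I)
    (hI : UniqueDiffOn ℝ I) (ht : t ∈ I) (hp : η t ∈ c.source)
    {X : ∀ s, TangentSpace (𝓡 (n + 1)) (η s)} {y : TangentSpace (𝓡 (n + 1)) (η t)} :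
    HasCovDerivIn L c η I X t y ↔ ∀ α, HasDerivWithinAt (fun s => comp c (η s) (X s) α)
      (comp c (η t) y α - ∑ γ, connMatrix L c (velocity η I t) α γ * comp c (η t) (X t) γ) I t := by
  refine forall_congr' fun α => ?_
  have h : ∑ β, ∑ γ, chern (lagr L c) α β γ (c (η t)) (coordVelocity c η I t)
      * coordVelocity c η I t β * comp c (η t) (X t) γ =
      ∑ γ, connMatrix L c (velocity η I t) α γ * comp c (η t) (X t) γ := by
    simp only [connMatrix, Matrix.of_apply, phase_velocity hc hη hI ht hp, conn, Finset.sum_mul]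
    exact Finset.sum_comm
  rw [h]

/-- The Euler-Lagrange equation of a geodesic. -/
lemma IsGeodesicOn.hasDerivWithinAt_momentum (hη : IsGeodesicOn L η I) (hL : IsLorentzFinsler L)
    (hc : c ∈ charts n M) (hI : UniqueDiffOn ℝ I) (ht : t ∈ I) (hp : η t ∈ c.source)
    (hv : (velocity η I t : TM n M).2 ≠ 0) (j : Fin (n + 1)) :
    HasDerivWithinAt (fun s => pdv j (lagr L c) (c (η s)) (coordVelocity c η I s))
      (pdx j (lagr L c) (c (η t)) (coordVelocity c η I t)) I t := by
  have hℓ := isCoordLagrangian_lagr hc hL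
  have hps := phase_mem_slit hc hp hv
  rw [phase_velocity hc hη.smooth hI ht hp] at hps
  have hs := hℓ.smooth.dv hℓ.isOpen j
  have h := hη.hasDerivWithinAt_comp hc hI ht hp (hs.differentiableAt hℓ.isOpen hps.1 hps.2)
  convert! h using 1
  rw [geodesicDeriv, geodesicField, hs.fderiv_eq_sum hℓ.isOpen hps.1 hps.2]
  have h3 := hℓ.sum_gLow_spray hps.1 hps.2 j
  have h4 : ∑ β, pdv β (pdv j (lagr L c)) (c (η t)) (coordVelocity c η I t) *
      (-(2 * spray (lagr L c) β (c (η t)) (coordVelocity c η I t))) =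
      -∑ β, gLow (lagr L c) j β (c (η t)) (coordVelocity c η I t) *
        (2 * spray (lagr L c) β (c (η t)) (coordVelocity c η I t)) := by
    rw [← Finset.sum_neg_distrib]
    refine Finset.sum_congr rfl fun β _ => ?_
    rw [hℓ.gLow_symm hps.1 hps.2 j β, mul_neg]
    rfl
  rw [h4]
  linarith

/-- The derivative of the matrix of a tensor field along a geodesic: the covariant derivative is the
ordinary derivative plus the commutator with the connection matrix. -/
lemma IsTensorDeriv.matDerivWithin (hL : IsLorentzFinsler L) (hη : IsGeodesicOn L η I)
    (hI : UniqueDiffOn ℝ I) (hunit : ∀ s ∈ I, L (velocity η I s) = -1 / 2)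
    {E E' : NormalEnd L η I} (hE : IsTensorDeriv L η I E E') (hc : c ∈ charts n M) (ht : t ∈ I)
    (hp : η t ∈ c.source) :
    MatDerivWithin (fun s => normalMatrix L c (velocity η I s) (E s))
      (normalMatrix L c (velocity η I t) (E' t) -
        (connMatrix L c (velocity η I t) * normalMatrix L c (velocity η I t) (E t) -
          normalMatrix L c (velocity η I t) (E t) * connMatrix L c (velocity η I t))) I t := by
  intro α j
  have hv0 (s) (hs : s ∈ I) : (velocity η I s : TM n M).2 ≠ 0 :=
    ne_zero_of_neg hL (by rw [hunit s hs]; norm_num)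
  have hvv (s) (hs : s ∈ I) :
      metric L (velocity η I s) (velocity η I s).2 (velocity η I s).2 = -1 := by
    rw [metric_self hL (hv0 s hs), hunit s hs]
    norm_num
  have hℓ := isCoordLagrangian_lagr hc hL
  have hps := phase_mem_slit hc hp (hv0 t ht)
  rw [phase_velocity hc hη.smooth hI ht hp] at hps
  set Γ := connMatrix L c (velocity η I t) with hΓ
  -- the projections of the coordinate vectors `∂/∂x^j`; as the projection is parallel, their
  -- covariant derivatives are the projections of those of `∂/∂x^j`
  let P : ∀ s, normalSpace L (velocity η I s) := fun s =>
    normalProjIn L c (velocity η I s) (EuclideanSpace.single j 1)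
  let q : normalSpace L (velocity η I t) :=
    normalProjIn L c (velocity η I t) (WithLp.toLp 2 fun α => Γ α j)
  have hPs (s) (hs : s ∈ I) (hsc : η s ∈ c.source) (α) : comp c (η s) (P s).1 α =
      (EuclideanSpace.single j (1 : ℝ) : Coord n) α +
        pdv j (lagr L c) (c (η s)) (coordVelocity c η I s) * coordVelocity c η I s α := by
    have h1 := comp_normalProjIn (v := velocity η I s) hL hc hsc (hvv s hs)
      (EuclideanSpace.single j 1) α
    rw [phase_velocity hc hη.smooth hI hs hsc] at h1
    refine h1.trans ?_
    simp
  have hP : HasCovDerivIn L c η I (fun s => (P s).1) t q.1 := by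
    refine (hasCovDerivIn_iff hc hη.smooth hI ht hp).2 fun α => ?_
    have hw : HasDerivWithinAt (fun s => coordVelocity c η I s α)
        (-(2 * spray (lagr L c) α (c (η t)) (coordVelocity c η I t))) I t :=
      (EuclideanSpace.proj (𝕜 := ℝ) α).hasFDerivAt.comp_hasDerivWithinAt t
        (hη.hasDerivWithinAt_coordVelocity hc hI ht hp)
    have hm := hη.hasDerivWithinAt_momentum hL hc hI ht hp (hv0 t ht) j
    have h1 : HasDerivWithinAt (fun s => comp c (η s) (P s).1 α) _ I t :=
      ((hm.mul hw).const_add ((EuclideanSpace.single j (1 : ℝ) : Coord n) α)).congr_of_eventuallyEq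
        ((eventually_mem_source hη.smooth ht hp).mono fun s hs => hPs s hs.1 hs.2 α) (hPs t ht hp α)
    convert! h1 using 1
    have h2 : comp c (η t) q.1 α = Γ α j +
        (∑ β, pdv β (lagr L c) (c (η t)) (coordVelocity c η I t) * Γ β j) *
          coordVelocity c η I t α := by
      have h3 := comp_normalProjIn (v := velocity η I t) hL hc hp (hvv t ht)
        (WithLp.toLp 2 fun α => Γ α j) α
      rw [phase_velocity hc hη.smooth hI ht hp] at h3
      exact h3
    have h4 : ∑ β, pdv β (lagr L c) (c (η t)) (coordVelocity c η I t) * Γ β j =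
        pdx j (lagr L c) (c (η t)) (coordVelocity c η I t) := by
      simp only [hΓ, connMatrix, phase_velocity hc hη.smooth hI ht hp, Matrix.of_apply]
      exact hℓ.sum_pdv_mul_conn hps.1 hps.2 j
    have h5 : ∑ γ, Γ α γ * comp c (η t) (P t).1 γ = Γ α j +
        pdv j (lagr L c) (c (η t)) (coordVelocity c η I t) *
          (2 * spray (lagr L c) α (c (η t)) (coordVelocity c η I t)) := by
      simp only [hPs t ht hp, mul_add, Finset.sum_add_distrib]
      congr 1
      · simp
      · rw [← hℓ.sum_conn_mul hps.1 hps.2, Finset.mul_sum]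
        refine Finset.sum_congr rfl fun γ _ => ?_
        simp only [hΓ, connMatrix, phase_velocity hc hη.smooth hI ht hp, Matrix.of_apply]
        ring
    rw [h2, h4, h5]
    ring
  have h := (hasCovDerivIn_iff hc hη.smooth hI ht hp).1 (hE c hc t ht hp P q hP) α
  have h1 : (fun s => normalMatrix L c (velocity η I s) (E s) α j) =
      fun s => comp c (η s) (E s (P s)).1 α := funext fun s => normalMatrix_apply (E s) α j
  beta_reduce
  rw [h1]
  convert! h using 1
  have h2 : comp c (η t) (E' t (P t) + E t q).1 α = comp c (η t) (E' t (P t)).1 α +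
      comp c (η t) (E t q).1 α := by
    exact congrArg (fun u : Coord n => u α)
      (map_add (mfderiv (𝓡 (n + 1)) (𝓡 (n + 1)) c (η t)) (E' t (P t)).1 (E t q).1)
  have h3 : comp c (η t) (E t q).1 α = _ := (sum_normalMatrix_mul (E t) _ α).symm
  rw [h2, h3, Matrix.sub_apply, Matrix.sub_apply, Matrix.mul_apply, Matrix.mul_apply]
  have h4 : comp c (η t) (E' t (P t)).1 α = _ := (normalMatrix_apply (E' t) α j).symm
  have h5 (γ) : comp c (η t) (E t (P t)).1 γ = _ := (normalMatrix_apply (E t) γ j).symm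
  simp only [h4, h5]
  ring

end CovariantDerivative

/-! ### The Riccati equation of a Lagrange tensor field -/

section Riccati

variable {n : ℕ} {M : Type*} [TopologicalSpace M] [ChartedSpace (Coord n) M]
  {L : TM n M → ℝ} {η : ℝ → M} {I : Set ℝ} {t : ℝ}

instance finite_normalSpace (v : TM n M) : Module.Finite ℝ (normalSpace L v) :=
  have : FiniteDimensional ℝ (TangentSpace (𝓡 (n + 1)) v.proj) :=
    inferInstanceAs (FiniteDimensional ℝ (Coord n))
  inferInstance

lemma isTensorDeriv_one : IsTensorDeriv L η I (fun _ => 1) (fun _ => 0) := by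
  intro c _ t _ _ P q h
  have h1 : ((0 : Module.End ℝ (normalSpace L (velocity η I t))) (P t) +
      (1 : Module.End ℝ (normalSpace L (velocity η I t))) q).1 = q.1 := by simp
  exact h1 ▸ h

variable [IsManifold (𝓡 (n + 1)) ∞ M]

/-- The Riccati equation for the endomorphism `B = J' J⁻¹` of a nonsingular Jacobi tensor field, in
the form of its trace: `tr B` is the logarithmic derivative of `det J`, and
`(tr B)' = -Ric - tr (B²)`. -/
lemma IsJacobiTensor.riccati (hL : IsLorentzFinsler L) (hη : IsGeodesicOn L η I)
    (hI : UniqueDiffOn ℝ I) (hunit : ∀ s ∈ I, L (velocity η I s) = -1 / 2)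
    {J J' : NormalEnd L η I} (hJ : IsJacobiTensor L η I J J') (hJu : ∀ s ∈ I, IsUnit (J s))
    (ht : t ∈ I) :
    HasDerivWithinAt (fun s => LinearMap.det (J s))
      (LinearMap.det (J t) * LinearMap.trace ℝ _ (J' t * Ring.inverse (J t))) I t ∧
    HasDerivWithinAt (fun s => LinearMap.trace ℝ _ (J' s * Ring.inverse (J s)))
      (-ric L (velocity η I t) -
        LinearMap.trace ℝ _ (J' t * Ring.inverse (J t) * (J' t * Ring.inverse (J t)))) I t := by
  set c := chartAt (Coord n) (η t) with hcdef
  have hc : c ∈ charts n M := chartAt_mem_charts _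
  have hp : η t ∈ c.source := mem_chart_source _ _
  have hv0 (s) (hs : s ∈ I) : (velocity η I s : TM n M).2 ≠ 0 :=
    ne_zero_of_neg hL (by rw [hunit s hs]; norm_num)
  have hvv (s) (hs : s ∈ I) :
      metric L (velocity η I s) (velocity η I s).2 (velocity η I s).2 = -1 := by
    rw [metric_self hL (hv0 s hs), hunit s hs]
    norm_num
  have hℓ := isCoordLagrangian_lagr hc hL
  have hps := phase_mem_slit hc hp (hv0 t ht)
  let m (s : ℝ) (E : Module.End ℝ (normalSpace L (velocity η I s))) :=
    normalMatrix L c (velocity η I s) E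
  -- `J` is extended by the identity on the line spanned by the velocity, so as to be invertible;
  -- `J'` is extended by zero
  let A (s : ℝ) := m s (J s) + (1 - m s 1)
  let A₁ (s : ℝ) := m s (J' s)
  let Γ := connMatrix L c (velocity η I t)
  let R : Matrix (Fin (n + 1)) (Fin (n + 1)) ℝ :=
    Matrix.of fun α β =>
      curv (lagr L c) α β (phase c (velocity η I t)).1 (phase c (velocity η I t)).2
  obtain ⟨J'', hJ'', heq⟩ := hJ.equation
  have hid (s) (hs : s ∈ I) (hsc : η s ∈ c.source) :
      normalProjIn L c (velocity η I s) ∘ₗ normalIncl L c (velocity η I s) = LinearMap.id :=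
    normalProjIn_normalIncl hc hsc (hvv s hs)
  have hmul (s) (hs : s ∈ I) (hsc : η s ∈ c.source) (E F) : m s (E * F) = m s E * m s F :=
    extMatrix_mul (hid s hs hsc) E F
  have hev := eventually_mem_source hη.smooth ht hp
  have hdetA (s) (hs : s ∈ I) (hsc : η s ∈ c.source) : (A s).det = LinearMap.det (J s) :=
    det_extMatrix (hid s hs hsc) (J s)
  have hinv (s) (hs : s ∈ I) (hsc : η s ∈ c.source) :
      A₁ s * (A s)⁻¹ = m s (J' s * Ring.inverse (J s)) := by
    have h1 : A s * (m s (Ring.inverse (J s)) + (1 - m s 1)) = 1 := by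
      have e1 : m s (J s) * m s (Ring.inverse (J s)) = m s 1 := by
        rw [← hmul s hs hsc, Ring.mul_inverse_cancel _ (hJu s hs)]
      have e2 : m s (J s) * m s 1 = m s (J s) := by rw [← hmul s hs hsc, mul_one]
      have e3 : m s 1 * m s (Ring.inverse (J s)) = m s (Ring.inverse (J s)) := by
        rw [← hmul s hs hsc, one_mul]
      have e4 : m s 1 * m s 1 = m s 1 := by rw [← hmul s hs hsc, mul_one]
      simp only [A, add_mul, mul_add, sub_mul, mul_sub, one_mul, mul_one, e1, e2, e3, e4]
      abel
    rw [Matrix.inv_eq_right_inv h1, mul_add, mul_sub, mul_one, ← hmul s hs hsc, ← hmul s hs hsc,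
      mul_one, sub_self, add_zero]
  have h1 : MatDerivWithin (fun s => m s 1) (-(Γ * m t 1 - m t 1 * Γ)) I t := by
    have h := isTensorDeriv_one.matDerivWithin hL hη hI hunit hc ht hp
    have h0 : normalMatrix L c (velocity η I t) 0 = 0 := by
      rw [normalMatrix, extMatrix, LinearMap.zero_comp, LinearMap.comp_zero, map_zero]
    rw [h0, zero_sub] at h
    exact h
  have hA : MatDerivWithin A (A₁ t - (Γ * A t - A t * Γ)) I t := by
    have h := (hJ.deriv.matDerivWithin hL hη hI hunit hc ht hp).add
      (MatDerivWithin.sub (A := fun _ => 1) (A' := 0) (fun i j => hasDerivWithinAt_const t I _) h1)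
    convert! h using 1
    simp only [A, A₁, m, Γ, mul_add, add_mul, mul_sub, sub_mul, mul_one, one_mul]
    abel
  -- the curvature endomorphism annihilates the velocity, which spans the complement
  have hR : m t (J'' t) = -(R * A t) := by
    have h2 : R * (1 - m t 1) = 0 := by
      ext α j
      have h3 (β) : (1 - m t 1) β j =
          -(pdv j (lagr L c) (phase c (velocity η I t)).1 (phase c (velocity η I t)).2 *
            (phase c (velocity η I t)).2 β) := by
        have h4 : m t 1 β j = _ := (normalMatrix_apply (c := c)
          (1 : Module.End ℝ (normalSpace L (velocity η I t))) β j).trans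
            (comp_normalProjIn hL hc hp (hvv t ht) (EuclideanSpace.single j 1) β)
        rw [Matrix.sub_apply, h4, Matrix.one_apply]
        simp
      rw [Matrix.mul_apply, Matrix.zero_apply]
      simp only [h3]
      calc _ = -pdv j (lagr L c) (phase c (velocity η I t)).1 (phase c (velocity η I t)).2 *
            ∑ β, R α β * (phase c (velocity η I t)).2 β := by
            rw [Finset.mul_sum]
            exact Finset.sum_congr rfl fun β _ => by ring
        _ = 0 := by
            have h5 : ∑ β, R α β * (phase c (velocity η I t)).2 β = 0 :=
              hℓ.sum_curv_mul hps.1 hps.2 α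
            rw [h5, mul_zero]
    have h3 : R * A t = R * m t (J t) := by rw [mul_add, h2, add_zero]
    rw [h3]
    ext α j
    have h4 := heq c hc t ht hp (normalProjIn L c (velocity η I t) (EuclideanSpace.single j 1)) α
    have h5 := normalMatrix_apply (c := c) (J'' t) α j
    have h6 (β) := normalMatrix_apply (c := c) (J t) β j
    rw [Matrix.neg_apply, Matrix.mul_apply]
    simp only [m, R, h5, h6, Matrix.of_apply, phase_velocity hc hη.smooth hI ht hp]
    exact eq_neg_of_add_eq_zero_left h4
  have hA₁ : MatDerivWithin A₁ (-(R * A t) - (Γ * A₁ t - A₁ t * Γ)) I t :=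
    hR ▸ hJ''.matDerivWithin hL hη hI hunit hc ht hp
  have hdet : (A t).det ≠ 0 := by
    rw [hdetA t ht hp]
    exact (LinearMap.isUnit_iff_isUnit_det _).1 (hJu t ht) |>.ne_zero
  obtain ⟨hd, htr⟩ := riccati_trace (hI t ht) hdet hA hA₁
  have htrace (s) (hs : s ∈ I) (hsc : η s ∈ c.source) : (A₁ s * (A s)⁻¹).trace =
      LinearMap.trace ℝ _ (J' s * Ring.inverse (J s)) := by
    rw [hinv s hs hsc]
    exact trace_extMatrix (hid s hs hsc) _
  constructor
  · rw [htrace t ht hp, hdetA t ht hp] at hd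
    exact hd.congr_of_eventuallyEq (hev.mono fun s hs => (hdetA s hs.1 hs.2).symm)
      (hdetA t ht hp).symm
  · have h2 : (A₁ t * (A t)⁻¹ * (A₁ t * (A t)⁻¹)).trace =
        LinearMap.trace ℝ _ (J' t * Ring.inverse (J t) * (J' t * Ring.inverse (J t))) := by
      rw [hinv t ht hp, ← hmul t ht hp]
      exact trace_extMatrix (hid t ht hp) _
    rw [h2] at htr
    exact htr.congr_of_eventuallyEq (hev.mono fun s hs => (htrace s hs.1 hs.2).symm)
      (htrace t ht hp).symm

/-- Raychaudhuri's inequality: for a Lagrange tensor field, the endomorphism `J' J⁻¹` is symmetric,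
so that the square of its trace is at most `n` times the trace of its square. -/
lemma IsLagrangeTensor.exists_expansion (hL : IsLorentzFinsler L) (hη : IsGeodesicOn L η I)
    (hI : UniqueDiffOn ℝ I) (hunit : ∀ s ∈ I, L (velocity η I s) = -1 / 2)
    {J : NormalEnd L η I} (hJ : IsLagrangeTensor L η I J) (hJu : ∀ s ∈ I, IsUnit (J s)) :
    ∃ θ κ : ℝ → ℝ, ∀ t ∈ I, HasDerivWithinAt (fun s => LinearMap.det (J s))
      (LinearMap.det (J t) * θ t) I t ∧
      HasDerivWithinAt θ (-ric L (velocity η I t) - κ t) I t ∧ θ t ^ 2 ≤ n * κ t := by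
  obtain ⟨J', hJac, hlag⟩ := hJ
  refine ⟨fun s => LinearMap.trace ℝ _ (J' s * Ring.inverse (J s)), fun s => LinearMap.trace ℝ _
    (J' s * Ring.inverse (J s) * (J' s * Ring.inverse (J s))), fun t ht => ?_⟩
  obtain ⟨h1, h2⟩ := hJac.riccati hL hη hI hunit hJu ht
  refine ⟨h1, h2, ?_⟩
  set v : TM n M := velocity η I t with hv
  have hneg : L v < 0 := by rw [hunit t ht]; norm_num
  let g : LinearMap.BilinForm ℝ (normalSpace L v) :=
    LinearMap.mk₂ ℝ (fun a b => metric L v a.1 b.1) (by simp) (by simp) (by simp) (by simp)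
  have hg (a b) : g a b = metric L v a.1 b.1 := rfl
  have h3 := sq_trace_le g ⟨fun a b => metric_symm hL (ne_zero_of_neg hL hneg) a.1 b.1⟩
    (fun w hw => metric_pos_of_mem_normalSpace hL hneg w.2 (by simpa using hw))
    (J' t * Ring.inverse (J t)) (fun a b => by
      have hu := Ring.mul_inverse_cancel _ (hJu t ht)
      obtain ⟨x, rfl⟩ : ∃ x, J t x = a := ⟨Ring.inverse (J t) a, DFunLike.congr_fun hu a⟩
      obtain ⟨y, rfl⟩ : ∃ x, J t x = b := ⟨Ring.inverse (J t) b, DFunLike.congr_fun hu b⟩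
      have hc (z) : Ring.inverse (J t) (J t z) = z :=
        DFunLike.congr_fun (Ring.inverse_mul_cancel _ (hJu t ht)) z
      have h4 := hlag t ht x y
      simp only [Module.End.mul_apply, hc, hg]
      linarith)
  rwa [finrank_normalSpace hL hneg] at h3

end Riccati

/-! ### The constant and the scalar inequality -/

section Scalar

variable {n : ℕ} {N : EReal} {ε : ℝ}

lemma sub_div_self_pos_of_range {x : ℝ} (hn : 1 ≤ n) (hN : x ≤ 0 ∨ (n : ℝ) ≤ x) (h0 : x ≠ 0)
    (h1 : x ≠ n) : 0 < (x - n) / x := by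
  have hn' : (1 : ℝ) ≤ n := by exact_mod_cast hn
  rcases hN with h | h
  · have : x < 0 := lt_of_le_of_ne h h0
    exact div_pos_of_neg_of_neg (by linarith) this
  · have : (n : ℝ) < x := lt_of_le_of_ne h (Ne.symm h1)
    exact div_pos (by linarith) (by linarith)

lemma exists_real_of_range (hN : (N ≠ ⊥ ∧ N ≤ 0) ∨ (n : EReal) ≤ N) (hN' : N ≠ ⊤) :
    ∃ x : ℝ, N = x ∧ (x ≤ 0 ∨ (n : ℝ) ≤ x) := by
  induction N with
  | bot => simp [(EReal.natCast_ne_bot n)] at hN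
  | top => exact absurd rfl hN'
  | coe x =>
    refine ⟨x, rfl, ?_⟩
    rw [← EReal.coe_natCast, EReal.coe_le_coe_iff] at hN
    exact hN.imp (fun h => EReal.coe_le_coe_iff.1 h.2) id

lemma cConst_pos (hn : 1 ≤ n) (hN : (N ≠ ⊥ ∧ N ≤ 0) ∨ (n : EReal) ≤ N)
    (hε : InTimelikeRange n N ε) : 0 < cConst n N ε := by
  have hn' : (0 : ℝ) < n := by exact_mod_cast hn
  rw [cConst]
  split_ifs with h0 h1
  · positivity
  · have h2 := (sq_lt_one_iff_abs_lt_one ε).2 (hε.2.1 h1)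
    have : 0 < 1 - ε ^ 2 := by linarith
    positivity
  · obtain ⟨x, rfl, hx⟩ := exists_real_of_range hN h1
    rw [EReal.toReal_coe]
    rw [EReal.coe_eq_zero] at h0
    suffices h : 0 < 1 - ε ^ 2 * ((x - n) / x) by positivity
    by_cases h2 : x = n
    · simp [h2]
    have hk := sub_div_self_pos_of_range hn hx h0 h2
    have h3 : |ε| < √(x / (x - n)) := by
      have := hε.2.2 (by simpa using h0) h1 fun h => h2 (EReal.coe_injective h)
      rwa [EReal.toReal_coe] at this
    have h4 := (Real.lt_sqrt (abs_nonneg ε)).1 h3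
    rw [sq_abs, ← inv_div] at h4
    have h5 := mul_lt_mul_of_pos_right h4 hk
    rw [inv_mul_cancel₀ hk.ne'] at h5
    linarith

/-- The scalar inequality behind the comparison, for real `N = x ≠ 0, n`. It is applied to the first
derivative `a` of the weight, the logarithmic derivative `u` of `|det J_ψ|` and `k = tr (B²)`, where
`u + a = tr B`. -/
lemma comparison_scalar_le {x a u k : ℝ} (hn : 1 ≤ n) (hk : 0 < (x - n) / x) (hx : x ≠ 0)
    (hκ : (u + a) ^ 2 ≤ n * k) :
    2 * (1 - ε) / n * a * u - k + 1 / n * (1 - ε ^ 2 * ((x - n) / x)) * u ^ 2 ≤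
      a ^ 2 / (x - n) := by
  have hn' : (0 : ℝ) < n := by exact_mod_cast hn
  have hxn : x - n ≠ 0 := fun h => by simp [h] at hk
  have h1 : (u + a) ^ 2 / n ≤ k := by rwa [div_le_iff₀' hn']
  have h2 : 0 ≤ (a + ε * ((x - n) / x) * u) ^ 2 / ((x - n) / x) / n := by positivity
  have h3 : (a + ε * ((x - n) / x) * u) ^ 2 / ((x - n) / x) / n =
      a ^ 2 / (x - n) - (2 * (1 - ε) / n * a * u - (u + a) ^ 2 / n
        + 1 / n * (1 - ε ^ 2 * ((x - n) / x)) * u ^ 2) := by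
    field_simp
    ring
  linarith

end Scalar

section Comparison

variable {n : ℕ} {M : Type*} [TopologicalSpace M] [ChartedSpace (Coord n) M] {N : EReal} {ε : ℝ}

/-- The comparison inequality in terms of the weighted Ricci curvature of `φ v`. -/
lemma le_neg_mul_ricN {L ψ : TM n M → ℝ} {v : TM n M} {φ ξ a b u k r : ℝ} (hn : 1 ≤ n)
    (hN : (N ≠ ⊥ ∧ N ≤ 0) ∨ (n : EReal) ≤ N) (hε : InTimelikeRange n N ε) (hφ : 0 < φ) (hξ : 0 < ξ)
    (hr : ric L v = φ ^ 2 * r) (ha : deriv (psiAlong ψ (geodesicFrom L v) univ) 0 = φ * a)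
    (hb : deriv (deriv (psiAlong ψ (geodesicFrom L v) univ)) 0 = φ ^ 2 * b)
    (hκ : (u + a) ^ 2 ≤ n * k) :
    ((φ ^ 2 * (cConst n N ε * ξ) *
      (2 * (1 - ε) / n * a * u + (-r - k - b) + cConst n N ε * u ^ 2) : ℝ) : EReal) ≤
      -(((cConst n N ε * ξ : ℝ) : EReal) * ricN L ψ N v) := by
  have hn' : (0 : ℝ) < n := by exact_mod_cast hn
  have hc := cConst_pos hn hN hε
  -- it suffices to bound the part of the bracket without `r` and `b` by `a² / (N - n)`, or by zero
  -- if that term is absent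
  have key (w : ℝ) (hw : 2 * (1 - ε) / n * a * u - k + cConst n N ε * u ^ 2 ≤ w) :
      ((φ ^ 2 * (cConst n N ε * ξ) *
      (2 * (1 - ε) / n * a * u + (-r - k - b) + cConst n N ε * u ^ 2) : ℝ) : EReal) ≤
      -(((cConst n N ε * ξ : ℝ) : EReal) * ((φ ^ 2 * r + φ ^ 2 * b - φ ^ 2 * w : ℝ) : EReal)) := by
    rw [← EReal.coe_mul, ← EReal.coe_neg, EReal.coe_le_coe_iff]
    have h1 : 0 ≤ φ ^ 2 * (cConst n N ε * ξ) := by positivity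
    nlinarith [mul_le_mul_of_nonneg_left hw h1]
  have h1 : (u + a) ^ 2 / n ≤ k := by rwa [div_le_iff₀' hn']
  simp only [ricN, hr, ha, hb]
  split_ifs with h2 h3 h4
  · have h0 : cConst n N ε = 1 / n * (1 - ε ^ 2) := by
      rw [cConst, if_neg (by rw [h2]; exact EReal.top_ne_zero), if_pos h2]
    have := key 0 (by
      rw [h0]
      have h3 : 0 ≤ (a + ε * u) ^ 2 / n := by positivity
      have h4 : (a + ε * u) ^ 2 / n = -(2 * (1 - ε) / n * a * u - (u + a) ^ 2 / n +
          1 / n * (1 - ε ^ 2) * u ^ 2) := by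
        field_simp
        ring
      linarith)
    simpa using this
  · have h0 : cConst n N ε = 1 / n := by
      have h5 : N ≠ 0 := by
        rw [h3]
        exact_mod_cast (by omega : n ≠ 0)
      rw [cConst, if_neg h5, if_neg h2, h3, ← EReal.coe_natCast, EReal.toReal_coe]
      simp
    have ha0 : a = 0 := (mul_eq_zero.1 h4).resolve_left hφ.ne'
    have := key 0 (by
      rw [h0]
      rw [ha0, add_zero] at h1
      have h4 : 1 / n * u ^ 2 = u ^ 2 / (n : ℝ) := by ring
      rw [ha0]
      linarith)
    simpa using this
  · rw [EReal.coe_mul_bot_of_pos (by positivity), EReal.neg_bot]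
    exact le_top
  · obtain ⟨x, rfl, hx⟩ := exists_real_of_range hN h2
    have hxn : x ≠ n := fun h => h3 (by rw [h, EReal.coe_natCast])
    have := key (a ^ 2 / (x - n)) (by
      by_cases hx0 : x = 0
      · have h5 : ε = 0 := hε.1 (by simp [hx0])
        have h0 : cConst n x ε = 1 / n := by rw [cConst, if_pos (by simp [hx0])]
        rw [h0, h5, hx0]
        have h4 : 2 * (1 - 0) / n * a * u - (u + a) ^ 2 / n + 1 / n * u ^ 2 = a ^ 2 / (0 - n) := by
          rw [zero_sub, div_neg]
          field_simp
          ring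
        linarith
      · have h0 : cConst n x ε = 1 / n * (1 - ε ^ 2 * ((x - n) / x)) := by
          rw [cConst, if_neg (by simpa using hx0), if_neg h2, EReal.toReal_coe]
        rw [h0]
        exact comparison_scalar_le hn (sub_div_self_pos_of_range hn hx hx0 hxn) hx0 hκ)
    rw [EReal.toReal_coe, mul_pow, mul_div_assoc (φ ^ 2)]
    exact this

end Comparison

section Calculus

variable {I : Set ℝ} {τ : ℝ → ℝ}

/-- The second derivative with respect to an `ε`-proper time of a power of `e^{-ψ} |D|`, where `θ`
is the logarithmic derivative of `D`. -/
lemma starDeriv_rpow (hI : I.OrdConnected) (hI' : (interior I).Nonempty) {n : ℕ} {ε c : ℝ}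
    {f ξ a b D θ θ' : ℝ → ℝ} (hτ : IsProperTime n ε f I τ)
    (hf : ∀ t ∈ I, HasDerivWithinAt f (a t) I t)
    (ha : ∀ t ∈ I, HasDerivWithinAt a (b t) I t) (hD0 : ∀ t ∈ I, D t ≠ 0)
    (hD : ∀ t ∈ I, HasDerivWithinAt D (D t * θ t) I t)
    (hθ : ∀ t ∈ I, HasDerivWithinAt θ (θ' t) I t)
    (hξ : ∀ t ∈ I, ξ t = (Real.exp (-f t) * |D t|) ^ c) :
    DifferentiableOn ℝ (ξ ∘ tauInv τ I) (τ '' I) ∧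
    DifferentiableOn ℝ (starDeriv τ I ξ ∘ tauInv τ I) (τ '' I) ∧
    ∀ t ∈ I, starDeriv τ I (starDeriv τ I ξ) t = (Real.exp (2 * (ε - 1) / n * f t))⁻¹ ^ 2 *
      (c * ξ t) * (2 * (1 - ε) / n * a t * (θ t - a t) + (θ' t - b t) + c * (θ t - a t) ^ 2) := by
  have hρ : ∀ t, 0 < Real.exp (2 * (ε - 1) / n * f t) := fun t => Real.exp_pos _
  have hξ1 : ∀ t ∈ I, ξ t = Real.exp (c * (Real.log (D t) - f t)) := fun t ht => by
    rw [hξ t ht, ← Real.exp_log_eq_abs (hD0 t ht), ← Real.exp_add, ← Real.exp_mul]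
    ring_nf
  have hlog : ∀ t ∈ I, HasDerivWithinAt (fun s => Real.log (D s)) (θ t) I t := fun t ht => by
    convert! (hD t ht).log (hD0 t ht) using 1
    rw [mul_div_cancel_left₀ _ (hD0 t ht)]
  have hdξ : ∀ t ∈ I, HasDerivWithinAt ξ (c * (θ t - a t) * ξ t) I t := fun t ht => by
    have h := (((hlog t ht).sub (hf t ht)).const_mul c).exp
    refine (h.congr hξ1 (hξ1 t ht)).congr_deriv ?_
    rw [hξ1 t ht]
    simp only [Pi.sub_apply]
    ring
  have hs : ∀ t ∈ I, starDeriv τ I ξ t =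
      Real.exp (-(2 * (ε - 1) / n * f t)) * (c * (θ t - a t) * ξ t) := fun t ht => by
    rw [starDeriv_eq hI hI' hτ hρ ht (hdξ t ht), Real.exp_neg]
  have hds : ∀ t ∈ I, HasDerivWithinAt (starDeriv τ I ξ) (Real.exp (-(2 * (ε - 1) / n * f t)) *
      (c * ξ t) * (2 * (1 - ε) / n * a t * (θ t - a t) + (θ' t - b t) + c * (θ t - a t) ^ 2)) I t :=
    fun t ht => by
      have h1 := (((hf t ht).const_mul (2 * (ε - 1) / n)).fun_neg).exp
      have h2 := (((hθ t ht).fun_sub (ha t ht)).const_mul c).fun_mul (hdξ t ht)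
      refine ((h1.fun_mul h2).congr hs (hs t ht)).congr_deriv ?_
      ring
  refine ⟨differentiableOn_comp_tauInv hI hτ hρ fun t ht => (hdξ t ht).differentiableWithinAt,
    differentiableOn_comp_tauInv hI hτ hρ fun t ht => (hds t ht).differentiableWithinAt,
    fun t ht => ?_⟩
  rw [starDeriv_eq hI hI' hτ hρ ht (hds t ht), Real.exp_neg]
  ring

end Calculus

end LorentzFinsler

end

open LorentzFinsler in
theorem mainTheorem11 (n : ℕ) (hn : 1 ≤ n)
    {M : Type*} [TopologicalSpace M] [ChartedSpace (Coord n) M] [IsManifold (𝓡 (n + 1)) ∞ M]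
    (L : TM n M → ℝ) (hL : IsLorentzFinsler L)
    (T : ∀ x : M, TangentSpace (𝓡 (n + 1)) x) (hT : IsTimeOrientation L T)
    (ψ : TM n M → ℝ) (hψ : IsWeight L T ψ)
    (I : Set ℝ) (hI : I.OrdConnected) (hI' : (interior I).Nonempty)
    (η : ℝ → M) (hη : IsGeodesicOn L η I)
    (hfuture : ∀ t ∈ I, velocity η I t ∈ futureTimelike L T)
    (hunit : ∀ t ∈ I, L (velocity η I t) = -1 / 2)
    (J : NormalEnd L η I) (hJ : IsLagrangeTensor L η I J) (hJ' : ∀ t ∈ I, IsUnit (J t))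
    (N : EReal) (hN : (N ≠ ⊥ ∧ N ≤ 0) ∨ (n : EReal) ≤ N)
    (ε : ℝ) (hε : InTimelikeRange n N ε)
    (τ : ℝ → ℝ) (hτ : IsProperTime n ε (psiAlong ψ η I) I τ)
    (ξ : ℝ → ℝ) (hξ : ξ = xi L ψ η I J (cConst n N ε)) :
    0 < cConst n N ε ∧
    DifferentiableOn ℝ (ξ ∘ tauInv τ I) (τ '' I) ∧
    DifferentiableOn ℝ (starDeriv τ I ξ ∘ tauInv τ I) (τ '' I) ∧
    ∀ t ∈ I, ((starDeriv τ I (starDeriv τ I ξ) t : ℝ) : EReal) ≤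
      -(((cConst n N ε * ξ t : ℝ) : EReal) * ricN L ψ N (starVelocity τ I η t)) := by
  have hn' : (0 : ℝ) < n := by exact_mod_cast hn
  have hIu := uniqueDiffOn_of_ordConnected hI hI'
  have hneg : ∀ t ∈ I, L (velocity η I t) < 0 := fun t ht => by rw [hunit t ht]; norm_num
  obtain ⟨θ, κ, hθ⟩ := hJ.exists_expansion hL hη hIu hunit hJ'
  set f := psiAlong ψ η I with hf
  set ρ : ℝ → ℝ := fun t => Real.exp (2 * (ε - 1) / n * f t) with hρdef
  have hρ : ∀ t, 0 < ρ t := fun t => Real.exp_pos _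
  -- the derivatives of the weight along `η` and along the geodesics which define `Ric_N`
  have hw (t) (ht : t ∈ I) : HasDerivWithinAt f (derivWithin f I t) I t ∧
      HasDerivWithinAt (derivWithin f I) (derivWithin (derivWithin f I) I t) I t ∧
      deriv (psiAlong ψ (geodesicFrom L (scale (ρ t)⁻¹ (velocity η I t))) univ) 0 =
        (ρ t)⁻¹ * derivWithin f I t ∧
      deriv (deriv (psiAlong ψ (geodesicFrom L (scale (ρ t)⁻¹ (velocity η I t))) univ)) 0 =
        (ρ t)⁻¹ ^ 2 * derivWithin (derivWithin f I) I t := by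
    obtain ⟨a, b, h1, h2, h3, h4⟩ := weight_derivatives_smul_velocity hL hT hψ hη hIu ht
      (hfuture t ht) (inv_pos.2 (hρ t))
    rw [h1.derivWithin (hIu t ht), h2.derivWithin (hIu t ht)]
    exact ⟨h1, h2, h3, h4⟩
  have hdet (t) (ht : t ∈ I) : LinearMap.det (J t) ≠ 0 :=
    ((LinearMap.isUnit_iff_isUnit_det _).1 (hJ' t ht)).ne_zero
  have hξ1 (t) (ht : t ∈ I) :
      ξ t = (Real.exp (-f t) * |LinearMap.det (J t)|) ^ cConst n N ε := by
    rw [hξ, xi, LinearMap.det_smul, finrank_normalSpace hL (hneg t ht), abs_mul, ← Real.exp_nat_mul,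
      abs_of_pos (Real.exp_pos _), mul_div_cancel₀ _ hn'.ne']
  obtain ⟨hd1, hd2, hd3⟩ := starDeriv_rpow hI hI' hτ (fun t ht => (hw t ht).1)
    (fun t ht => (hw t ht).2.1) hdet (fun t ht => (hθ t ht).1) (fun t ht => (hθ t ht).2.1) hξ1
  refine ⟨cConst_pos hn hN hε, hd1, hd2, fun t ht => ?_⟩
  have hξ0 : 0 < ξ t := by
    rw [hξ1 t ht]
    exact Real.rpow_pos_of_pos (mul_pos (Real.exp_pos _) (abs_pos.2 (hdet t ht))) _
  rw [hd3 t ht, starVelocity_eq hI hI' hτ hρ ht hη.smooth]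
  have h := le_neg_mul_ricN (u := θ t - derivWithin f I t) (k := κ t) hn hN hε
    (inv_pos.2 (hρ t)) hξ0 (ric_smul hL (ne_zero_of_neg hL (hneg t ht)) (inv_pos.2 (hρ t)))
    (hw t ht).2.2.1 (hw t ht).2.2.2 (by rw [sub_add_cancel]; exact (hθ t ht).2.2)
  convert! h using 2
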